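/- Let $k\ge 3$, $m\ge 1$, and let $f^+,g^+:\mathbb{R}^2\times\mathbb{R}^m\to\mathbb{R}$ be $C^k$. Consider the $\mathbb{Z}_2$-symmetric Filippov system with discontinuity boundary $\Sigma=\{y=0\}$, $$(\dot x,\dot y)=\begin{cases}Z^+(x,y;\alpha)=(f^+(x,y;\alpha),\,g^+(x,y;\alpha)), & y>0,\\ Z^-(x,y;\alpha)=(-f^+(-x,-y;\alpha),\,-g^+(-x,-y;\alpha)), & y<0,\end{cases}$$ whose solutions are understood in the sense of Filippov. Write $g^\pm$ for the second component of $Z^\pm$. The crossing set is $\Sigma^c=\{p\in\Sigma: g^+g^->0\}$ and the sliding set is $\Sigma^s=\{p\in\Sigma: g^+g^-\le 0\}$, with boundary $\partial\Sigma^s=\{p\in\Sigma: g^+g^-=0\}$; a sliding segment is stable if $g^+<0<g^-$ on it. A point of $\Sigma$ is a tangent point of a subsystem if its vector field $Z^\pm$ is nonzero there with $g^\pm=0$, and it is then a visible fold if in addition the second Lie derivative of $h(x,y)=y$ along $Z^\pm$ is positive (upper subsystem), respectively negative (lower subsystem). A cycle is a periodic orbit that is isolated among all periodic orbits. A *crossing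 cycle* visits both sides of $\Sigma$ and meets $\Sigma$ only in $\Sigma^c$. A *critical crossing cycle* visits both sides, contains a tangent point and meets $\Sigma$ only in $\Sigma^c\cup\partial\Sigma^s$. A *sliding cycle* contains a tangent point and a segment of $\Sigma^s$ of nonzero length; it is stable if its sliding segments are stable. Assume: * (H0) there are $a>0$, $\tau_0>0$ such that the solution $\gamma_0^+$ of the upper subsystem with $\alpha=0$ and $\gamma_0^+(0)=(-a,0)$ satisfies $\gamma_0^+(\tau_0)=(a,0)$ and lies in $\{y>0\}$ for $0<t<\tau_0$; * (H1) $g^+(-a,0;0)=0$ and $f^+(-a,0;0)\,g^+_x(-a,0;0)>0$; * (H2) $g^+(a,0;0)<0$. Let $\Gamma_0$ be the union of the arc $\gamma_0^+([0,\tau_0])$ and its image under $(x,y)\mapsto(-x,-y)$. Put $$\lambda(t)=\exp\Big(\int_t^{\tau_0}(f^+_x+g^+_y)(\gamma_0^+(s);0)\,ds\Big),\qquad \kappa_i=\int_0^{\tau_0}\lambda(t)\,(f^+g^+_{\alpha_i}-g^+f^+_{\alpha_i})(\gamma_0^+(t);0)\,dt,$$ $$\theta_i=-\frac{\kappa_i}{g^+(a,0;0)}-\frac{g^+_{\alpha_i}(-a,0;0)}{g^+_x(-a,0;0)},\qquad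 i=1,\dots,m,$$ and suppose $(\theta_1,\dots,\theta_m)\neq 0$. Write $s=f^+(-a,0;0)$. Then there is a neighborhood $A_0$ of $\Gamma_0$ such that for every neighborhood $\mathcal A\subseteq A_0$ of $\Gamma_0$ (in particular for every sufficiently small annulus around $\Gamma_0$) there are an open neighborhood $U$ of $\alpha=0$, a $C^k$ diffeomorphism $\beta=\rho(\alpha)=(\rho_1(\alpha),\dots,\rho_m(\alpha))$ from $U$ onto an open set $V$ with $\rho(0)=0$ and $$\beta_1=\rho_1(\alpha)=\sum_{i=1}^m\theta_i\alpha_i+O(\|\alpha\|^2)\quad(\alpha\to0),$$ and a $C^k$ function $r:U\to\mathbb{R}$ with $r(0)=a$, such that for every $\beta\in V$ the system with parameter $\alpha=\rho^{-1}(\beta)$ has the following properties, where $r=r(\alpha)$. * **Dynamics on $\Sigma$.** The point $(-r,0)\in\mathcal A$ is a visible fold of the upper subsystem and a regular point ($g^-\neq0$) of the lower one. The points $(x,0)\in\mathcal A$ with $x<0$ are upward crossing points ($g^+>0$, $g^->0$) if $s(x+r)>0$, and points of a stable sliding segment if $s(x+r)<0$; the sliding motion there is rightward if $s>0$ and leftward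 if $s<0$. The situation on the part of $\mathcal A\cap\Sigma$ with $x>0$ is the symmetric one, with $(r,0)\in\mathcal A$ a visible fold of the lower subsystem and a regular point of the upper one. * **If $s\beta_1<0$**, the only periodic orbit contained in $\mathcal A$ is a crossing cycle. It is hyperbolic and stable (its Poincaré return map has a multiplier of modulus less than $1$), and it meets $\Sigma$ exactly in two points $(\pm\xi,0)$, where $0<\xi<r$ if $s>0$ and $\xi>r$ if $s<0$. * **If $\beta_1=0$**, the only periodic orbit contained in $\mathcal A$ is a critical crossing cycle. It meets $\Sigma$ exactly in the two regular-folds $(\pm r,0)$, and it is asymptotically orbitally stable from the inside if $s>0$ and from the outside if $s<0$. * **If $s\beta_1>0$**, the only periodic orbit contained in $\mathcal A$ is a sliding cycle. It is stable, and it meets $\Sigma$ exactly in the points $(x,0)$ for which $|x|$ lies in the closed interval between $r$ and some $\eta>0$, where $\eta>r$ if $s>0$ and $\eta<r$ if $s<0$; so it slides on both sliding segments. -/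

import Mathlib

open Set Filter Topology MeasureTheory

noncomputable section

/-! ### Planar Filippov systems with discontinuity boundary `Σ = {y = 0}`

Throughout, `Zp` is the vector field of the upper subsystem (valid on `Σ⁺ = {y > 0}`) and `Zm` that
of the lower subsystem (valid on `Σ⁻ = {y < 0}`).  As `Σ = {h = 0}` with `h (x, y) = y`, the
Lie derivative `Z h` is the second component of `Z`. -/

/-- The discontinuity boundary `Σ`, the `x`-axis. -/
def switchingLine : Set (ℝ × ℝ) := {p | p.2 = 0}

/-- The crossing set `Σᶜ`. -/
def crossingSet (Zp Zm : ℝ × ℝ → ℝ × ℝ) : Set (ℝ × ℝ) :=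
  {p | p.2 = 0 ∧ 0 < (Zp p).2 * (Zm p).2}

/-- The sliding set `Σˢ`. -/
def slidingSet (Zp Zm : ℝ × ℝ → ℝ × ℝ) : Set (ℝ × ℝ) :=
  {p | p.2 = 0 ∧ (Zp p).2 * (Zm p).2 ≤ 0}

/-- The boundary `∂Σˢ`, the points of `Σ` at which one of the normal components vanishes. -/
def slidingBoundary (Zp Zm : ℝ × ℝ → ℝ × ℝ) : Set (ℝ × ℝ) :=
  {p | p.2 = 0 ∧ (Zp p).2 * (Zm p).2 = 0}

/-- The interior of the sliding set relative to `Σ`. -/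
def slidingInterior (Zp Zm : ℝ × ℝ → ℝ × ℝ) : Set (ℝ × ℝ) :=
  {p | p.2 = 0 ∧ ∀ᶠ x in 𝓝 p.1, (x, (0 : ℝ)) ∈ slidingSet Zp Zm}

/-- The vector field that governs the sliding motion at a point where the two normal components
differ: the convex combination of `Zp` and `Zm` that is tangent to `Σ`. -/
def slidingField (Zp Zm : ℝ × ℝ → ℝ × ℝ) (p : ℝ × ℝ) : ℝ × ℝ :=
  ((Zp p).2 / ((Zp p).2 - (Zm p).2)) • Zm p + (1 - (Zp p).2 / ((Zp p).2 - (Zm p).2)) • Zp p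

/-- `p` is a tangent point of the subsystem with vector field `Z`. -/
def IsTangentPoint (Z : ℝ × ℝ → ℝ × ℝ) (p : ℝ × ℝ) : Prop :=
  p.2 = 0 ∧ Z p ≠ 0 ∧ (Z p).2 = 0

/-- The second Lie derivative `Z² h` of `h (x, y) = y`. -/
def secondLie (Z : ℝ × ℝ → ℝ × ℝ) (p : ℝ × ℝ) : ℝ := fderiv ℝ (fun q => (Z q).2) p (Z p)

/-- The set-valued right-hand side given by Filippov's convention. -/
def filippovSet (Zp Zm : ℝ × ℝ → ℝ × ℝ) (p : ℝ × ℝ) : Set (ℝ × ℝ) :=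
  {v | (0 < p.2 ∧ v = Zp p) ∨ (p.2 < 0 ∧ v = Zm p) ∨ (p.2 = 0 ∧ v ∈ segment ℝ (Zm p) (Zp p))}

/-- `γ` is a (Filippov) solution on the time interval `[s, t]`: it is absolutely continuous and its
velocity obeys Filippov's convention at almost every time.  Inside `Σ⁺` and `Σ⁻` this is an orbit
of the respective subsystem; on `Σ` the solution can stay only on the sliding set, where it obeys the
sliding system. -/
def IsSolution (Zp Zm : ℝ × ℝ → ℝ × ℝ) (γ : ℝ → ℝ × ℝ) (s t : ℝ) : Prop :=
  AbsolutelyContinuousOnInterval γ s t ∧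
    ∀ᵐ u : ℝ, u ∈ Ioo s t → ∃ v ∈ filippovSet Zp Zm (γ u), HasDerivAt γ v u

/-! ### Periodic orbits and cycles -/

/-- `Γ` is the orbit of a non-constant periodic solution. -/
def IsPeriodicOrbit (Zp Zm : ℝ × ℝ → ℝ × ℝ) (Γ : Set (ℝ × ℝ)) : Prop :=
  ∃ (γ : ℝ → ℝ × ℝ) (T : ℝ), 0 < T ∧ Function.Periodic γ T ∧ IsSolution Zp Zm γ 0 T ∧
    (∃ t, γ t ≠ γ 0) ∧ Γ = range γ

/-- `Γ` is isolated in the set of all periodic orbits. -/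
def IsIsolatedOrbit (Zp Zm : ℝ × ℝ → ℝ × ℝ) (Γ : Set (ℝ × ℝ)) : Prop :=
  ∃ N ∈ 𝓝ˢ Γ, ∀ Γ', IsPeriodicOrbit Zp Zm Γ' → Γ' ⊆ N → Γ' = Γ

/-- `Γ` occupies both `Σ⁺` and `Σ⁻`. -/
def OccupiesBothSides (Γ : Set (ℝ × ℝ)) : Prop :=
  (∃ p ∈ Γ, 0 < p.2) ∧ ∃ p ∈ Γ, p.2 < 0

/-- `Γ` contains a tangent point of one of the subsystems. -/
def ContainsTangentPoint (Zp Zm : ℝ × ℝ → ℝ × ℝ) (Γ : Set (ℝ × ℝ)) : Prop :=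
  ∃ p ∈ Γ, IsTangentPoint Zp p ∨ IsTangentPoint Zm p

/-- A crossing cycle: an isolated periodic orbit formed by regular orbits of both subsystems that
are concatenated only at points of `Σᶜ`. -/
def IsCrossingCycle (Zp Zm : ℝ × ℝ → ℝ × ℝ) (Γ : Set (ℝ × ℝ)) : Prop :=
  IsPeriodicOrbit Zp Zm Γ ∧ IsIsolatedOrbit Zp Zm Γ ∧ OccupiesBothSides Γ ∧
    Γ ∩ switchingLine ⊆ crossingSet Zp Zm

/-- A critical crossing cycle: an isolated tangential periodic orbit that occupies `Σ⁺` and `Σ⁻`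
and meets `Σ` only at points of `Σᶜ ∪ ∂Σˢ`. -/
def IsCriticalCrossingCycle (Zp Zm : ℝ × ℝ → ℝ × ℝ) (Γ : Set (ℝ × ℝ)) : Prop :=
  IsPeriodicOrbit Zp Zm Γ ∧ IsIsolatedOrbit Zp Zm Γ ∧ ContainsTangentPoint Zp Zm Γ ∧
    OccupiesBothSides Γ ∧ Γ ∩ switchingLine ⊆ crossingSet Zp Zm ∪ slidingBoundary Zp Zm

/-- A sliding cycle: an isolated tangential periodic orbit that contains a sliding segment of
non-zero length. -/
def IsSlidingCycle (Zp Zm : ℝ × ℝ → ℝ × ℝ) (Γ : Set (ℝ × ℝ)) : Prop :=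
  IsPeriodicOrbit Zp Zm Γ ∧ IsIsolatedOrbit Zp Zm Γ ∧ ContainsTangentPoint Zp Zm Γ ∧
    ∃ x₁ x₂ : ℝ, x₁ < x₂ ∧ ∀ x ∈ Icc x₁ x₂, (x, (0 : ℝ)) ∈ Γ ∩ slidingSet Zp Zm

/-! ### Stability -/

/-- A sliding cycle is stable if its sliding segments are stable, i.e. if both vector fields point
towards `Σ` on them. -/
def HasStableSliding (Zp Zm : ℝ × ℝ → ℝ × ℝ) (Γ : Set (ℝ × ℝ)) : Prop :=
  ∀ p ∈ Γ ∩ slidingInterior Zp Zm, (Zp p).2 < 0 ∧ 0 < (Zm p).2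

/-- `P` is, near `x₀`, the Poincaré first return map of a section `{(x, 0) : |x - x₀| < δ}`. -/
def IsReturnMapAt (Zp Zm : ℝ × ℝ → ℝ × ℝ) (x₀ : ℝ) (P : ℝ → ℝ) : Prop :=
  ∃ δ > 0, ∀ᶠ x in 𝓝 x₀, ∃ τ > 0,
    (∃ γ : ℝ → ℝ × ℝ, γ 0 = (x, 0) ∧ IsSolution Zp Zm γ 0 τ) ∧
    ∀ γ : ℝ → ℝ × ℝ, γ 0 = (x, 0) → IsSolution Zp Zm γ 0 τ →
      γ τ = (P x, 0) ∧ |P x - x₀| < δ ∧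
      ∀ t ∈ Ioo 0 τ, ¬ ((γ t).2 = 0 ∧ |(γ t).1 - x₀| < δ)

/-- `Γ` is hyperbolic and stable: it passes through a crossing point at which the return map has
a fixed point with multiplier of modulus less than one. -/
def IsHyperbolicallyStable (Zp Zm : ℝ × ℝ → ℝ × ℝ) (Γ : Set (ℝ × ℝ)) : Prop :=
  ∃ (x₀ : ℝ) (P : ℝ → ℝ) (μ : ℝ), (x₀, (0 : ℝ)) ∈ Γ ∩ crossingSet Zp Zm ∧
    IsReturnMapAt Zp Zm x₀ P ∧ P x₀ = x₀ ∧ HasDerivAt P μ x₀ ∧ |μ| < 1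

/-- The points enclosed by the closed curve `Γ`. -/
def insideOf (Γ : Set (ℝ × ℝ)) : Set (ℝ × ℝ) :=
  {p | p ∉ Γ ∧ Bornology.IsBounded (connectedComponentIn Γᶜ p)}

/-- The points that neither lie on the closed curve `Γ` nor are enclosed by it. -/
def outsideOf (Γ : Set (ℝ × ℝ)) : Set (ℝ × ℝ) :=
  {p | p ∉ Γ ∧ ¬ Bornology.IsBounded (connectedComponentIn Γᶜ p)}

/-- Asymptotic orbital stability of `Γ` with respect to initial points in `D`. -/
def IsStableFrom (Zp Zm : ℝ × ℝ → ℝ × ℝ) (D Γ : Set (ℝ × ℝ)) : Prop :=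
  (∀ V ∈ 𝓝ˢ Γ, ∃ W ∈ 𝓝ˢ Γ, ∀ (γ : ℝ → ℝ × ℝ) (T : ℝ), 0 ≤ T → IsSolution Zp Zm γ 0 T →
    γ 0 ∈ W ∩ D → γ T ∈ V) ∧
  ∃ W ∈ 𝓝ˢ Γ, ∀ γ : ℝ → ℝ × ℝ, (∀ T, 0 ≤ T → IsSolution Zp Zm γ 0 T) → γ 0 ∈ W ∩ D →
    Tendsto (fun t => Metric.infDist (γ t) Γ) atTop (𝓝 0)

/-! ### The codimension-one crossing-sliding bifurcation diagram

In the next definitions `s` is a number whose sign is that of `f⁺(-a, 0; 0)`, and `(-r, 0)` and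
`(r, 0)` are the positions of the two regular-folds. -/

/-- The dynamics on `A ∩ Σ` : each of the two parts of `A ∩ Σ` (in `x < 0` and in `x > 0`) is split
by a visible regular-fold into a crossing segment and a stable sliding segment, on which the sliding
motion is directed towards the fold. -/
structure SwitchingDynamics (Zp Zm : ℝ × ℝ → ℝ × ℝ) (A : Set (ℝ × ℝ)) (s r : ℝ) : Prop where
  left_mem : (-r, (0 : ℝ)) ∈ A
  left_fold : IsTangentPoint Zp (-r, 0) ∧ 0 < secondLie Zp (-r, 0) ∧ (Zm (-r, 0)).2 ≠ 0
  left_crossing : ∀ x < 0, (x, (0 : ℝ)) ∈ A → 0 < s * (x + r) →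
    0 < (Zp (x, 0)).2 ∧ 0 < (Zm (x, 0)).2
  left_sliding : ∀ x < 0, (x, (0 : ℝ)) ∈ A → s * (x + r) < 0 →
    ((Zp (x, 0)).2 < 0 ∧ 0 < (Zm (x, 0)).2) ∧ 0 < s * (slidingField Zp Zm (x, 0)).1
  right_mem : (r, (0 : ℝ)) ∈ A
  right_fold : IsTangentPoint Zm (r, 0) ∧ secondLie Zm (r, 0) < 0 ∧ (Zp (r, 0)).2 ≠ 0
  right_crossing : ∀ x > 0, (x, (0 : ℝ)) ∈ A → s * (x - r) < 0 →
    (Zp (x, 0)).2 < 0 ∧ (Zm (x, 0)).2 < 0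
  right_sliding : ∀ x > 0, (x, (0 : ℝ)) ∈ A → 0 < s * (x - r) →
    ((Zp (x, 0)).2 < 0 ∧ 0 < (Zm (x, 0)).2) ∧ s * (slidingField Zp Zm (x, 0)).1 < 0

/-- `Γ` is the only periodic orbit contained in `A`. -/
def IsOnlyPeriodicOrbitIn (Zp Zm : ℝ × ℝ → ℝ × ℝ) (A Γ : Set (ℝ × ℝ)) : Prop :=
  Γ ⊆ A ∧ ∀ Γ', IsPeriodicOrbit Zp Zm Γ' → Γ' ⊆ A → Γ' = Γ

/-- The only periodic orbit in `A` is a hyperbolic stable crossing cycle, meeting `Σ` in exactly two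
points `(±ξ, 0)`, which lie between the folds if `s > 0` and beyond them if `s < 0`. -/
def CrossingPhase (Zp Zm : ℝ × ℝ → ℝ × ℝ) (A : Set (ℝ × ℝ)) (s r : ℝ) : Prop :=
  ∃ Γ, IsCrossingCycle Zp Zm Γ ∧ IsHyperbolicallyStable Zp Zm Γ ∧
    (∃ ξ > 0, 0 < s * (r - ξ) ∧ Γ ∩ switchingLine = {(-ξ, 0), (ξ, 0)}) ∧
    IsOnlyPeriodicOrbitIn Zp Zm A Γ

/-- The only periodic orbit in `A` is a critical crossing cycle, meeting `Σ` exactly in the two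
folds, which is internally stable if `s > 0` and externally stable if `s < 0`. -/
def CriticalPhase (Zp Zm : ℝ × ℝ → ℝ × ℝ) (A : Set (ℝ × ℝ)) (s r : ℝ) : Prop :=
  ∃ Γ, IsCriticalCrossingCycle Zp Zm Γ ∧
    (0 < s → IsStableFrom Zp Zm (insideOf Γ) Γ) ∧ (s < 0 → IsStableFrom Zp Zm (outsideOf Γ) Γ) ∧
    Γ ∩ switchingLine = {(-r, 0), (r, 0)} ∧
    IsOnlyPeriodicOrbitIn Zp Zm A Γ

/-- The only periodic orbit in `A` is a stable sliding cycle, which slides on both sliding segments,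
between `(±η, 0)` and the folds `(±r, 0)`, and does not meet `Σ` elsewhere. -/
def SlidingPhase (Zp Zm : ℝ × ℝ → ℝ × ℝ) (A : Set (ℝ × ℝ)) (s r : ℝ) : Prop :=
  ∃ Γ, IsSlidingCycle Zp Zm Γ ∧ HasStableSliding Zp Zm Γ ∧
    (∃ η > 0, 0 < s * (η - r) ∧ Γ ∩ switchingLine = {p | p.2 = 0 ∧ |p.1| ∈ uIcc r η}) ∧
    IsOnlyPeriodicOrbitIn Zp Zm A Γ

/-! ### The `ℤ₂`-symmetric family -/

/-- The vector field of the upper subsystem. -/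
def upperField {m : ℕ} (f g : ℝ → ℝ → (Fin m → ℝ) → ℝ) (α : Fin m → ℝ) (p : ℝ × ℝ) : ℝ × ℝ :=
  (f p.1 p.2 α, g p.1 p.2 α)

/-- The vector field of the lower subsystem, determined by the symmetry about the origin. -/
def lowerField {m : ℕ} (f g : ℝ → ℝ → (Fin m → ℝ) → ℝ) (α : Fin m → ℝ) (p : ℝ × ℝ) : ℝ × ℝ :=
  (-f (-p.1) (-p.2) α, -g (-p.1) (-p.2) α)

/-- The partial derivative in `x`. -/
def partialX {m : ℕ} (f : ℝ → ℝ → (Fin m → ℝ) → ℝ) (p : ℝ × ℝ) (α : Fin m → ℝ) : ℝ :=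
  deriv (fun x => f x p.2 α) p.1

/-- The partial derivative in `y`. -/
def partialY {m : ℕ} (f : ℝ → ℝ → (Fin m → ℝ) → ℝ) (p : ℝ × ℝ) (α : Fin m → ℝ) : ℝ :=
  deriv (fun y => f p.1 y α) p.2

/-- The partial derivative in the parameter `αᵢ`. -/
def partialParam {m : ℕ} (f : ℝ → ℝ → (Fin m → ℝ) → ℝ) (i : Fin m) (p : ℝ × ℝ) (α : Fin m → ℝ) :
    ℝ :=
  deriv (fun u => f p.1 p.2 (Function.update α i u)) (α i)

/-- `λ(t) = exp (∫ₜ^τ₀ (f_x + g_y)(γ₀(u); 0) du)`. -/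
def lambdaCoeff {m : ℕ} (f g : ℝ → ℝ → (Fin m → ℝ) → ℝ) (γ₀ : ℝ → ℝ × ℝ) (τ₀ t : ℝ) : ℝ :=
  Real.exp (∫ u in t..τ₀, (partialX f (γ₀ u) 0 + partialY g (γ₀ u) 0))

/-- `κᵢ = ∫₀^τ₀ λ(t) (f g_{αᵢ} - g f_{αᵢ})(γ₀(t); 0) dt`. -/
def kappaCoeff {m : ℕ} (f g : ℝ → ℝ → (Fin m → ℝ) → ℝ) (γ₀ : ℝ → ℝ × ℝ) (τ₀ : ℝ) (i : Fin m) : ℝ :=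
  ∫ t in (0 : ℝ)..τ₀, lambdaCoeff f g γ₀ τ₀ t *
    (f (γ₀ t).1 (γ₀ t).2 0 * partialParam g i (γ₀ t) 0 -
      g (γ₀ t).1 (γ₀ t).2 0 * partialParam f i (γ₀ t) 0)

/-- `θᵢ = - κᵢ / g(a, 0; 0) - g_{αᵢ}(-a, 0; 0) / g_x(-a, 0; 0)`. -/
def thetaCoeff {m : ℕ} (f g : ℝ → ℝ → (Fin m → ℝ) → ℝ) (γ₀ : ℝ → ℝ × ℝ) (a τ₀ : ℝ) (i : Fin m) :
    ℝ :=
  -(kappaCoeff f g γ₀ τ₀ i / g a 0 0) - partialParam g i (-a, 0) 0 / partialX g (-a, 0) 0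

/-- The closed curve `Γ₀` formed by the arc `γ₀([0, τ₀])` and its image under the symmetry. -/
def symmetricLoop (γ₀ : ℝ → ℝ × ℝ) (τ₀ : ℝ) : Set (ℝ × ℝ) :=
  γ₀ '' Icc 0 τ₀ ∪ (fun t => -γ₀ t) '' Icc 0 τ₀

end

/-! ### Absolutely continuous functions -/

section AbsolutelyContinuous

variable {F : Type*} [NormedAddCommGroup F]

/-! By the symmetry it is enough to follow a solution for half a turn, from the part of Σ near `(-a,
0)` to the part near `(a, 0)`, and then to apply `p ↦ -p`. Let `(-r, 0)` be the upper fold at the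
parameter α and σ the sign of `f (-a) 0 0`. Near the fold the lower field points upwards and all
motion above or along Σ drifts in the direction σ. So a solution from a point `(x, 0)` on the
sliding side has no choice but to slide to the fold and leave there along the upper orbit, while one
from the crossing side leaves at once. The half-return map is therefore `h x = Q (foldClamp σ r x)`,
where `foldClamp` is the projection to the half-line of the fold and the crossing points and `Q =
-P`, with `P` the hitting map of the upper flow.

Because the arc leaves Σ tangentially, ∂P/∂x vanishes at the base point. Hence `Q` has Lipschitz
constant 1/2 nearby, `foldClamp` is nonexpanding, and `h` is a contraction with exactly one fixed
point `x`. The loop through `x` is a periodic orbit, and any periodic orbit near Γ₀ produces a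
periodic point of `h`, which must be `x`. The fixed point is a crossing point, the fold or a sliding
point according to the sign of `σ * (Q (-r) + r)`, and `Q (-r) + r = -d(α)` with `d(α) = P(-r(α), α)
- r(α)`. The Melnikov identity and the implicit function theorem for `r` show that the gradient of
`d` at 0 is θ. As θ ≠ 0, `d` can be taken as the first coordinate β₁ of a C^k chart.

Three inputs are needed. `P` must be C^k, which follows from the implicit function theorem in a
space of paths (`exists_smooth_flow`). Filippov solutions, which are only absolutely continuous,
must be determined near the fold; sign arguments do this (`FoldCorner`). Every orbit that starts
near the loop must reach Σ near one of its ends (`FoldLoop.exists_entry`). For a single parameter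
these facts are collected in `LoopData`, from which the phase portraits are read off;
`FoldLoop.exists_loopData` supplies it for all small α.

Stability of the critical cycle comes from the same construction: at a parameter with β₁ = 0 the
cycle itself satisfies the hypotheses on Γ₀, so loop data around it provide arbitrarily small
trapping neighbourhoods. -/

theorem AbsolutelyContinuousOnInterval.congr {f g : ℝ → F} {a b : ℝ}
    (hf : AbsolutelyContinuousOnInterval f a b) (h : EqOn f g (uIcc a b)) :
    AbsolutelyContinuousOnInterval g a b := by
  rw [absolutelyContinuousOnInterval_iff] at hf ⊢
  intro ε hε
  obtain ⟨δ, hδ, H⟩ := hf ε hε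
  refine ⟨δ, hδ, fun E hE hs => ?_⟩
  have := H E hE hs
  rwa [Finset.sum_congr rfl fun i hi => ?_] at this
  rw [h (hE.1 i hi).1, h (hE.1 i hi).2]

/-- A nonexpanding change of variable that keeps disjoint intervals disjoint maps test families to
test families, so the same δ works. It is applied to clampings and to translations. -/
theorem AbsolutelyContinuousOnInterval.comp_of_uIoc_subset {f : ℝ → F} {a b c d : ℝ} {φ : ℝ → ℝ}
    (hf : AbsolutelyContinuousOnInterval f a b) (hmaps : MapsTo φ (uIcc c d) (uIcc a b))
    (hdist : ∀ s t, dist (φ s) (φ t) ≤ dist s t)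
    (hdisj : ∀ s t s' t', Disjoint (uIoc s t) (uIoc s' t') →
      Disjoint (uIoc (φ s) (φ t)) (uIoc (φ s') (φ t'))) :
    AbsolutelyContinuousOnInterval (f ∘ φ) c d := by
  rw [absolutelyContinuousOnInterval_iff] at hf ⊢
  intro ε hε
  obtain ⟨δ, hδ, H⟩ := hf ε hε
  refine ⟨δ, hδ, fun E hE hs => ?_⟩
  refine H (E.1, fun i => (φ (E.2 i).1, φ (E.2 i).2)) ⟨fun i hi => ?_, ?_⟩ ?_
  · exact ⟨hmaps (hE.1 i hi).1, hmaps (hE.1 i hi).2⟩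
  · intro i hi j hj hij
    exact hdisj _ _ _ _ (hE.2 hi hj hij)
  · exact lt_of_le_of_lt (Finset.sum_le_sum fun i _ => hdist _ _) hs

/-- On the whole interval `f x = f (min x b) + f (max x b) - f b`, and clamping preserves absolute
continuity. -/
theorem AbsolutelyContinuousOnInterval.trans {f : ℝ → F} {a b c : ℝ} (hab : a ≤ b) (hbc : b ≤ c)
    (h₁ : AbsolutelyContinuousOnInterval f a b) (h₂ : AbsolutelyContinuousOnInterval f b c) :
    AbsolutelyContinuousOnInterval f a c := by
  have e₁ : AbsolutelyContinuousOnInterval (f ∘ fun x => min x b) a c := by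
    refine h₁.comp_of_uIoc_subset ?_ ?_ ?_
    · intro x hx
      rw [uIcc_of_le (hab.trans hbc)] at hx
      rw [uIcc_of_le hab]
      exact ⟨le_min hx.1 hab, min_le_right _ _⟩
    · intro s t
      rw [Real.dist_eq, Real.dist_eq]
      simpa using abs_min_sub_min_le_max s b t b
    · intro s t s' t' h
      refine h.mono ?_ ?_ <;> intro u hu <;> simp only [mem_uIoc] at hu ⊢ <;> grind
  have e₂ : AbsolutelyContinuousOnInterval (f ∘ fun x => max x b) a c := by
    refine h₂.comp_of_uIoc_subset ?_ ?_ ?_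
    · intro x hx
      rw [uIcc_of_le (hab.trans hbc)] at hx
      rw [uIcc_of_le hbc]
      exact ⟨le_max_right _ _, max_le hx.2 hbc⟩
    · intro s t
      rw [Real.dist_eq, Real.dist_eq]
      simpa using abs_max_sub_max_le_max s b t b
    · intro s t s' t' h
      refine h.mono ?_ ?_ <;> intro u hu <;> simp only [mem_uIoc] at hu ⊢ <;> grind
  have e₃ : AbsolutelyContinuousOnInterval (fun _ : ℝ => f b) a c :=
    (LipschitzWith.const (f b)).lipschitzOnWith.absolutelyContinuousOnInterval
  refine ((e₁.add e₂).sub e₃).congr fun x _ => ?_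
  rcases le_total x b with h | h <;> simp [h]

theorem AbsolutelyContinuousOnInterval.comp_add_left {f : ℝ → F} {a b : ℝ} (s : ℝ)
    (h : AbsolutelyContinuousOnInterval f (s + a) (s + b)) :
    AbsolutelyContinuousOnInterval (fun t => f (s + t)) a b := by
  refine h.comp_of_uIoc_subset (φ := fun t => s + t) ?_ ?_ ?_
  · intro x hx
    rw [mem_uIcc] at hx ⊢
    grind
  · intro u v
    simp
  · intro u t u' t' h
    rw [Set.disjoint_left] at h ⊢
    intro x hx hx'
    refine h (a := x - s) ?_ ?_ <;> simp only [mem_uIoc] at hx hx' ⊢ <;> grind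

theorem AbsolutelyContinuousOnInterval.comp_lipschitz {G : Type*} [NormedAddCommGroup G]
    {f : ℝ → F} {a b : ℝ} {φ : F → G}
    (hf : AbsolutelyContinuousOnInterval f a b) (hφ : ∀ x y, dist (φ x) (φ y) ≤ dist x y) :
    AbsolutelyContinuousOnInterval (fun t => φ (f t)) a b := by
  rw [absolutelyContinuousOnInterval_iff] at hf ⊢
  intro ε hε
  obtain ⟨δ, hδ, H⟩ := hf ε hε
  refine ⟨δ, hδ, fun E hE hs => ?_⟩
  exact lt_of_le_of_lt (Finset.sum_le_sum fun i _ => hφ _ _) (H E hE hs)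

/-- An absolutely continuous function is the integral of its derivative. All quantitative
information on Filippov solutions enters through this estimate. -/
theorem AbsolutelyContinuousOnInterval.mul_le_sub_of_ae_le {f : ℝ → ℝ} {a b c : ℝ} (hab : a ≤ b)
    (hf : AbsolutelyContinuousOnInterval f a b)
    (h : ∀ᵐ u : ℝ, u ∈ Ioo a b → ∃ v, c ≤ v ∧ HasDerivAt f v u) : c * (b - a) ≤ f b - f a := by
  rw [← hf.integral_deriv_eq_sub]
  have : ∫ _ in a..b, c = c * (b - a) := by simp [mul_comm]
  rw [← this]
  refine intervalIntegral.integral_mono_ae_restrict hab (by simp) hf.intervalIntegrable_deriv ?_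
  have hb : ∀ᵐ u : ℝ, u ≠ b := by simp [ae_iff]
  have ha : ∀ᵐ u : ℝ, u ≠ a := by simp [ae_iff]
  rw [EventuallyLE, ae_restrict_iff' measurableSet_Icc]
  filter_upwards [h, ha, hb] with u hu hua hub hmem
  obtain ⟨v, hcv, hv⟩ := hu ⟨lt_of_le_of_ne hmem.1 hua.symm, lt_of_le_of_ne hmem.2 hub⟩
  rw [hv.deriv]
  exact hcv

end AbsolutelyContinuous

/-! ### First and last times -/

theorem exists_first_nonpos {f : ℝ → ℝ} {s u : ℝ} (hsu : s ≤ u) (hf : ContinuousOn f (Icc s u))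
    (hu : f u ≤ 0) : ∃ z ∈ Icc s u, f z ≤ 0 ∧ ∀ w ∈ Ico s z, 0 < f w := by
  have hcl : IsClosed (Icc s u ∩ f ⁻¹' Iic 0) :=
    hf.preimage_isClosed_of_isClosed isClosed_Icc isClosed_Iic
  have hcomp : IsCompact (Icc s u ∩ f ⁻¹' Iic 0) :=
    isCompact_Icc.of_isClosed_subset hcl inter_subset_left
  obtain ⟨z, hz, hmin⟩ := hcomp.exists_isLeast ⟨u, right_mem_Icc.2 hsu, hu⟩
  refine ⟨z, hz.1, hz.2, fun w hw => ?_⟩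
  by_contra hcon
  exact absurd (hmin ⟨⟨hw.1, hw.2.le.trans hz.1.2⟩, not_lt.1 hcon⟩) (not_le.2 hw.2)

theorem exists_first_zero {f : ℝ → ℝ} {s u : ℝ} (hsu : s ≤ u) (hf : ContinuousOn f (Icc s u))
    (hs : 0 ≤ f s) (hu : f u ≤ 0) : ∃ z ∈ Icc s u, f z = 0 ∧ ∀ w ∈ Ico s z, 0 < f w := by
  obtain ⟨z, hz, hz0, hpos⟩ := exists_first_nonpos hsu hf hu
  refine ⟨z, hz, le_antisymm hz0 ?_, hpos⟩
  rcases hz.1.eq_or_lt with rfl | hlt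
  · exact hs
  have hc : ContinuousWithinAt f (Iio z) z :=
    ((hf z hz).mono fun w hw => (⟨hw.1, hw.2.le.trans hz.2⟩ : w ∈ Icc s u)
      : ContinuousWithinAt f (Ico s z) z).mono_of_mem_nhdsWithin (Ico_mem_nhdsLT hlt)
  refine ge_of_tendsto hc ?_
  filter_upwards [Ico_mem_nhdsLT hlt] with w hw using (hpos w hw).le

theorem exists_last_zero {f : ℝ → ℝ} {s u : ℝ} (hsu : s ≤ u) (hf : ContinuousOn f (Icc s u))
    (hs : f s ≤ 0) (hu : 0 ≤ f u) : ∃ z ∈ Icc s u, f z = 0 ∧ ∀ w ∈ Ioc z u, 0 < f w := by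
  have hf' : ContinuousOn (fun t => f (-t)) (Icc (-u) (-s)) :=
    hf.comp continuousOn_neg fun t ht => ⟨by linarith [ht.2], by linarith [ht.1]⟩
  obtain ⟨z, hz, hz0, hpos⟩ := exists_first_zero (f := fun t => f (-t)) (neg_le_neg hsu) hf'
    (by simpa using hu) (by simpa using hs)
  refine ⟨-z, ⟨by linarith [hz.2], by linarith [hz.1]⟩, hz0, fun w hw => ?_⟩
  simpa using hpos (-w) ⟨by linarith [hw.2], by linarith [hw.1]⟩

/-! ### Classical solutions -/

theorem ContDiff.eqOn_of_hasDerivWithinAt {E : Type*} [NormedAddCommGroup E] [NormedSpace ℝ E]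
    [FiniteDimensional ℝ E] {Z : E → E} (hZ : ContDiff ℝ 1 Z) {u v : ℝ → E} {b : ℝ}
    (hu : ∀ t ∈ Icc 0 b, HasDerivWithinAt u (Z (u t)) (Icc 0 b) t)
    (hv : ∀ t ∈ Icc 0 b, HasDerivWithinAt v (Z (v t)) (Icc 0 b) t) (h0 : u 0 = v 0) :
    EqOn u v (Icc 0 b) := by
  have : ProperSpace E := FiniteDimensional.proper ℝ E
  have hcu : ContinuousOn u (Icc 0 b) := fun t ht => (hu t ht).continuousWithinAt
  have hcv : ContinuousOn v (Icc 0 b) := fun t ht => (hv t ht).continuousWithinAt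
  -- A C¹ field need be Lipschitz on bounded sets only; one ball contains both compact trajectories.
  obtain ⟨R, hR⟩ := ((isCompact_Icc.image_of_continuousOn hcu).union
    (isCompact_Icc.image_of_continuousOn hcv)).isBounded.subset_closedBall 0
  obtain ⟨L, hL⟩ := (hZ.contDiffOn (s := Metric.closedBall 0 R)).exists_lipschitzOnWith (by decide)
    (convex_closedBall _ _) (isCompact_closedBall _ _)
  have hder : ∀ {w : ℝ → E}, (∀ t ∈ Icc 0 b, HasDerivWithinAt w (Z (w t)) (Icc 0 b) t) →
      ∀ t ∈ Ico 0 b, HasDerivWithinAt w (Z (w t)) (Ici t) t := fun {w} hw t ht =>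
    ((hw t (Ico_subset_Icc_self ht)).mono (Icc_subset_Icc_left ht.1)).mono_of_mem_nhdsWithin
      (Icc_mem_nhdsGE ht.2)
  exact ODE_solution_unique_of_mem_Icc_right (v := fun _ => Z) (s := fun _ => Metric.closedBall 0 R)
    (fun _ _ => hL) hcu (hder hu)
    (fun t ht => hR (Or.inl (mem_image_of_mem _ (Ico_subset_Icc_self ht)))) hcv (hder hv)
    (fun t ht => hR (Or.inr (mem_image_of_mem _ (Ico_subset_Icc_self ht)))) h0

section Components

variable {γ : ℝ → ℝ × ℝ} {v : ℝ × ℝ} {S : Set ℝ} {t : ℝ}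

theorem hasDerivWithinAt_snd_comp (h : HasDerivWithinAt γ v S t) :
    HasDerivWithinAt (fun x => (γ x).2) v.2 S t :=
  (hasFDerivAt_snd (𝕜 := ℝ) (p := γ t)).comp_hasDerivWithinAt t h

theorem hasDerivAt_fst_comp (h : HasDerivAt γ v t) : HasDerivAt (fun x => (γ x).1) v.1 t :=
  (hasFDerivAt_fst (𝕜 := ℝ) (p := γ t)).comp_hasDerivAt t h

theorem hasDerivAt_snd_comp (h : HasDerivAt γ v t) : HasDerivAt (fun x => (γ x).2) v.2 t :=
  (hasFDerivAt_snd (𝕜 := ℝ) (p := γ t)).comp_hasDerivAt t h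

end Components

/-! ### Filippov solutions -/

section Filippov

variable {Zp Zm : ℝ × ℝ → ℝ × ℝ} {γ : ℝ → ℝ × ℝ} {s t u : ℝ}

theorem IsSolution.continuousOn (h : IsSolution Zp Zm γ s t) (hst : s ≤ t) :
    ContinuousOn γ (Icc s t) := by
  simpa [uIcc_of_le hst] using h.1.continuousOn

theorem IsSolution.mono {s' t' : ℝ} (h : IsSolution Zp Zm γ s t) (h₁ : s ≤ s') (h₂ : s' ≤ t')
    (h₃ : t' ≤ t) : IsSolution Zp Zm γ s' t' := by
  refine ⟨h.1.mono ?_, ?_⟩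
  · rw [uIcc_of_le h₂, uIcc_of_le (h₁.trans (h₂.trans h₃))]
    exact Icc_subset_Icc h₁ h₃
  · filter_upwards [h.2] with w hw hmem
    exact hw ⟨h₁.trans_lt hmem.1, hmem.2.trans_le h₃⟩

theorem IsSolution.trans (hst : s ≤ t) (htu : t ≤ u) (h₁ : IsSolution Zp Zm γ s t)
    (h₂ : IsSolution Zp Zm γ t u) : IsSolution Zp Zm γ s u := by
  refine ⟨h₁.1.trans hst htu h₂.1, ?_⟩
  have hb : ∀ᵐ w : ℝ, w ≠ t := by simp [ae_iff]
  filter_upwards [h₁.2, h₂.2, hb] with w hw₁ hw₂ hne hmem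
  rcases lt_or_gt_of_ne hne with h | h
  · exact hw₁ ⟨hmem.1, h⟩
  · exact hw₂ ⟨h, hmem.2⟩

theorem IsSolution.congr {γ' : ℝ → ℝ × ℝ} (hst : s ≤ t) (h : IsSolution Zp Zm γ s t)
    (heq : EqOn γ γ' (Icc s t)) : IsSolution Zp Zm γ' s t := by
  refine ⟨h.1.congr (by rwa [uIcc_of_le hst]), ?_⟩
  filter_upwards [h.2] with w hw hmem
  obtain ⟨v, hv, hd⟩ := hw hmem
  rw [heq (Ioo_subset_Icc_self hmem)] at hv
  refine ⟨v, hv, hd.congr_of_eventuallyEq ?_⟩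
  filter_upwards [Ioo_mem_nhds hmem.1 hmem.2] with x hx using (heq (Ioo_subset_Icc_self hx)).symm

theorem IsSolution.comp_add_left {c : ℝ} (h : IsSolution Zp Zm γ (c + s) (c + t)) :
    IsSolution Zp Zm (fun x => γ (c + x)) s t := by
  refine ⟨h.1.comp_add_left c, ?_⟩
  have := (measurePreserving_add_left volume c).quasiMeasurePreserving.ae h.2
  filter_upwards [this] with w hw hmem
  obtain ⟨v, hv, hd⟩ := hw ⟨by linarith [hmem.1], by linarith [hmem.2]⟩
  exact ⟨v, hv, hd.comp_const_add c w⟩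

/-- The field obtained from `Z` by the symmetry about the origin. -/
def centralField (Z : ℝ × ℝ → ℝ × ℝ) (p : ℝ × ℝ) : ℝ × ℝ := -Z (-p)

theorem filippovSet_neg {Z : ℝ × ℝ → ℝ × ℝ} {p v : ℝ × ℝ}
    (h : v ∈ filippovSet Z (centralField Z) p) : -v ∈ filippovSet Z (centralField Z) (-p) := by
  simp only [filippovSet, centralField, mem_ofPred_eq] at h ⊢
  rcases h with ⟨h, rfl⟩ | ⟨h, rfl⟩ | ⟨h, hv⟩
  · exact Or.inr (Or.inl ⟨by simpa using h, by simp⟩)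
  · exact Or.inl ⟨by simpa using h, by simp⟩
  · refine Or.inr (Or.inr ⟨by simpa using h, ?_⟩)
    rw [neg_neg, segment_symm]
    obtain ⟨x, y, hx, hy, hxy, rfl⟩ := hv
    exact ⟨x, y, hx, hy, hxy, by simp; abel⟩

theorem IsSolution.neg {Z : ℝ × ℝ → ℝ × ℝ} (h : IsSolution Z (centralField Z) γ s t) :
    IsSolution Z (centralField Z) (fun x => -γ x) s t := by
  refine ⟨h.1.neg, ?_⟩
  filter_upwards [h.2] with w hw hmem
  obtain ⟨v, hv, hd⟩ := hw hmem
  exact ⟨-v, filippovSet_neg hv, hd.neg⟩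

theorem IsSolution.snd_mul_le_sub {c : ℝ} (hst : s ≤ t) (h : IsSolution Zp Zm γ s t)
    (hc : ∀ w ∈ Ioo s t, ∀ v ∈ filippovSet Zp Zm (γ w), HasDerivAt γ v w → c ≤ v.2) :
    c * (t - s) ≤ (γ t).2 - (γ s).2 := by
  refine (h.1.comp_lipschitz (φ := Prod.snd) fun x y => le_max_right _ _).mul_le_sub_of_ae_le hst ?_
  filter_upwards [h.2] with w hw hmem
  obtain ⟨v, hv, hd⟩ := hw hmem
  exact ⟨v.2, hc w hmem v hv hd, hasDerivAt_snd_comp hd⟩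

theorem IsSolution.fst_mul_le_sub {c σ : ℝ} (hσ : |σ| = 1) (hst : s ≤ t)
    (h : IsSolution Zp Zm γ s t)
    (hc : ∀ w ∈ Ioo s t, ∀ v ∈ filippovSet Zp Zm (γ w), HasDerivAt γ v w → c ≤ σ * v.1) :
    c * (t - s) ≤ σ * (γ t).1 - σ * (γ s).1 := by
  refine (h.1.comp_lipschitz (φ := fun p : ℝ × ℝ => σ * p.1)
    fun x y => ?_).mul_le_sub_of_ae_le hst ?_
  · rw [Real.dist_eq, ← mul_sub, abs_mul, hσ, one_mul]
    exact le_max_left _ _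
  filter_upwards [h.2] with w hw hmem
  obtain ⟨v, hv, hd⟩ := hw hmem
  exact ⟨σ * v.1, hc w hmem v hv hd, (hasDerivAt_fst_comp hd).const_mul σ⟩

/-- Subtracting the primitive of `Zp ∘ γ` leaves an absolutely continuous function with derivative
zero almost everywhere, hence a constant. So above Σ a Filippov solution is a classical one, also at
the two end times, where it may touch Σ. -/
theorem IsSolution.hasDerivWithinAt_of_pos (hst : s ≤ t) (hZ : Continuous Zp)
    (h : IsSolution Zp Zm γ s t) (hpos : ∀ w ∈ Ioo s t, 0 < (γ w).2) :
    ∀ w ∈ Icc s t, HasDerivWithinAt γ (Zp (γ w)) (Icc s t) w := by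
  have hcont := h.continuousOn hst
  obtain ⟨β, hβ, hβe⟩ : ∃ β : ℝ → ℝ × ℝ, Continuous β ∧ EqOn β γ (Icc s t) :=
    ⟨IccExtend hst ((Icc s t).domRestrict γ), hcont.domRestrict.Icc_extend',
      fun w hw => by rw [IccExtend_of_mem hst _ hw]; rfl⟩
  set I : ℝ → ℝ × ℝ := fun w => ∫ x in s..w, Zp (β x) with hI
  have hId : ∀ w, HasDerivAt I (Zp (β w)) w := fun w =>
    ((hZ.comp hβ).integral_hasStrictDerivAt s w).hasDerivAt
  have hIac : AbsolutelyContinuousOnInterval I s t := by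
    refine ContDiffOn.absolutelyContinuousOnInterval (ContDiff.contDiffOn ?_)
    refine contDiff_one_iff_deriv.2 ⟨fun w => (hId w).differentiableAt, ?_⟩
    rw [show deriv I = Zp ∘ β from funext fun w => (hId w).deriv]
    exact hZ.comp hβ
  have hb : ∀ᵐ w : ℝ, w ≠ s := by simp [ae_iff]
  have hb' : ∀ᵐ w : ℝ, w ≠ t := by simp [ae_iff]
  obtain ⟨C, hC⟩ := (h.1.sub hIac).const_of_ae_hasDerivAt_zero (by
    filter_upwards [h.2, hb, hb'] with w hw hws hwt hmem
    rw [uIcc_of_le hst] at hmem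
    have hmem' : w ∈ Ioo s t := ⟨lt_of_le_of_ne hmem.1 hws.symm, lt_of_le_of_ne hmem.2 hwt⟩
    obtain ⟨v, hv, hd⟩ := hw hmem'
    have hvZ : v = Zp (γ w) := by
      have hp := hpos w hmem'
      rcases hv with ⟨-, rfl⟩ | ⟨h', -⟩ | ⟨h', -⟩
      · rfl
      · exact absurd h' hp.le.not_gt
      · exact absurd h' hp.ne'
    have := hd.sub (hId w)
    rwa [hβe hmem, hvZ, sub_self] at this)
  intro w hw
  rw [uIcc_of_le hst] at hC
  have h1 : HasDerivWithinAt (fun x => C + I x) (Zp (γ w)) (Icc s t) w := by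
    rw [← hβe hw]
    exact ((hId w).const_add C).hasDerivWithinAt
  refine h1.congr (fun x hx => ?_) ?_
  · rw [← hC x hx]; simp
  · rw [← hC w hw]; simp

theorem isSolution_of_hasDerivWithinAt {v : ℝ → ℝ × ℝ} (hst : s ≤ t)
    (hv : ContinuousOn v (Icc s t)) (hd : ∀ w ∈ Icc s t, HasDerivWithinAt γ (v w) (Icc s t) w)
    (hmem : ∀ w ∈ Ioo s t, v w ∈ filippovSet Zp Zm (γ w)) : IsSolution Zp Zm γ s t := by
  constructor
  · obtain ⟨C, hC⟩ := isCompact_Icc.exists_bound_of_continuousOn hv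
    have : LipschitzOnWith C.toNNReal γ (Icc s t) :=
      (convex_Icc s t).lipschitzOnWith_of_nnnorm_hasDerivWithin_le hd fun w hw => by
        rw [← NNReal.coe_le_coe, coe_nnnorm]
        exact (hC w hw).trans (Real.le_coe_toNNReal C)
    rw [← uIcc_of_le hst] at this
    exact this.absolutelyContinuousOnInterval
  · refine Eventually.of_forall fun w hw => ⟨v w, hmem w hw, ?_⟩
    exact (hd w (Ioo_subset_Icc_self hw)).hasDerivAt (Icc_mem_nhds hw.1 hw.2)

theorem isSolution_of_pos (hst : s ≤ t) (hZ : Continuous Zp)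
    (hd : ∀ w ∈ Icc s t, HasDerivWithinAt γ (Zp (γ w)) (Icc s t) w)
    (hpos : ∀ w ∈ Ioo s t, 0 < (γ w).2) : IsSolution Zp Zm γ s t :=
  isSolution_of_hasDerivWithinAt (v := fun w => Zp (γ w)) hst
    (hZ.comp_continuousOn fun w hw => (hd w hw).continuousWithinAt) hd
    fun w hw => Or.inl ⟨hpos w hw, rfl⟩

theorem isSolution_refl : IsSolution Zp Zm γ s s :=
  ⟨LipschitzOnWith.absolutelyContinuousOnInterval (K := 0) fun x hx y hy => by
    rw [uIcc_self, mem_singleton_iff] at hx hy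
    simp [hx, hy], by simp⟩

end Filippov

/-! ### Filippov solutions near a visible regular-fold -/

/-- The closed square of half-width `δ` about `(-a, 0)`. -/
def cornerBox (a δ : ℝ) : Set (ℝ × ℝ) := {p | |p.1 + a| ≤ δ ∧ |p.2| ≤ δ}

/-- Quantitative form of: `(-r, 0)` is a visible regular-fold of the upper field `Z`, both fields
have a tangential drift in the direction of `σ`, and the lower field points upwards. -/
structure FoldCorner (Z : ℝ × ℝ → ℝ × ℝ) (σ a r δ c : ℝ) : Prop where
  sign : |σ| = 1
  c_pos : 0 < c
  contDiff : ContDiff ℝ 1 Z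
  lower_pos : ∀ p ∈ cornerBox a δ, 0 < (centralField Z p).2
  drift : ∀ p ∈ cornerBox a δ, c ≤ σ * (Z p).1
  sliding : ∀ x, |x + a| ≤ δ → ∀ v ∈ segment ℝ (centralField Z (x, 0)) (Z (x, 0)), v.2 = 0 →
    c ≤ σ * v.1
  crossing : ∀ x, |x + a| ≤ δ → 0 < σ * (x + r) → 0 < (Z (x, 0)).2
  attracting : ∀ x, |x + a| ≤ δ → σ * (x + r) < 0 → (Z (x, 0)).2 < 0
  fold : (Z (-r, 0)).2 = 0

theorem filippovSet_of_pos {Zp Zm : ℝ × ℝ → ℝ × ℝ} {p v : ℝ × ℝ} (hp : 0 < p.2)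
    (h : v ∈ filippovSet Zp Zm p) : v = Zp p := by
  rcases h with ⟨-, rfl⟩ | ⟨h', -⟩ | ⟨h', -⟩
  · rfl
  · exact absurd h' hp.le.not_gt
  · exact absurd h' hp.ne'

theorem filippovSet_of_neg {Zp Zm : ℝ × ℝ → ℝ × ℝ} {p v : ℝ × ℝ} (hp : p.2 < 0)
    (h : v ∈ filippovSet Zp Zm p) : v = Zm p := by
  rcases h with ⟨h', -⟩ | ⟨-, rfl⟩ | ⟨h', -⟩
  · exact absurd h' hp.le.not_gt
  · rfl
  · exact absurd h' hp.ne

theorem filippovSet_of_zero {Zp Zm : ℝ × ℝ → ℝ × ℝ} {p v : ℝ × ℝ} (hp : p.2 = 0)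
    (h : v ∈ filippovSet Zp Zm p) : v ∈ segment ℝ (Zm p) (Zp p) := by
  rcases h with ⟨h', -⟩ | ⟨h', -⟩ | ⟨-, h'⟩
  · exact absurd hp h'.ne'
  · exact absurd hp h'.ne
  · exact h'

theorem le_filippovSet_snd {Zp Zm : ℝ × ℝ → ℝ × ℝ} {p v : ℝ × ℝ} {e : ℝ}
    (h : v ∈ filippovSet Zp Zm p) (hp : e ≤ (Zp p).2) (hm : e ≤ (Zm p).2) : e ≤ v.2 := by
  rcases h with ⟨-, rfl⟩ | ⟨-, rfl⟩ | ⟨-, x, y, hx, hy, hxy, rfl⟩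
  · exact hp
  · exact hm
  · simp only [Prod.snd_add, Prod.smul_snd, smul_eq_mul]
    have := mul_le_mul_of_nonneg_left hm hx
    have := mul_le_mul_of_nonneg_left hp hy
    have : x * e + y * e = e := by rw [← add_mul, hxy, one_mul]
    linarith

theorem continuous_centralField {Z : ℝ × ℝ → ℝ × ℝ} (h : Continuous Z) :
    Continuous (centralField Z) :=
  (h.comp continuous_neg).neg

/-- Projection of `x` to the half-line that consists of the fold `-r` and the crossing points. -/
noncomputable def foldClamp (σ r x : ℝ) : ℝ := if 0 ≤ σ * (x + r) then x else -r

theorem foldClamp_of_nonneg {σ r x : ℝ} (h : 0 ≤ σ * (x + r)) : foldClamp σ r x = x := if_pos h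

theorem foldClamp_of_neg {σ r x : ℝ} (h : σ * (x + r) < 0) : foldClamp σ r x = -r :=
  if_neg h.not_ge

theorem foldClamp_nonneg (σ r x : ℝ) : 0 ≤ σ * (foldClamp σ r x + r) := by
  unfold foldClamp
  split_ifs with h
  · exact h
  · simp

theorem abs_foldClamp_sub_le {σ r x y : ℝ} (hσ : |σ| = 1) :
    |foldClamp σ r x - foldClamp σ r y| ≤ |x - y| := by
  unfold foldClamp
  rcases eq_or_eq_neg_of_abs_eq hσ with rfl | rfl <;> split_ifs <;> grind

namespace FoldCorner

variable {Z : ℝ × ℝ → ℝ × ℝ} {σ a r δ c : ℝ} {γ : ℝ → ℝ × ℝ} {s t : ℝ}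

/-- After a last visit to Σ before going below it, the velocity would be that of the lower field,
which points upwards in the box. -/
theorem nonneg (C : FoldCorner Z σ a r δ c) (hst : s ≤ t)
    (h : IsSolution Z (centralField Z) γ s t) (hbox : ∀ w ∈ Icc s t, γ w ∈ cornerBox a δ)
    (h0 : 0 ≤ (γ s).2) : ∀ w ∈ Icc s t, 0 ≤ (γ w).2 := by
  intro w hw
  by_contra! hneg
  have hcont := ((h.continuousOn hst).mono (Icc_subset_Icc_right hw.2)).snd
  obtain ⟨z, hz, hz0, hpos⟩ := exists_last_zero hw.1 hcont.neg
    (by simpa using h0) (by simpa using hneg.le)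
  have hz0 : (γ z).2 = 0 := by simpa using hz0
  have := (h.mono hz.1 hz.2 hw.2).snd_mul_le_sub (c := 0) hz.2 fun u hu v hv _ => by
    have hu' : (γ u).2 < 0 := by simpa using hpos u (Ioo_subset_Ioc_self hu)
    rw [filippovSet_of_neg hu' hv]
    exact (C.lower_pos _ (hbox u ⟨hz.1.trans hu.1.le, hu.2.le.trans hw.2⟩)).le
  linarith

/-- At a time spent on Σ the height has a local minimum, so an existing velocity is tangential and
the bound on tangential convex combinations applies. At other times the velocity is that of the
upper field. -/
theorem drift_le (C : FoldCorner Z σ a r δ c) (hst : s ≤ t)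
    (h : IsSolution Z (centralField Z) γ s t) (hbox : ∀ w ∈ Icc s t, γ w ∈ cornerBox a δ)
    (h0 : 0 ≤ (γ s).2) : c * (t - s) ≤ σ * (γ t).1 - σ * (γ s).1 := by
  have hnn := C.nonneg hst h hbox h0
  refine h.fst_mul_le_sub C.sign hst fun w hw v hv hd => ?_
  have hw' := Ioo_subset_Icc_self hw
  rcases (hnn w hw').eq_or_lt with h' | h'
  · have hv0 : v.2 = 0 := by
      refine IsLocalMin.hasDerivAt_eq_zero (f := fun x => (γ x).2) (a := w) ?_
        (hasDerivAt_snd_comp hd)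
      filter_upwards [Ioo_mem_nhds hw.1 hw.2] with x hx
      rw [← h']
      exact hnn x (Ioo_subset_Icc_self hx)
    have hp : γ w = ((γ w).1, 0) := Prod.ext rfl h'.symm
    refine C.sliding (γ w).1 (hbox w hw').1 v ?_ hv0
    rw [← hp]
    exact filippovSet_of_zero h'.symm hv
  · rw [filippovSet_of_pos h' hv]
    exact C.drift _ (hbox w hw')

/-- A solution that has not passed the fold is stuck on Σ. Otherwise, at its last time `z` on Σ, the
drift places it strictly before the fold, where the upper field points down, so it could not have
risen after `z`. -/
theorem snd_eq_zero (C : FoldCorner Z σ a r δ c) (hst : s ≤ t)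
    (h : IsSolution Z (centralField Z) γ s t) (hbox : ∀ w ∈ Icc s t, γ w ∈ cornerBox a δ)
    (h0 : (γ s).2 = 0) (ht : σ * ((γ t).1 + r) ≤ 0) : (γ t).2 = 0 := by
  by_contra hne
  have hnn := C.nonneg hst h hbox h0.ge
  have hcont := h.continuousOn hst
  have hpos : 0 < (γ t).2 := lt_of_le_of_ne (hnn t (right_mem_Icc.2 hst)) (Ne.symm hne)
  obtain ⟨z, hz, hz0, hzpos⟩ := exists_last_zero hst hcont.snd h0.le hpos.le
  have hzt : z < t := lt_of_le_of_ne hz.2 (by rintro rfl; exact hne hz0)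
  have hbz : ∀ w ∈ Icc z t, γ w ∈ cornerBox a δ := fun w hw => hbox w ⟨hz.1.trans hw.1, hw.2⟩
  have hdr := C.drift_le hzt.le (h.mono hz.1 hz.2 le_rfl) hbz hz0.ge
  have hcz : 0 < c * (t - z) := mul_pos C.c_pos (sub_pos.2 hzt)
  have hneg : (Z (γ z)).2 < 0 := by
    have hp : γ z = ((γ z).1, 0) := Prod.ext rfl hz0
    rw [hp]
    refine C.attracting _ (hbox z hz).1 ?_
    nlinarith
  have hZc : ContinuousWithinAt (fun w => (Z (γ w)).2) (Icc z t) z :=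
    ((C.contDiff.continuous.comp_continuousOn hcont).snd z hz).mono (Icc_subset_Icc_left hz.1)
  have hev : ∀ᶠ w in 𝓝[≥] z, (Z (γ w)).2 < 0 :=
    by
    rw [← nhdsWithin_Icc_eq_nhdsGE hzt]
    exact hZc.eventually (gt_mem_nhds hneg)
  obtain ⟨w, hw, hwneg⟩ := (mem_nhdsGE_iff_exists_Ico_subset' hzt).1 hev
  set u := (z + min w t) / 2 with hu
  have hzm : z < min w t := lt_min hw hzt
  have hzu : z < u := by rw [hu]; linarith
  have huw : u < w := by have := min_le_left w t; rw [hu]; linarith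
  have hut : u < t := by have := min_le_right w t; rw [hu]; linarith
  have hdec : -(γ u).2 ≥ 0 := by
    -- The required upper bound on the height is the lower bound for the reflected solution `-γ`.
    have := ((h.mono (s' := z) (t' := u) hz.1 hzu.le hut.le).neg).snd_mul_le_sub (c := 0) hzu.le
      fun x hx v hv hd => by
        have hx' : 0 < (γ x).2 := hzpos x ⟨hx.1, hx.2.le.trans hut.le⟩
        rw [filippovSet_of_neg (by simpa using hx') hv]
        have := hwneg ⟨hx.1.le, hx.2.trans huw⟩
        simp only [centralField, neg_neg, Prod.snd_neg, Left.nonneg_neg_iff]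
        exact le_of_lt this
    simp only [Prod.snd_neg, hz0] at this
    linarith
  have := hzpos u ⟨hzu, hut.le⟩
  linarith

/-- If the solution were on Σ at time `t`, the drift would put it strictly beyond the fold. There
both normal components are positive, so the height just before `t` would be negative. -/
theorem snd_pos (C : FoldCorner Z σ a r δ c) (hst : s < t)
    (h : IsSolution Z (centralField Z) γ s t) (hbox : ∀ w ∈ Icc s t, γ w ∈ cornerBox a δ)
    (h0 : 0 ≤ (γ s).2) (hs : 0 ≤ σ * ((γ s).1 + r)) : 0 < (γ t).2 := by
  have hnn := C.nonneg hst.le h hbox h0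
  by_contra hle
  have ht0 : (γ t).2 = 0 := le_antisymm (not_lt.1 hle) (hnn t (right_mem_Icc.2 hst.le))
  have hcont := h.continuousOn hst.le
  have hdr := C.drift_le hst.le h hbox h0
  have hcz : 0 < c * (t - s) := mul_pos C.c_pos (sub_pos.2 hst)
  have htm := right_mem_Icc.2 hst.le
  have hZpos : 0 < (Z (γ t)).2 := by
    have hp : γ t = ((γ t).1, 0) := Prod.ext rfl ht0
    rw [hp]
    refine C.crossing _ (hbox t htm).1 ?_
    nlinarith
  obtain ⟨e, he, heZ⟩ := exists_between (lt_min hZpos (C.lower_pos _ (hbox t htm)))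
  have hev : ∀ᶠ w in 𝓝[≤] t, e < (Z (γ w)).2 ∧ e < (centralField Z (γ w)).2 := by
    have hc₁ : ContinuousWithinAt (fun w => (Z (γ w)).2) (Icc s t) t :=
      (C.contDiff.continuous.comp_continuousOn hcont).snd t htm
    have hc₂ : ContinuousWithinAt (fun w => (centralField Z (γ w)).2) (Icc s t) t :=
      ((continuous_centralField C.contDiff.continuous).comp_continuousOn hcont).snd t htm
    rw [← nhdsWithin_Icc_eq_nhdsLE hst]
    exact (hc₁.eventually (lt_mem_nhds (heZ.trans_le (min_le_left _ _)))).and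
      (hc₂.eventually (lt_mem_nhds (heZ.trans_le (min_le_right _ _))))
  obtain ⟨w, hw, hwpos⟩ := (mem_nhdsLE_iff_exists_Ioc_subset' hst).1 hev
  set u := (t + max w s) / 2 with hu
  have hm : max w s < t := max_lt hw hst
  have hut : u < t := by rw [hu]; linarith
  have hwu : w < u := by have := le_max_left w s; rw [hu]; linarith
  have hsu : s < u := by have := le_max_right w s; rw [hu]; linarith
  have hgrow := (h.mono hsu.le hut.le le_rfl).snd_mul_le_sub (c := e) hut.le fun x hx v hv _ => by
    have := hwpos ⟨hwu.trans hx.1, hx.2.le⟩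
    exact le_filippovSet_snd hv this.1.le this.2.le
  have := mul_pos he (sub_pos.2 hut)
  have := hnn u ⟨hsu.le, hut.le⟩
  linarith

end FoldCorner

/-! ### Sliding to the fold and leaving Σ. -/

namespace FoldCorner

variable {Z : ℝ × ℝ → ℝ × ℝ} {σ a r δ c : ℝ} {γ : ℝ → ℝ × ℝ}

theorem exists_exit {Zp Zm : ℝ × ℝ → ℝ × ℝ} {T : ℝ} (hT : 0 ≤ T) (h : IsSolution Zp Zm γ 0 T) :
    ∃ T₀ ∈ Icc 0 T, (∀ w ∈ Ico 0 T₀, γ w ∈ cornerBox a δ) ∧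
      (T₀ < T → δ ≤ |(γ T₀).1 + a| ∨ δ ≤ |(γ T₀).2|) := by
  have hcont := h.continuousOn hT
  set m : ℝ → ℝ := fun t => min (δ - |(γ t).1 + a|) (δ - |(γ t).2|) with hm
  have hmc : ContinuousOn m (Icc 0 T) := by
    have h1 := hcont.fst
    have h2 := hcont.snd
    fun_prop
  have hbox : ∀ w, 0 < m w → γ w ∈ cornerBox a δ := fun w hw =>
    ⟨by linarith [(lt_min_iff.1 hw).1], by linarith [(lt_min_iff.1 hw).2]⟩
  by_cases hex : ∃ t ∈ Icc 0 T, m t ≤ 0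
  · obtain ⟨t, ht, hmt⟩ := hex
    obtain ⟨z, hz, hz0, hzpos⟩ := exists_first_nonpos ht.1 (hmc.mono (Icc_subset_Icc_right ht.2)) hmt
    refine ⟨z, ⟨hz.1, hz.2.trans ht.2⟩, fun w hw => hbox w (hzpos w hw), fun _ => ?_⟩
    rcases min_le_iff.1 hz0 with h' | h'
    · exact Or.inl (by linarith)
    · exact Or.inr (by linarith)
  · push Not at hex
    exact ⟨T, right_mem_Icc.2 hT, fun w hw => hbox w (hex w (Ico_subset_Icc_self hw)),
      fun h => absurd h (lt_irrefl _)⟩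

theorem mem_cornerBox_of_Ico {T T₀ : ℝ} (hcont : ContinuousOn γ (Icc 0 T)) (hT₀ : 0 < T₀)
    (hT : T₀ ≤ T) (h : ∀ w ∈ Ico 0 T₀, γ w ∈ cornerBox a δ) :
    ∀ w ∈ Icc 0 T₀, γ w ∈ cornerBox a δ := by
  have hclosed : IsClosed (cornerBox a δ) :=
    (isClosed_le (continuous_fst.add continuous_const).abs continuous_const).inter
      (isClosed_le continuous_snd.abs continuous_const)
  have hc : ContinuousOn γ (Icc 0 T₀) := hcont.mono (Icc_subset_Icc_right hT)
  have hpre := hc.preimage_isClosed_of_isClosed isClosed_Icc hclosed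
  have hsub : closure (Ico 0 T₀) ⊆ Icc 0 T₀ ∩ γ ⁻¹' cornerBox a δ :=
    closure_minimal (fun w hw => ⟨Ico_subset_Icc_self hw, h w hw⟩) hpre
  rw [closure_Ico hT₀.ne] at hsub
  exact fun w hw => (hsub hw).2

theorem exists_pos_exit {Zp Zm : ℝ × ℝ → ℝ × ℝ} {T : ℝ} (hT : 0 < T)
    (h : IsSolution Zp Zm γ 0 T) (h1 : |(γ 0).1 + a| < δ) (h2 : |(γ 0).2| < δ) :
    ∃ T₀, 0 < T₀ ∧ T₀ ≤ T ∧ (∀ w ∈ Icc 0 T₀, γ w ∈ cornerBox a δ) ∧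
      (T₀ < T → δ ≤ |(γ T₀).1 + a| ∨ δ ≤ |(γ T₀).2|) := by
  obtain ⟨T₀, hT₀, hbox, hex⟩ := exists_exit (a := a) (δ := δ) hT.le h
  have h0 : 0 < T₀ := by
    refine lt_of_le_of_ne hT₀.1 ?_
    rintro rfl
    rcases hex hT with h' | h' <;> linarith
  exact ⟨T₀, h0, hT₀.2, mem_cornerBox_of_Ico (h.continuousOn hT.le) h0 hT₀.2 hbox, hex⟩

/-- A solution that starts on `Σ` near the fold first slides to the fold, if it starts on the sliding
segment. -/
theorem slide (C : FoldCorner Z σ a r δ c) {ε T x : ℝ} (hε : ε < δ) (hT : 0 ≤ T)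
    (hr : |r - a| ≤ ε) (hx : |x + a| ≤ ε) (h : IsSolution Z (centralField Z) γ 0 T)
    (h0 : γ 0 = (x, 0)) :
    (c * T ≤ 2 * ε ∧ ∀ t ∈ Icc 0 T, γ t ∈ (fun u : ℝ => (u, (0 : ℝ))) '' uIcc x (foldClamp σ r x)) ∨
    ∃ t₁ ∈ Icc 0 T, c * t₁ ≤ 2 * ε ∧ γ t₁ = (foldClamp σ r x, 0) ∧
      γ '' Icc 0 t₁ = (fun u : ℝ => (u, (0 : ℝ))) '' uIcc x (foldClamp σ r x) := by
  have hε0 : 0 ≤ ε := (abs_nonneg _).trans hx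
  rcases le_or_gt 0 (σ * (x + r)) with hσ | hσ
  · refine Or.inr ⟨0, left_mem_Icc.2 hT, by simpa using hε0, ?_, ?_⟩
    · rw [h0, foldClamp_of_nonneg hσ]
    · simp [h0, foldClamp_of_nonneg hσ]
  rcases hT.eq_or_lt with rfl | hT'
  · refine Or.inl ⟨by simpa using hε0, fun t ht => ?_⟩
    have : t = 0 := le_antisymm ht.2 ht.1
    rw [this, h0]
    exact mem_image_of_mem _ left_mem_uIcc
  rw [foldClamp_of_neg hσ]
  obtain ⟨T₀, hT₀, hT₀T, hbox, hex⟩ := exists_pos_exit (a := a) (δ := δ) hT' h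
    (by rw [h0]; exact hx.trans_lt hε) (by rw [h0]; simpa using hε0.trans_lt hε)
  have hcont := h.continuousOn hT
  have h00 : (γ 0).2 = 0 := by rw [h0]
  have hsol : ∀ w ∈ Icc 0 T₀, IsSolution Z (centralField Z) γ 0 w := fun w hw =>
    h.mono le_rfl hw.1 (hw.2.trans hT₀T)
  have hboxw : ∀ w ∈ Icc 0 T₀, ∀ w' ∈ Icc 0 w, γ w' ∈ cornerBox a δ := fun w hw w' hw' =>
    hbox w' ⟨hw'.1, hw'.2.trans hw.2⟩
  have hmono : ∀ w ∈ Icc 0 T₀, c * w ≤ σ * (γ w).1 - σ * x := fun w hw => by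
    have := C.drift_le hw.1 (hsol w hw) (hboxw w hw) h00.ge
    rw [h0] at this
    simpa using this
  have hzero : ∀ w ∈ Icc 0 T₀, σ * ((γ w).1 + r) ≤ 0 → (γ w).2 = 0 := fun w hw =>
    C.snd_eq_zero hw.1 (hsol w hw) (hboxw w hw) h00
  -- Both `x` and `-r` are within `ε` of `-a`, and the distance between them is covered with speed
  -- at least `c`; hence the bound `2 * ε` on `c * w`.
  have hmem : ∀ w ∈ Icc 0 T₀, σ * ((γ w).1 + r) ≤ 0 →
      (γ w).1 ∈ uIcc x (-r) ∧ c * w ≤ 2 * ε := fun w hw hle => by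
    have h1 := hmono w hw
    have h2 : 0 ≤ c * w := mul_nonneg C.c_pos.le hw.1
    rw [mem_uIcc]
    rw [abs_le] at hx hr
    rcases eq_or_eq_neg_of_abs_eq C.sign with rfl | rfl
    · exact ⟨Or.inl ⟨by linarith, by linarith⟩, by linarith⟩
    · exact ⟨Or.inr ⟨by linarith, by linarith⟩, by linarith⟩
  by_cases hreach : ∃ t ∈ Icc 0 T₀, 0 ≤ σ * ((γ t).1 + r)
  · right
    obtain ⟨t, ht, htr⟩ := hreach
    have hcs : ContinuousOn (fun w => -(σ * ((γ w).1 + r))) (Icc 0 t) :=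
      (continuousOn_const.mul ((hcont.fst.mono (Icc_subset_Icc_right (ht.2.trans hT₀T))).add
        continuousOn_const)).neg
    obtain ⟨t₁, ht₁, ht₁0, ht₁pos⟩ := exists_first_zero ht.1 hcs (by simpa [h0] using hσ.le)
      (by linarith)
    have ht₁T₀ : t₁ ∈ Icc 0 T₀ := ⟨ht₁.1, ht₁.2.trans ht.2⟩
    have hle : ∀ w ∈ Icc 0 t₁, σ * ((γ w).1 + r) ≤ 0 := fun w hw => by
      rcases hw.2.eq_or_lt with rfl | hlt
      · linarith
      · linarith [ht₁pos w ⟨hw.1, hlt⟩]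
    have hin : ∀ w ∈ Icc 0 t₁, w ∈ Icc 0 T₀ := fun w hw => ⟨hw.1, hw.2.trans ht₁T₀.2⟩
    have hend : (γ t₁).1 = -r := by
      have hσ0 : σ ≠ 0 := by
        rintro rfl
        simpa using C.sign
      have : (γ t₁).1 + r = 0 := by
        rcases mul_eq_zero.1 (neg_eq_zero.1 ht₁0) with h' | h'
        · exact absurd h' hσ0
        · exact h'
      linarith
    refine ⟨t₁, ⟨ht₁.1, ht₁T₀.2.trans hT₀T⟩,
      (hmem t₁ ht₁T₀ (hle t₁ (right_mem_Icc.2 ht₁.1))).2,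
      Prod.ext hend (hzero t₁ ht₁T₀ (hle t₁ (right_mem_Icc.2 ht₁.1))), ?_⟩
    apply Subset.antisymm
    · rintro _ ⟨w, hw, rfl⟩
      exact ⟨(γ w).1, (hmem w (hin w hw) (hle w hw)).1,
        Prod.ext rfl (hzero w (hin w hw) (hle w hw)).symm⟩
    · rintro _ ⟨u, hu, rfl⟩
      have hiv := intermediate_value_uIcc (a := 0) (b := t₁) (f := fun w => (γ w).1) (by
        rw [uIcc_of_le ht₁.1]
        exact hcont.fst.mono (Icc_subset_Icc_right (ht₁T₀.2.trans hT₀T)))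
      rw [uIcc_of_le ht₁.1, hend, h0] at hiv
      obtain ⟨w, hw, hwu⟩ := hiv hu
      exact ⟨w, hw, Prod.ext hwu (hzero w (hin w hw) (hle w hw))⟩
  · left
    push Not at hreach
    -- While the fold is not reached, the solution lies on Σ between `x` and `-r`, well inside the
    -- box, so it cannot leave the box before `T`.
    have hTT : T₀ = T := by
      by_contra hne
      have h1 := right_mem_Icc.2 hT₀.le
      have h2 := (hmem T₀ h1 (hreach T₀ h1).le).1
      rcases hex (lt_of_le_of_ne hT₀T hne) with h3 | h3
      · rw [abs_le] at hx hr
        rw [mem_uIcc] at h2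
        rcases le_abs.1 h3 with h4 | h4 <;> rcases h2 with h2 | h2 <;> linarith [h2.1, h2.2]
      · rw [hzero T₀ h1 (hreach T₀ h1).le, abs_zero] at h3
        linarith
    subst hTT
    refine ⟨(hmem T₀ (right_mem_Icc.2 hT₀.le) (hreach T₀ (right_mem_Icc.2 hT₀.le)).le).2,
      fun t ht => ⟨(γ t).1, (hmem t ht (hreach t ht).le).1,
        Prod.ext rfl (hzero t ht (hreach t ht).le).symm⟩⟩

/-- A solution that starts at the fold or at a crossing point follows the upper field. -/
theorem lift (C : FoldCorner Z σ a r δ c) {T x τ : ℝ} {φ : ℝ → ℝ × ℝ} (hT : 0 ≤ T)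
    (hx : |x + a| < δ) (hσ : 0 ≤ σ * (x + r)) (h : IsSolution Z (centralField Z) γ 0 T)
    (h0 : γ 0 = (x, 0)) (hφ0 : φ 0 = (x, 0))
    (hφ : ∀ t ∈ Icc 0 τ, HasDerivWithinAt φ (Z (φ t)) (Icc 0 τ) t)
    (hφpos : ∀ t ∈ Ioo 0 τ, 0 < (φ t).2) : ∀ t ∈ Icc 0 T, t ≤ τ → γ t = φ t := by
  rcases hT.eq_or_lt with rfl | hT'
  · intro t ht _
    have : t = 0 := le_antisymm ht.2 ht.1
    rw [this, h0, hφ0]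
  have hδ : 0 < δ := (abs_nonneg _).trans_lt hx
  obtain ⟨T₀, hT₀, hT₀T, hbox, -⟩ := exists_pos_exit (a := a) (δ := δ) hT' h
    (by rw [h0]; exact hx) (by rw [h0]; simpa using hδ)
  have hcont := h.continuousOn hT
  have h00 : 0 ≤ (γ 0).2 := by rw [h0]
  have hpos₀ : ∀ w ∈ Ioc 0 T₀, 0 < (γ w).2 := fun w hw =>
    C.snd_pos hw.1 (h.mono le_rfl hw.1.le (hw.2.trans hT₀T))
      (fun w' hw' => hbox w' ⟨hw'.1, hw'.2.trans hw.2⟩) h00 (by rw [h0]; exact hσ)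
  have key : ∀ S, 0 ≤ S → S ≤ T → S ≤ τ → (∀ w ∈ Ioo 0 S, 0 < (γ w).2) → EqOn γ φ (Icc 0 S) := by
    intro S hS0 hST hSτ hpos
    exact C.contDiff.eqOn_of_hasDerivWithinAt
      ((h.mono le_rfl hS0 hST).hasDerivWithinAt_of_pos hS0 C.contDiff.continuous hpos)
      (fun t ht => (hφ t ⟨ht.1, ht.2.trans hSτ⟩).mono (Icc_subset_Icc_right hSτ)) (by rw [h0, hφ0])
  -- Positivity of the height is all that is missing. It holds inside the box by `snd_pos`. At a
  -- first later zero the solution still agrees with `φ`, which is positive there.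
  suffices H : ∀ S, 0 ≤ S → S ≤ T → S ≤ τ → ∀ w ∈ Ioo 0 S, 0 < (γ w).2 by
    intro t ht htτ
    exact key t ht.1 ht.2 htτ (H t ht.1 ht.2 htτ) (right_mem_Icc.2 ht.1)
  intro S hS0 hST hSτ w hw
  by_contra! hle
  have hwT₀ : T₀ < w := by
    by_contra! hcon
    exact absurd (hpos₀ w ⟨hw.1, hcon⟩) (not_lt.2 hle)
  obtain ⟨z, hz, hz0, hzpos⟩ := exists_first_nonpos hwT₀.le
    (hcont.snd.mono (Icc_subset_Icc hT₀.le (hw.2.le.trans hST))) hle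
  have hz' : 0 < z := hT₀.trans_le hz.1
  have hzτ : z < τ := (hz.2.trans_lt hw.2).trans_le hSτ
  have heq := key z hz'.le (hz.2.trans (hw.2.le.trans hST)) hzτ.le (fun u hu => by
    rcases le_or_gt u T₀ with h' | h'
    · exact hpos₀ u ⟨hu.1, h'⟩
    · exact hzpos u ⟨h'.le, hu.2⟩) (right_mem_Icc.2 hz'.le)
  have := hφpos z ⟨hz', hzτ⟩
  rw [← heq] at this
  linarith

end FoldCorner

/-! ### Existence of sliding motions. -/

theorem exists_scalar_solution {S : ℝ → ℝ} {L c : ℝ} (hL : 0 < L) (hc : 0 < c)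
    (hS : ContinuousOn S (Icc 0 L)) (hb : ∀ w ∈ Icc 0 L, c ≤ S w) :
    ∃ T > 0, ∃ ψ : ℝ → ℝ, ψ 0 = 0 ∧ ψ T = L ∧ Continuous ψ ∧ ψ '' Icc 0 T = Icc 0 L ∧
      ∀ t ∈ Icc 0 T, HasDerivAt ψ (S (ψ t)) t := by
  set S' : ℝ → ℝ := IccExtend hL.le ((Icc 0 L).domRestrict S) with hS'
  have hS'c : Continuous S' := hS.domRestrict.Icc_extend'
  have hS'e : ∀ w ∈ Icc 0 L, S' w = S w := fun w hw => by
    rw [hS', IccExtend_of_mem hL.le _ hw]; rfl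
  have hS'p : ∀ w, S' w ∈ S '' Icc 0 L := fun w =>
    ⟨projIcc 0 L hL.le w, (projIcc 0 L hL.le w).2, rfl⟩
  have hS'b : ∀ w, c ≤ S' w := fun w => by
    obtain ⟨u, hu, hu'⟩ := hS'p w
    rw [← hu']; exact hb u hu
  obtain ⟨B, hB⟩ := (isCompact_Icc.image_of_continuousOn hS).bddAbove
  have hS'B : ∀ w, S' w ≤ B := fun w => hB (hS'p w)
  have hBpos : 0 < B := hc.trans_le ((hS'b 0).trans (hS'B 0))
  have hinvc : Continuous fun w => (S' w)⁻¹ := hS'c.inv₀ fun w => (hc.trans_le (hS'b w)).ne'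
  -- `G` is the travel time; its inverse solves the equation. As the speed is bounded away from
  -- zero, continuity suffices and no Lipschitz condition is needed.
  set G : ℝ → ℝ := fun w => ∫ u in (0 : ℝ)..w, (S' u)⁻¹ with hG
  have hGd : ∀ w, HasDerivAt G ((S' w)⁻¹) w := fun w =>
    (hinvc.integral_hasStrictDerivAt 0 w).hasDerivAt
  have hGc : Continuous G := continuous_iff_continuousAt.2 fun w => (hGd w).continuousAt
  have hG0 : G 0 = 0 := by simp [hG]
  have hGm : StrictMono G := strictMono_of_deriv_pos fun w => by
    rw [(hGd w).deriv]
    exact inv_pos.2 (hc.trans_le (hS'b w))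
  -- An upper bound on the speed makes the travel time grow at least linearly, so `G` is onto and
  -- has a global inverse.
  have hGB : Monotone fun w => G w - w * B⁻¹ := by
    have hd : ∀ w, HasDerivAt (fun w => G w - w * B⁻¹) ((S' w)⁻¹ - 1 * B⁻¹) w := fun w =>
      (hGd w).sub ((hasDerivAt_id w).mul_const _)
    refine monotone_of_deriv_nonneg (fun w => (hd w).differentiableAt) fun w => ?_
    rw [(hd w).deriv, one_mul, sub_nonneg]
    exact inv_anti₀ (hc.trans_le (hS'b w)) (hS'B w)
  have htop : Tendsto G atTop atTop := by
    refine tendsto_atTop_mono' _ ?_ (tendsto_id.atTop_mul_const (inv_pos.2 hBpos))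
    filter_upwards [eventually_ge_atTop 0] with w hw
    have := hGB hw
    simp only [hG0, zero_mul, sub_zero] at this
    simpa using this
  have hbot : Tendsto G atBot atBot := by
    refine tendsto_atBot_mono' _ ?_ (tendsto_id.atBot_mul_const (inv_pos.2 hBpos))
    filter_upwards [eventually_le_atBot 0] with w hw
    have := hGB hw
    simp only [hG0, zero_mul, sub_zero] at this
    simpa using this
  set e := hGm.orderIsoOfSurjective G (hGc.surjective htop hbot) with he
  have heG : ∀ w, e w = G w := fun w => rfl
  have hψG : ∀ w, e.symm (G w) = w := fun w => e.symm_apply_apply w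
  have hGψ : ∀ t, G (e.symm t) = t := fun t => e.apply_symm_apply t
  have hψ0 : e.symm 0 = 0 := by
    have := hψG 0
    rwa [hG0] at this
  have himg : e.symm '' Icc 0 (G L) = Icc 0 L := by
    rw [OrderIso.image_Icc, hψ0, hψG]
  refine ⟨G L, by have := hGm hL; rwa [hG0] at this, e.symm, hψ0, hψG L, e.symm.continuous, himg, ?_⟩
  intro t ht
  have hmem : e.symm t ∈ Icc 0 L := himg ▸ mem_image_of_mem _ ht
  have := (hGd (e.symm t)).of_local_left_inverse e.symm.continuous.continuousAt
    (inv_ne_zero (hc.trans_le (hS'b _)).ne') (Eventually.of_forall hGψ)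
  rwa [inv_inv, hS'e _ hmem] at this

theorem slidingField_mem_segment {Zp Zm : ℝ × ℝ → ℝ × ℝ} {p : ℝ × ℝ} (hp : (Zp p).2 ≤ 0)
    (hm : 0 < (Zm p).2) :
    slidingField Zp Zm p ∈ segment ℝ (Zm p) (Zp p) ∧ (slidingField Zp Zm p).2 = 0 := by
  have hd : (Zp p).2 - (Zm p).2 < 0 := by linarith
  refine ⟨⟨_, _, div_nonneg_of_nonpos hp hd.le, ?_, by ring, rfl⟩, ?_⟩
  · rw [sub_nonneg, div_le_one_of_neg hd]
    linarith
  · have := hd.ne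
    simp only [slidingField, Prod.snd_add, Prod.smul_snd, smul_eq_mul]
    field_simp
    ring

theorem mk_zero_mem_cornerBox {a δ x : ℝ} (hx : |x + a| ≤ δ) : (x, (0 : ℝ)) ∈ cornerBox a δ :=
  ⟨hx, by simpa using (abs_nonneg _).trans hx⟩

namespace FoldCorner

variable {Z : ℝ × ℝ → ℝ × ℝ} {σ a r δ c : ℝ}

theorem upper_nonpos (C : FoldCorner Z σ a r δ c) {x : ℝ} (hx : |x + a| ≤ δ)
    (hσ : σ * (x + r) ≤ 0) : (Z (x, 0)).2 ≤ 0 := by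
  rcases hσ.eq_or_lt with h | h
  · have hσ0 : σ ≠ 0 := by
      rintro rfl
      simpa using C.sign
    have : x = -r := by
      rcases mul_eq_zero.1 h with h' | h'
      · exact absurd h' hσ0
      · linarith
    rw [this, C.fold]
  · exact (C.attracting x hx h).le

theorem le_slidingField (C : FoldCorner Z σ a r δ c) {x : ℝ} (hx : |x + a| ≤ δ)
    (hσ : σ * (x + r) ≤ 0) : c ≤ σ * (slidingField Z (centralField Z) (x, 0)).1 := by
  have := slidingField_mem_segment (Zm := centralField Z) (C.upper_nonpos hx hσ)
    (C.lower_pos _ (mk_zero_mem_cornerBox hx))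
  exact C.sliding x hx _ this.1 this.2

/-- With the distance from `x` in the direction σ as coordinate, sliding is a scalar equation with
speed at least `c` on an interval of length `-(σ * (x + r))`. -/
theorem exists_slide (C : FoldCorner Z σ a r δ c) {x : ℝ} (hx : |x + a| ≤ δ) (hr : |r - a| ≤ δ)
    (hσ : σ * (x + r) < 0) : ∃ T > 0, ∃ β : ℝ → ℝ × ℝ, β 0 = (x, 0) ∧ β T = (-r, 0) ∧
      IsSolution Z (centralField Z) β 0 T ∧
      β '' Icc 0 T = (fun u : ℝ => (u, (0 : ℝ))) '' uIcc x (-r) := by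
  have hσ2 : σ * σ = 1 := by
    rcases eq_or_eq_neg_of_abs_eq C.sign with rfl | rfl <;> norm_num
  set L := -(σ * (x + r)) with hL
  have hL0 : 0 < L := by linarith
  have hfac : ∀ w ∈ Icc 0 L, |x + σ * w + a| ≤ δ ∧ σ * (x + σ * w + r) ≤ 0 := by
    intro w hw
    have e : σ * (x + σ * w + r) = w - L := by rw [hL]; linear_combination w * hσ2
    refine ⟨?_, by rw [e]; linarith [hw.2]⟩
    rw [abs_le] at hx hr ⊢
    rcases eq_or_eq_neg_of_abs_eq C.sign with rfl | rfl <;> constructor <;> linarith [hw.1, hw.2]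
  set X : ℝ → ℝ × ℝ := fun w => slidingField Z (centralField Z) (x + σ * w, 0) with hX
  have hXc : ContinuousOn X (Icc 0 L) := by
    have h1 : Continuous fun w : ℝ => Z (x + σ * w, 0) :=
      C.contDiff.continuous.comp (by fun_prop)
    have h2 : Continuous fun w : ℝ => centralField Z (x + σ * w, 0) :=
      (continuous_centralField C.contDiff.continuous).comp (by fun_prop)
    have h3 : ContinuousOn (fun w : ℝ => (Z (x + σ * w, 0)).2 /
        ((Z (x + σ * w, 0)).2 - (centralField Z (x + σ * w, 0)).2)) (Icc 0 L) :=
      h1.snd.continuousOn.div (h1.snd.sub h2.snd).continuousOn fun w hw => by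
        have h4 := C.upper_nonpos (hfac w hw).1 (hfac w hw).2
        have h5 := C.lower_pos _ (mk_zero_mem_cornerBox (hfac w hw).1)
        linarith
    exact (h3.smul h2.continuousOn).add ((continuousOn_const.sub h3).smul h1.continuousOn)
  have hXS : ∀ w ∈ Icc 0 L, X w ∈ segment ℝ (centralField Z (x + σ * w, 0)) (Z (x + σ * w, 0)) ∧
      (X w).2 = 0 := fun w hw =>
    slidingField_mem_segment (C.upper_nonpos (hfac w hw).1 (hfac w hw).2)
      (C.lower_pos _ (mk_zero_mem_cornerBox (hfac w hw).1))
  obtain ⟨T, hT, ψ, hψ0, hψT, hψc, himg, hψd⟩ := exists_scalar_solution (S := fun w => σ * (X w).1)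
    hL0 C.c_pos (continuousOn_const.mul hXc.fst)
    fun w hw => C.le_slidingField (hfac w hw).1 (hfac w hw).2
  have hmem : ∀ t ∈ Icc 0 T, ψ t ∈ Icc 0 L := fun t ht => himg ▸ mem_image_of_mem ψ ht
  refine ⟨T, hT, fun t => (x + σ * ψ t, 0), by simp [hψ0], ?_, ?_, ?_⟩
  · refine Prod.ext ?_ rfl
    show x + σ * ψ T = -r
    rw [hψT, hL]
    linear_combination (-(x + r)) * hσ2
  · refine isSolution_of_hasDerivWithinAt (v := fun t => X (ψ t)) hT.le
      (hXc.comp hψc.continuousOn hmem) (fun t ht => ?_) fun t ht => ?_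
    · have h1 : HasDerivAt (fun t => x + σ * ψ t) (X (ψ t)).1 t := by
        have := ((hψd t ht).const_mul σ).const_add x
        rwa [← mul_assoc, hσ2, one_mul] at this
      have h2 := h1.prodMk (hasDerivAt_const t (0 : ℝ))
      have e : X (ψ t) = ((X (ψ t)).1, 0) := Prod.ext rfl (hXS _ (hmem t ht)).2
      rw [e]
      exact h2.hasDerivWithinAt
    · exact Or.inr (Or.inr ⟨rfl, (hXS _ (hmem t (Ioo_subset_Icc_self ht))).1⟩)
  · have : (fun t => (x + σ * ψ t, (0 : ℝ))) '' Icc 0 T =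
        (fun u : ℝ => (u, (0 : ℝ))) '' ((fun w => x + σ * w) '' (ψ '' Icc 0 T)) := by
      simp only [image_image]
    rw [this, himg]
    congr 1
    rcases eq_or_eq_neg_of_abs_eq C.sign with rfl | rfl
    · have hle : x ≤ -r := by linarith
      rw [uIcc_of_le hle]
      ext u
      simp only [mem_image, mem_Icc, one_mul]
      constructor
      · rintro ⟨w, hw, rfl⟩
        exact ⟨by linarith, by linarith⟩
      · intro hu
        exact ⟨u - x, ⟨by linarith, by linarith⟩, by ring⟩
    · have hle : -r ≤ x := by linarith
      rw [uIcc_of_ge hle]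
      ext u
      simp only [mem_image, mem_Icc]
      constructor
      · rintro ⟨w, hw, rfl⟩
        exact ⟨by linarith, by linarith⟩
      · intro hu
        exact ⟨x - u, ⟨by linarith, by linarith⟩, by ring⟩

end FoldCorner

/-- Quantitative description of the upper half of a neighbourhood of a symmetric loop through the
fold corner: `φ x` is the upper orbit from `(x, 0)`, which returns to `Σ` at time `τ x` in the point
`(-Q x, 0)`.  Every upper orbit from `W` meets `Σ` near `(-a, 0)` or `(a, 0)`. -/
structure LoopData (Z : ℝ × ℝ → ℝ × ℝ) (σ a r δ c ε M τmin : ℝ) (V W : Set (ℝ × ℝ))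
    (φ : ℝ → ℝ → ℝ × ℝ) (τ Q : ℝ → ℝ) : Prop extends FoldCorner Z σ a r δ c where
  eps_pos : 0 < ε
  eps_lt : ε < δ
  eps_le : 2 * ε ≤ a
  r_mem : |r - a| ≤ ε
  time_pos : 0 < τmin
  time_ge : ∀ x, |x + a| ≤ ε → τmin ≤ τ x
  time_le : ∀ x, |x + a| ≤ ε → τ x ≤ M
  lift_zero : ∀ x, |x + a| ≤ ε → φ x 0 = (x, 0)
  lift_deriv : ∀ x, |x + a| ≤ ε → ∀ t ∈ Icc 0 (τ x),
    HasDerivWithinAt (φ x) (Z (φ x t)) (Icc 0 (τ x)) t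
  lift_pos : ∀ x, |x + a| ≤ ε → 0 ≤ σ * (x + r) → ∀ t ∈ Ioo 0 (τ x), 0 < (φ x t).2
  lift_end : ∀ x, |x + a| ≤ ε → φ x (τ x) = (-Q x, 0)
  lift_mem : ∀ x, |x + a| ≤ ε → ∀ t ∈ Icc 0 (τ x), φ x t ∈ V
  map_mem : ∀ x, |x + a| ≤ ε → |Q x + a| < ε
  map_lip : ∀ x y, |x + a| ≤ ε → |y + a| ≤ ε → |Q x - Q y| ≤ 1 / 2 * |x - y|
  map_diff : ∀ x, |x + a| ≤ ε → ∃ μ, HasDerivAt Q μ x ∧ |μ| ≤ 1 / 2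
  base_mem : ∀ x, |x + a| ≤ ε → (x, (0 : ℝ)) ∈ V
  neg_mem_V : ∀ p ∈ V, -p ∈ V
  neg_mem_W : ∀ p ∈ W, -p ∈ W
  entry : ∀ p ∈ W, 0 ≤ p.2 → ∃ (S : ℝ) (u : ℝ → ℝ × ℝ), 0 ≤ S ∧ u 0 = p ∧ S ≤ M ∧
    (∀ t ∈ Icc 0 S, HasDerivWithinAt u (Z (u t)) (Icc 0 S) t) ∧ (∀ t ∈ Icc 0 S, u t ∈ V) ∧
    (∀ t ∈ Ico 0 S, 0 < (u t).2) ∧ (u S).2 = 0 ∧ (|(u S).1 + a| ≤ ε ∨ |-(u S).1 + a| ≤ ε)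

/-- The half-return map. -/
noncomputable def halfMap (σ r : ℝ) (Q : ℝ → ℝ) (x : ℝ) : ℝ := Q (foldClamp σ r x)

/-- The trace of the solution from `(x, 0)` until it meets `Σ` on the other side. -/
def halfTrace (σ r : ℝ) (φ : ℝ → ℝ → ℝ × ℝ) (τ : ℝ → ℝ) (x : ℝ) : Set (ℝ × ℝ) :=
  (fun u : ℝ => (u, (0 : ℝ))) '' uIcc x (foldClamp σ r x) ∪
    φ (foldClamp σ r x) '' Icc 0 (τ (foldClamp σ r x))

/-- Solutions merge while they slide: every point passed on the way to the fold has the same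
continuation from the fold on. -/
theorem foldClamp_eq_of_mem_uIcc {σ r x y : ℝ} (hσ : |σ| = 1)
    (h : y ∈ uIcc x (foldClamp σ r x)) : foldClamp σ r y = foldClamp σ r x := by
  rw [mem_uIcc] at h
  unfold foldClamp at h ⊢
  rcases eq_or_eq_neg_of_abs_eq hσ with rfl | rfl <;> clear hσ <;> split_ifs at h ⊢ <;> grind

/-! ### The half-return map and forward solutions near the loop. -/

namespace LoopData

variable {Z : ℝ × ℝ → ℝ × ℝ} {σ a r δ c ε M τmin : ℝ} {V W : Set (ℝ × ℝ)}
  {φ : ℝ → ℝ → ℝ × ℝ} {τ Q : ℝ → ℝ} {γ : ℝ → ℝ × ℝ}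

theorem clamp_mem (D : LoopData Z σ a r δ c ε M τmin V W φ τ Q) {x : ℝ} (hx : |x + a| ≤ ε) :
    |foldClamp σ r x + a| ≤ ε := by
  unfold foldClamp
  split_ifs
  · exact hx
  · have := D.r_mem
    rwa [show -r + a = -(r - a) by ring, abs_neg]

theorem uIcc_mem (D : LoopData Z σ a r δ c ε M τmin V W φ τ Q) {x u : ℝ} (hx : |x + a| ≤ ε)
    (hu : u ∈ uIcc x (foldClamp σ r x)) : |u + a| ≤ ε := by
  have h := D.clamp_mem hx
  rw [abs_le] at hx h ⊢
  rw [mem_uIcc] at hu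
  rcases hu with hu | hu <;> constructor <;> linarith [hu.1, hu.2]

theorem halfMap_mem (D : LoopData Z σ a r δ c ε M τmin V W φ τ Q) {x : ℝ} (hx : |x + a| ≤ ε) :
    |halfMap σ r Q x + a| ≤ ε :=
  (D.map_mem _ (D.clamp_mem hx)).le

theorem halfMap_lip (D : LoopData Z σ a r δ c ε M τmin V W φ τ Q) {x y : ℝ} (hx : |x + a| ≤ ε)
    (hy : |y + a| ≤ ε) : |halfMap σ r Q x - halfMap σ r Q y| ≤ 1 / 2 * |x - y| :=
  (D.map_lip _ _ (D.clamp_mem hx) (D.clamp_mem hy)).trans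
    (mul_le_mul_of_nonneg_left (abs_foldClamp_sub_le D.sign) (by norm_num))

theorem iterate_mem (D : LoopData Z σ a r δ c ε M τmin V W φ τ Q) {x : ℝ} (hx : |x + a| ≤ ε)
    (n : ℕ) : |(halfMap σ r Q)^[n] x + a| ≤ ε := by
  induction n generalizing x with
  | zero => exact hx
  | succ n ih => exact ih (D.halfMap_mem hx)

theorem iterate_lip (D : LoopData Z σ a r δ c ε M τmin V W φ τ Q) {x y : ℝ} (hx : |x + a| ≤ ε)
    (hy : |y + a| ≤ ε) (n : ℕ) :
    |(halfMap σ r Q)^[n] x - (halfMap σ r Q)^[n] y| ≤ (1 / 2) ^ n * |x - y| := by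
  induction n generalizing x y with
  | zero => simp
  | succ n ih =>
    refine (ih (D.halfMap_mem hx) (D.halfMap_mem hy)).trans ?_
    rw [pow_succ, mul_assoc]
    exact mul_le_mul_of_nonneg_left (D.halfMap_lip hx hy) (by positivity)

/-- Existence only needs a continuous self-map of an interval; contraction is used for uniqueness.
-/
theorem exists_fixedPoint (D : LoopData Z σ a r δ c ε M τmin V W φ τ Q) :
    ∃ x, |x + a| ≤ ε ∧ halfMap σ r Q x = x := by
  have hmem : ∀ x, x ∈ Icc (-a - ε) (-a + ε) ↔ |x + a| ≤ ε := fun x => by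
    rw [abs_le, mem_Icc]
    constructor <;> rintro ⟨h1, h2⟩ <;> constructor <;> linarith
  have hlip : LipschitzOnWith (1 / 2) (halfMap σ r Q) (Icc (-a - ε) (-a + ε)) :=
    LipschitzOnWith.of_dist_le_mul fun x hx y hy => by
      simpa [Real.dist_eq] using D.halfMap_lip ((hmem x).1 hx) ((hmem y).1 hy)
  obtain ⟨x, hx, hfix⟩ := exists_mem_Icc_isFixedPt_of_mapsTo hlip.continuousOn
    (by linarith [D.eps_pos]) fun x hx => (hmem _).2 (D.halfMap_mem ((hmem x).1 hx))
  exact ⟨x, (hmem x).1 hx, hfix⟩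

/-- A contraction has no periodic points besides its fixed point. Periods other than one matter
because a periodic orbit could a priori wind around several times. -/
theorem eq_of_iterate_eq (D : LoopData Z σ a r δ c ε M τmin V W φ τ Q) {x y : ℝ}
    (hx : |x + a| ≤ ε) (hfix : halfMap σ r Q x = x) (hy : |y + a| ≤ ε) {n : ℕ} (hn : n ≠ 0)
    (h : (halfMap σ r Q)^[n] y = y) : y = x := by
  have h1 := D.iterate_lip hy hx n
  rw [h, Function.iterate_fixed hfix] at h1
  have h2 : ((1 : ℝ) / 2) ^ n ≤ 1 / 2 := by
    calc ((1 : ℝ) / 2) ^ n ≤ (1 / 2) ^ 1 :=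
          pow_le_pow_of_le_one (by norm_num) (by norm_num) (Nat.one_le_iff_ne_zero.2 hn)
      _ = 1 / 2 := pow_one _
  have h3 := mul_le_mul_of_nonneg_right h2 (abs_nonneg (y - x))
  have h4 : |y - x| = 0 := le_antisymm (by linarith) (abs_nonneg _)
  linarith [abs_eq_zero.1 h4]

theorem halfTrace_subset (D : LoopData Z σ a r δ c ε M τmin V W φ τ Q) {x : ℝ}
    (hx : |x + a| ≤ ε) : halfTrace σ r φ τ x ⊆ V := by
  rintro p (⟨u, hu, rfl⟩ | ⟨t, ht, rfl⟩)
  · exact D.base_mem u (D.uIcc_mem hx hu)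
  · exact D.lift_mem _ (D.clamp_mem hx) t ht

theorem halfTrace_of_snd_eq_zero (D : LoopData Z σ a r δ c ε M τmin V W φ τ Q) {x u : ℝ}
    (hx : |x + a| ≤ ε) : (u, (0 : ℝ)) ∈ halfTrace σ r φ τ x ↔
      u ∈ uIcc x (foldClamp σ r x) ∨ u = -halfMap σ r Q x := by
  have hk := D.clamp_mem hx
  constructor
  · rintro (⟨v, hv, h⟩ | ⟨t, ht, h⟩)
    · rw [Prod.mk.injEq] at h
      exact Or.inl (h.1 ▸ hv)
    · rcases ht.1.eq_or_lt with rfl | h1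
      · rw [D.lift_zero _ hk, Prod.mk.injEq] at h
        exact Or.inl (h.1 ▸ right_mem_uIcc)
      rcases ht.2.eq_or_lt with rfl | h2
      · rw [D.lift_end _ hk, Prod.mk.injEq] at h
        exact Or.inr h.1.symm
      have := D.lift_pos _ hk (foldClamp_nonneg σ r x) t ⟨h1, h2⟩
      rw [h] at this
      exact absurd this (lt_irrefl _)
  · rintro (h | rfl)
    · exact Or.inl (mem_image_of_mem _ h)
    · exact Or.inr ⟨_, right_mem_Icc.2 (D.time_pos.le.trans (D.time_ge _ hk)), D.lift_end _ hk⟩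

/-- The slide takes at most `2 * ε / c` and the arc at most `M`. Either `T` comes too early and the
solution is still on its first half trace, or the half trace has been run through completely. -/
theorem passage (D : LoopData Z σ a r δ c ε M τmin V W φ τ Q) {x T : ℝ} (hT : 0 ≤ T)
    (h : IsSolution Z (centralField Z) γ 0 T) (h0 : γ 0 = (x, 0)) (hx : |x + a| ≤ ε) :
    (T ≤ M + 2 * ε / c ∧ ∀ t ∈ Icc 0 T, γ t ∈ halfTrace σ r φ τ x) ∨
    ∃ t₁ ∈ Icc τmin T, t₁ ≤ M + 2 * ε / c ∧ γ t₁ = (-halfMap σ r Q x, 0) ∧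
      γ '' Icc 0 t₁ = halfTrace σ r φ τ x := by
  have hk := D.clamp_mem hx
  have hτ := D.time_ge _ hk
  have hτM := D.time_le _ hk
  have hτ0 : 0 < τ (foldClamp σ r x) := D.time_pos.trans_le hτ
  rcases D.slide D.eps_lt hT D.r_mem hx h h0 with ⟨hTc, hmem⟩ | ⟨t₁, ht₁, ht₁c, hend, himg⟩
  · left
    refine ⟨?_, fun t ht => Or.inl (hmem t ht)⟩
    have : T ≤ 2 * ε / c := by
      rw [le_div_iff₀ D.c_pos]
      linarith
    linarith
  have ht₁' : t₁ ≤ 2 * ε / c := by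
    rw [le_div_iff₀ D.c_pos]
    linarith
  have hsol : IsSolution Z (centralField Z) (fun t => γ (t₁ + t)) 0 (T - t₁) := by
    refine IsSolution.comp_add_left ?_
    rw [add_zero, add_sub_cancel]
    exact h.mono ht₁.1 ht₁.2 le_rfl
  have hlift := D.lift (sub_nonneg.2 ht₁.2) (hk.trans_lt D.eps_lt) (foldClamp_nonneg σ r x) hsol
    (by simpa using hend) (D.lift_zero _ hk) (D.lift_deriv _ hk)
    (D.lift_pos _ hk (foldClamp_nonneg σ r x))
  have hfirst : ∀ t ∈ Icc 0 t₁, γ t ∈ halfTrace σ r φ τ x := fun t ht =>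
    Or.inl (himg ▸ mem_image_of_mem γ ht)
  rcases le_or_gt (τ (foldClamp σ r x)) (T - t₁) with hle | hlt
  · right
    refine ⟨t₁ + τ (foldClamp σ r x), ⟨by linarith [ht₁.1], by linarith⟩, by linarith, ?_, ?_⟩
    · have := hlift _ ⟨hτ0.le, hle⟩ le_rfl
      rw [this, D.lift_end _ hk]
      rfl
    · rw [halfTrace, ← himg, ← Icc_union_Icc_eq_Icc ht₁.1
        (le_add_of_nonneg_right hτ0.le : t₁ ≤ t₁ + τ (foldClamp σ r x)), image_union]
      congr 1
      ext p
      constructor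
      · rintro ⟨t, ht, rfl⟩
        refine ⟨t - t₁, ⟨by linarith [ht.1], by linarith [ht.2]⟩, ?_⟩
        have := hlift (t - t₁) ⟨by linarith [ht.1], by linarith [ht.2]⟩ (by linarith [ht.2])
        rw [← this, add_sub_cancel]
      · rintro ⟨t, ht, rfl⟩
        refine ⟨t₁ + t, ⟨by linarith [ht.1], by linarith [ht.2]⟩, ?_⟩
        exact hlift t ⟨ht.1, ht.2.trans hle⟩ ht.2
  · left
    refine ⟨by linarith, fun t ht => ?_⟩
    rcases le_or_gt t t₁ with h' | h'
    · exact hfirst t ⟨ht.1, h'⟩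
    · have := hlift (t - t₁) ⟨by linarith, by linarith [ht.2]⟩ (by linarith [ht.2])
      rw [add_sub_cancel] at this
      exact Or.inr ⟨t - t₁, ⟨by linarith, by linarith [ht.2]⟩, this.symm⟩

/-- A solution after time `t₁`, seen through the central symmetry. -/
theorem _root_.IsSolution.neg_comp_add {t₁ T : ℝ} (h : IsSolution Z (centralField Z) γ 0 T)
    (h1 : 0 ≤ t₁) (h2 : t₁ ≤ T) :
    IsSolution Z (centralField Z) (fun t => -γ (t₁ + t)) 0 (T - t₁) := by
  refine (IsSolution.comp_add_left ?_).neg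
  rw [add_zero, add_sub_cancel]
  exact h.mono h1 h2 le_rfl

/-- Reflecting after each completed half turn returns the situation to the left end with `x`
replaced by its image. A half turn costs at least `τmin`, so about `T / τmin` of them suffice. -/
theorem follow (D : LoopData Z σ a r δ c ε M τmin V W φ τ Q) {x T : ℝ} (hT : 0 ≤ T)
    (h : IsSolution Z (centralField Z) γ 0 T) (h0 : γ 0 = (x, 0)) (hx : |x + a| ≤ ε) :
    ∀ t ∈ Icc 0 T, ∃ n, γ t ∈ halfTrace σ r φ τ ((halfMap σ r Q)^[n] x) ∨
      -γ t ∈ halfTrace σ r φ τ ((halfMap σ r Q)^[n] x) := by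
  obtain ⟨N, hN⟩ := exists_nat_ge (T / τmin)
  rw [div_le_iff₀ D.time_pos] at hN
  induction N generalizing γ x T with
  | zero =>
    intro t ht
    have ht0 : t = 0 := by
      have : T = 0 := le_antisymm (by simpa using hN) hT
      exact le_antisymm (this ▸ ht.2) ht.1
    exact ⟨0, Or.inl (Or.inl ⟨x, left_mem_uIcc, by rw [ht0, h0]⟩)⟩
  | succ N ih =>
    intro t ht
    rcases D.passage hT h h0 hx with ⟨-, hmem⟩ | ⟨t₁, ht₁, -, hend, himg⟩
    · exact ⟨0, Or.inl (hmem t ht)⟩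
    have ht₁0 : 0 ≤ t₁ := D.time_pos.le.trans ht₁.1
    rcases le_or_gt t t₁ with hle | hlt
    · exact ⟨0, Or.inl (himg ▸ mem_image_of_mem γ ⟨ht.1, hle⟩)⟩
    · obtain ⟨n, hn⟩ := ih (γ := fun t => -γ (t₁ + t)) (x := halfMap σ r Q x) (T := T - t₁)
        (by linarith [ht₁.2]) (h.neg_comp_add ht₁0 ht₁.2) (by simp [hend]) (D.halfMap_mem hx)
        (by push_cast at hN; linarith [ht₁.1]) (t - t₁) ⟨by linarith, by linarith [ht.2]⟩
      refine ⟨n + 1, ?_⟩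
      rw [Function.iterate_succ_apply]
      simpa [or_comm] using hn

/-- A time longer than `n` maximal passages rules out the unfinished alternative of `passage` at
each of the first `n` half turns. -/
theorem hits (D : LoopData Z σ a r δ c ε M τmin V W φ τ Q) {x T : ℝ} (n : ℕ)
    (hT : n * (M + 2 * ε / c) < T) (h : IsSolution Z (centralField Z) γ 0 T) (h0 : γ 0 = (x, 0))
    (hx : |x + a| ≤ ε) : ∃ t ∈ Icc 0 T, t ≤ n * (M + 2 * ε / c) ∧
      (γ t = ((halfMap σ r Q)^[n] x, 0) ∨ -γ t = ((halfMap σ r Q)^[n] x, 0)) := by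
  have hM : 0 < M + 2 * ε / c := by
    have h1 := (D.time_pos.trans_le (D.time_ge x hx)).trans_le (D.time_le x hx)
    have h2 := div_pos (mul_pos two_pos D.eps_pos) D.c_pos
    linarith
  induction n generalizing γ x T with
  | zero => exact ⟨0, ⟨le_rfl, by simpa using hT.le⟩, by simp, Or.inl h0⟩
  | succ n ih =>
    push_cast at hT ⊢
    have hn : 0 ≤ n * (M + 2 * ε / c) := by positivity
    rcases D.passage (by linarith) h h0 hx with ⟨hle, -⟩ | ⟨t₁, ht₁, ht₁M, hend, himg⟩
    · linarith
    have ht₁0 : 0 ≤ t₁ := D.time_pos.le.trans ht₁.1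
    obtain ⟨t, ht, htM, h'⟩ := ih (γ := fun t => -γ (t₁ + t)) (x := halfMap σ r Q x) (T := T - t₁)
      (by linarith) (h.neg_comp_add ht₁0 ht₁.2) (by simp [hend]) (D.halfMap_mem hx)
    refine ⟨t₁ + t, ⟨by linarith [ht.1], by linarith [ht.2]⟩, by linarith, ?_⟩
    rw [Function.iterate_succ_apply]
    simpa [or_comm] using h'

end LoopData

/-- The union of the half trace from `(x, 0)` and its image under the central symmetry. -/
def loopTrace (σ r : ℝ) (φ : ℝ → ℝ → ℝ × ℝ) (τ : ℝ → ℝ) (x : ℝ) : Set (ℝ × ℝ) :=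
  {p | p ∈ halfTrace σ r φ τ x ∨ -p ∈ halfTrace σ r φ τ x}

/-- `γ` is a `T`-periodic Filippov solution for all positive times. -/
def IsPeriodicSolution (Z : ℝ × ℝ → ℝ × ℝ) (γ : ℝ → ℝ × ℝ) (T : ℝ) : Prop :=
  0 < T ∧ Function.Periodic γ T ∧ ∀ S, 0 ≤ S → IsSolution Z (centralField Z) γ 0 S

/-! ### Periodic solutions. -/

namespace IsPeriodicSolution

variable {Z : ℝ × ℝ → ℝ × ℝ} {γ : ℝ → ℝ × ℝ} {T : ℝ}

/-- The definition of a periodic orbit asks for a solution on one period only; its translates are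
glued together. -/
theorem of_isSolution (hT : 0 < T) (hper : Function.Periodic γ T)
    (h : IsSolution Z (centralField Z) γ 0 T) : IsPeriodicSolution Z γ T := by
  refine ⟨hT, hper, fun S hS => ?_⟩
  have key : ∀ n : ℕ, IsSolution Z (centralField Z) γ 0 (n * T) := by
    intro n
    induction n with
    | zero => simpa using isSolution_refl
    | succ n ih =>
      have hn : 0 ≤ (n : ℝ) * T := by positivity
      refine ih.trans (t := n * T) hn (by push_cast; nlinarith) ?_
      have h1 : IsSolution Z (centralField Z) (fun t => γ (-(n * T) + t)) (n * T)
          ((n + 1 : ℕ) * T) := by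
        refine IsSolution.comp_add_left ?_
        rw [show -((n : ℝ) * T) + n * T = 0 by ring,
          show -((n : ℝ) * T) + (n + 1 : ℕ) * T = T by push_cast; ring]
        exact h
      have h2 : (fun t => γ (-(n * T) + t)) = γ := by
        funext t
        rw [neg_add_eq_sub]
        exact (hper.nat_mul n).sub_eq t
      rwa [h2] at h1
  obtain ⟨n, hn⟩ := exists_nat_ge (S / T)
  rw [div_le_iff₀ hT] at hn
  exact (key n).mono le_rfl hS hn

theorem shift (h : IsPeriodicSolution Z γ T) {s : ℝ} (hs : 0 ≤ s) :
    IsPeriodicSolution Z (fun t => γ (s + t)) T := by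
  refine ⟨h.1, fun t => ?_, fun S hS => IsSolution.comp_add_left ?_⟩
  · show γ (s + (t + T)) = γ (s + t)
    rw [← add_assoc]
    exact h.2.1 _
  · rw [add_zero]
    exact (h.2.2 (s + S) (by linarith)).mono hs (by linarith) le_rfl

theorem neg (h : IsPeriodicSolution Z γ T) : IsPeriodicSolution Z (fun t => -γ t) T :=
  ⟨h.1, fun t => congrArg Neg.neg (h.2.1 t), fun S hS => (h.2.2 S hS).neg⟩

theorem exists_large (h : IsPeriodicSolution Z γ T) (s t : ℝ) : ∃ u, s ≤ u ∧ γ u = γ t := by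
  obtain ⟨n, hn⟩ := exists_nat_ge ((s - t) / T)
  rw [div_le_iff₀ h.1] at hn
  exact ⟨t + n * T, by linarith, h.2.1.nat_mul n t⟩

theorem range_shift (s : ℝ) : range (fun t => γ (s + t)) = range γ := by
  ext p
  constructor
  · rintro ⟨t, rfl⟩
    exact ⟨s + t, rfl⟩
  · rintro ⟨t, rfl⟩
    exact ⟨t - s, by simp⟩

end IsPeriodicSolution

/-! ### Trapping and uniqueness of the periodic orbit. -/

namespace LoopData

variable {Z : ℝ × ℝ → ℝ × ℝ} {σ a r δ c ε M τmin : ℝ} {V W : Set (ℝ × ℝ)}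
  {φ : ℝ → ℝ → ℝ × ℝ} {τ Q : ℝ → ℝ} {γ : ℝ → ℝ × ℝ}

theorem follow_entry (D : LoopData Z σ a r δ c ε M τmin V W φ τ Q) {T S : ℝ} {u : ℝ → ℝ × ℝ}
    (hT : 0 ≤ T) (h : IsSolution Z (centralField Z) γ 0 T) (h0 : u 0 = γ 0)
    (hu : ∀ t ∈ Icc 0 S, HasDerivWithinAt u (Z (u t)) (Icc 0 S) t)
    (hpos : ∀ t ∈ Ico 0 S, 0 < (u t).2) : ∀ t ∈ Icc 0 T, t ≤ S → γ t = u t := by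
  have hcont := h.continuousOn hT
  have key : ∀ R, 0 ≤ R → R ≤ T → R ≤ S → (∀ w ∈ Ioo 0 R, 0 < (γ w).2) → EqOn γ u (Icc 0 R) := by
    intro R hR0 hRT hRS hR
    exact D.contDiff.eqOn_of_hasDerivWithinAt
      ((h.mono le_rfl hR0 hRT).hasDerivWithinAt_of_pos hR0 D.contDiff.continuous hR)
      (fun t ht => (hu t ⟨ht.1, ht.2.trans hRS⟩).mono (Icc_subset_Icc_right hRS)) h0.symm
  intro t ht htS
  refine key t ht.1 ht.2 htS (fun w hw => ?_) (right_mem_Icc.2 ht.1)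
  by_contra! hle
  obtain ⟨z, hz, hz0, hzpos⟩ := exists_first_nonpos hw.1.le
    (hcont.snd.mono (Icc_subset_Icc_right (hw.2.le.trans ht.2))) hle
  have hzS : z < S := (hz.2.trans_lt hw.2).trans_le htS
  have heq := key z hz.1 (hz.2.trans (hw.2.le.trans ht.2)) hzS.le
    (fun v hv => hzpos v ⟨hv.1.le, hv.2⟩) (right_mem_Icc.2 hz.1)
  have := hpos z ⟨hz.1, hzS⟩
  rw [← heq] at this
  linarith

theorem exists_base (D : LoopData Z σ a r δ c ε M τmin V W φ τ Q) {T S : ℝ} (hS : S ∈ Icc 0 T)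
    (h : IsSolution Z (centralField Z) γ 0 T) (h0 : (γ S).2 = 0)
    (hm : |(γ S).1 + a| ≤ ε ∨ |-(γ S).1 + a| ≤ ε) :
    (∃ x, |x + a| ≤ ε ∧ (γ S = (x, 0) ∨ -γ S = (x, 0))) ∧ ∀ t ∈ Icc S T, γ t ∈ V := by
  have hb : ∃ x, |x + a| ≤ ε ∧ (γ S = (x, 0) ∨ -γ S = (x, 0)) := by
    rcases hm with hm | hm
    · exact ⟨_, hm, Or.inl (Prod.ext rfl h0)⟩
    · exact ⟨_, hm, Or.inr (Prod.ext rfl (by simp [h0]))⟩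
  refine ⟨hb, fun t ht => ?_⟩
  obtain ⟨x, hx, hγ⟩ := hb
  have hmem : ∀ p : ℝ × ℝ, (∃ n, p ∈ halfTrace σ r φ τ ((halfMap σ r Q)^[n] x) ∨
      -p ∈ halfTrace σ r φ τ ((halfMap σ r Q)^[n] x)) → p ∈ V := by
    rintro p ⟨n, hp | hp⟩
    · exact D.halfTrace_subset (D.iterate_mem hx n) hp
    · simpa using D.neg_mem_V _ (D.halfTrace_subset (D.iterate_mem hx n) hp)
  have hneg := h.neg_comp_add hS.1 hS.2
  have htm : t - S ∈ Icc 0 (T - S) := ⟨by linarith [ht.1], by linarith [ht.2]⟩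
  rcases hγ with hγ | hγ
  · have := D.follow (sub_nonneg.2 hS.2) hneg.neg (by simpa using hγ) hx (t - S) htm
    simp only [neg_neg, add_sub_cancel] at this
    exact hmem _ this
  · have := D.follow (sub_nonneg.2 hS.2) hneg (by simpa using hγ) hx (t - S) htm
    simp only [add_sub_cancel] at this
    simpa using D.neg_mem_V _ (hmem _ this)

/-- The solution follows an upper orbit down to a base segment, and from there `follow` applies. The
first conclusion gives stability, the second brings every periodic orbit in `W` to a base segment.
-/
theorem enter_of_nonneg (D : LoopData Z σ a r δ c ε M τmin V W φ τ Q) {T : ℝ} (hT : 0 ≤ T)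
    (h : IsSolution Z (centralField Z) γ 0 T) (hW : γ 0 ∈ W) (hp : 0 ≤ (γ 0).2) :
    (∀ t ∈ Icc 0 T, γ t ∈ V) ∧
    (M ≤ T → ∃ s ∈ Icc 0 M, ∃ x, |x + a| ≤ ε ∧ (γ s = (x, 0) ∨ -γ s = (x, 0))) := by
  obtain ⟨S, u, hS, hu0, hSM, hu, huV, hupos, huS, hum⟩ := D.entry _ hW hp
  have hf := D.follow_entry hT h hu0 hu hupos
  rcases le_or_gt S T with hST | hST
  · have hγS := hf S ⟨hS, hST⟩ le_rfl
    rw [← hγS] at huS hum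
    obtain ⟨hb, hV⟩ := D.exists_base ⟨hS, hST⟩ h huS hum
    refine ⟨fun t ht => ?_, fun _ => ⟨S, ⟨hS, hSM⟩, hb⟩⟩
    rcases le_total t S with htS | htS
    · rw [hf t ht htS]
      exact huV t ⟨ht.1, htS⟩
    · exact hV t ⟨htS, ht.2⟩
  · refine ⟨fun t ht => ?_, fun hMT => by linarith⟩
    rw [hf t ht (ht.2.trans hST.le)]
    exact huV t ⟨ht.1, ht.2.trans hST.le⟩

theorem enter (D : LoopData Z σ a r δ c ε M τmin V W φ τ Q) {T : ℝ} (hT : 0 ≤ T)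
    (h : IsSolution Z (centralField Z) γ 0 T) (hW : γ 0 ∈ W) :
    (∀ t ∈ Icc 0 T, γ t ∈ V) ∧
    (M ≤ T → ∃ s ∈ Icc 0 M, ∃ x, |x + a| ≤ ε ∧ (γ s = (x, 0) ∨ -γ s = (x, 0))) := by
  rcases le_total 0 (γ 0).2 with hp | hp
  · exact D.enter_of_nonneg hT h hW hp
  · obtain ⟨h1, h2⟩ := D.enter_of_nonneg hT h.neg (D.neg_mem_W _ hW) (by simpa using hp)
    refine ⟨fun t ht => by simpa using D.neg_mem_V _ (h1 t ht), fun hMT => ?_⟩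
    obtain ⟨s, hs, x, hx, hx'⟩ := h2 hMT
    exact ⟨s, hs, x, hx, by simpa [or_comm] using hx'⟩

theorem time_bound_nonneg (D : LoopData Z σ a r δ c ε M τmin V W φ τ Q) : 0 ≤ M := by
  have h : |-r + a| ≤ ε := by
    have := D.r_mem
    rwa [show -r + a = -(r - a) by ring, abs_neg]
  exact (D.time_pos.le.trans (D.time_ge _ h)).trans (D.time_le _ h)

theorem passage_bound_pos (D : LoopData Z σ a r δ c ε M τmin V W φ τ Q) :
    0 < M + 2 * ε / c := by
  have h1 := D.time_bound_nonneg
  have h2 := div_pos (mul_pos two_pos D.eps_pos) D.c_pos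
  linarith

theorem neg_base (D : LoopData Z σ a r δ c ε M τmin V W φ τ Q) {x : ℝ} (hx : |x + a| ≤ ε) :
    x < 0 := by
  rw [abs_le] at hx
  linarith [D.eps_le, D.eps_pos]

/-- By periodicity the point at which the first half turn ends is visited again after the second
one. It thus lies on the half trace of a later iterate, which makes the second iterate of `y` a
periodic point of `h`, hence the fixed point. -/
theorem periodic_reaches (D : LoopData Z σ a r δ c ε M τmin V W φ τ Q) {T x y : ℝ}
    (hγ : IsPeriodicSolution Z γ T) (hx : |x + a| ≤ ε) (hfix : halfMap σ r Q x = x)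
    (hy : |y + a| ≤ ε) (h0 : γ 0 = (y, 0)) : ∃ s, 0 ≤ s ∧ (γ s = (x, 0) ∨ -γ s = (x, 0)) := by
  have hB := D.passage_bound_pos
  set h := halfMap σ r Q with hh
  obtain ⟨T₁, hT₁⟩ := exists_gt ((1 : ℕ) * (M + 2 * ε / c))
  obtain ⟨t₁, ht₁, -, h₁⟩ := D.hits 1 hT₁ (hγ.2.2 T₁ (by push_cast at hT₁; linarith)) h0 hy
  obtain ⟨T₂, hT₂⟩ := exists_gt ((2 : ℕ) * (M + 2 * ε / c))
  obtain ⟨t₂, ht₂, -, h₂⟩ := D.hits 2 hT₂ (hγ.2.2 T₂ (by push_cast at hT₂; linarith)) h0 hy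
  have hy1 := D.iterate_mem hy 1
  have hy2 := D.iterate_mem hy 2
  suffices hx2 : h^[2] y = x by
    rw [hx2] at h₂
    exact ⟨t₂, ht₂.1, h₂⟩
  obtain ⟨u, hu, hγu⟩ := hγ.exists_large t₂ t₁
  have hfol : ∃ n, γ t₁ ∈ halfTrace σ r φ τ (h^[n] (h^[2] y)) ∨
      -γ t₁ ∈ halfTrace σ r φ τ (h^[n] (h^[2] y)) := by
    have hmem : u - t₂ ∈ Icc 0 (u - t₂) := right_mem_Icc.2 (by linarith)
    rcases h₂ with h₂ | h₂
    · have := D.follow hmem.1 ((hγ.shift ht₂.1).2.2 _ hmem.1) (by simpa using h₂) hy2 _ hmem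
      simpa [hγu] using this
    · have := D.follow hmem.1 ((hγ.shift ht₂.1).neg.2.2 _ hmem.1) (by simpa using h₂) hy2 _ hmem
      simpa [hγu, or_comm] using this
  obtain ⟨n, hn⟩ := hfol
  rw [← Function.iterate_add_apply] at hn
  set x₁ := h^[1] y with hx₁
  have hxn := D.iterate_mem hy (n + 2)
  have hxn1 := D.iterate_mem hy (n + 3)
  have hsucc : halfMap σ r Q (h^[n + 2] y) = h^[n + 3] y :=
    (Function.iterate_succ_apply' (halfMap σ r Q) (n + 2) y).symm
  have hsucc1 : h^[2] y = halfMap σ r Q x₁ :=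
    Function.iterate_succ_apply' (halfMap σ r Q) 1 y
  have hcase : (x₁, (0 : ℝ)) ∈ halfTrace σ r φ τ (h^[n + 2] y) ∨
      (-x₁, (0 : ℝ)) ∈ halfTrace σ r φ τ (h^[n + 2] y) := by
    rcases h₁ with h₁ | h₁
    · rw [h₁] at hn
      simpa using hn
    · have h₁' : γ t₁ = (-x₁, 0) := by
        rw [← neg_neg (γ t₁), h₁]
        simp
      rw [h₁'] at hn
      simpa [or_comm] using hn
  have hneg := D.neg_base hy1
  have hnegn := D.neg_base hxn1
  -- A half trace meets Σ only in its slide and its end point. If `x₁` is on the slide from the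
  -- iterate of index `n + 2`, both have the same clamp, so their images coincide; if it is the
  -- reflected end point, then `x₁` is the iterate of index `n + 3`. The other two cases have the
  -- wrong sign.
  have hend : ∃ k, k ≠ 0 ∧ h^[2] y = h^[k + 2] y := by
    rcases hcase with hc | hc
    · rcases (D.halfTrace_of_snd_eq_zero hxn).1 hc with hc | hc
      · refine ⟨n + 1, by omega, ?_⟩
        rw [hsucc1, show n + 1 + 2 = n + 3 by ring, ← hsucc]
        simp only [halfMap]
        rw [foldClamp_eq_of_mem_uIcc D.sign hc]
      · rw [hsucc] at hc
        linarith
    · rcases (D.halfTrace_of_snd_eq_zero hxn).1 hc with hc | hc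
      · have := D.neg_base (D.uIcc_mem hxn hc)
        linarith
      · rw [hsucc, neg_inj] at hc
        refine ⟨n + 2, by omega, ?_⟩
        rw [hsucc1, hc, hh, ← Function.iterate_succ_apply' (halfMap σ r Q) (n + 3) y]
  obtain ⟨k, hk, hk'⟩ := hend
  refine D.eq_of_iterate_eq hx hfix hy2 hk ?_
  rw [← hh, ← Function.iterate_add_apply, ← hk']

theorem range_eq_loopTrace (D : LoopData Z σ a r δ c ε M τmin V W φ τ Q) {T x : ℝ}
    (hγ : IsPeriodicSolution Z γ T) (hx : |x + a| ≤ ε) (hfix : halfMap σ r Q x = x)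
    (h0 : γ 0 = (x, 0)) : range γ = loopTrace σ r φ τ x := by
  have hB := D.passage_bound_pos
  have hB1 : 0 < M + 2 * ε / c + 1 := by linarith
  have hpass : ∀ {β : ℝ → ℝ × ℝ}, IsPeriodicSolution Z β T → β 0 = (x, 0) →
      halfTrace σ r φ τ x ⊆ range β ∧ ∃ s, 0 ≤ s ∧ β s = (-x, 0) := by
    intro β hβ hβ0
    rcases D.passage hB1.le (hβ.2.2 _ hB1.le) hβ0 hx with ⟨hle, -⟩ | ⟨t₁, ht₁, -, hend, himg⟩
    · linarith
    · exact ⟨himg ▸ image_subset_range _ _, t₁, D.time_pos.le.trans ht₁.1, by rw [hend, hfix]⟩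
  obtain ⟨hsub, s, hs, hγs⟩ := hpass hγ h0
  obtain ⟨hsub', -⟩ := hpass (hγ.shift hs).neg (by simp [hγs])
  apply Subset.antisymm
  · rintro _ ⟨t, rfl⟩
    obtain ⟨u, hu, hγu⟩ := hγ.exists_large 0 t
    obtain ⟨n, hn⟩ := D.follow hu (hγ.2.2 u hu) h0 hx u (right_mem_Icc.2 hu)
    rwa [Function.iterate_fixed hfix, hγu] at hn
  · rintro p (hp | hp)
    · exact hsub hp
    · obtain ⟨t, ht⟩ := hsub' hp
      exact ⟨s + t, by simpa using ht⟩

theorem neg_mem_loopTrace {x : ℝ} {p : ℝ × ℝ} (h : p ∈ loopTrace σ r φ τ x) :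
    -p ∈ loopTrace σ r φ τ x := by
  rcases h with h | h
  · exact Or.inr (by simpa using h)
  · exact Or.inl h

/-- The orbit enters a base segment, then passes through the fixed point, and from there its range
is determined. At each of these arrivals it may be the reflected solution that arrives, which does
not matter since the loop is symmetric. -/
theorem periodic_unique (D : LoopData Z σ a r δ c ε M τmin V W φ τ Q) {x : ℝ}
    (hx : |x + a| ≤ ε) (hfix : halfMap σ r Q x = x) {Γ : Set (ℝ × ℝ)}
    (hΓ : IsPeriodicOrbit Z (centralField Z) Γ) (hW : Γ ⊆ W) : Γ = loopTrace σ r φ τ x := by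
  obtain ⟨γ, T, hT, hper, hsol, -, rfl⟩ := hΓ
  have hγ := IsPeriodicSolution.of_isSolution hT hper hsol
  have hM := D.time_bound_nonneg
  have key : ∀ {β : ℝ → ℝ × ℝ}, IsPeriodicSolution Z β T → ∀ {s y : ℝ}, 0 ≤ s →
      (β s = (y, 0) ∨ -β s = (y, 0)) → ∃ β', IsPeriodicSolution Z β' T ∧ β' 0 = (y, 0) ∧
        (range β' = range β ∨ range β' = range fun t => -β t) := by
    intro β hβ s y hs hy
    rcases hy with hy | hy
    · exact ⟨_, hβ.shift hs, by simpa using hy, Or.inl (IsPeriodicSolution.range_shift s)⟩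
    · exact ⟨_, (hβ.shift hs).neg, by simpa using hy,
        Or.inr (IsPeriodicSolution.range_shift (γ := fun t => -β t) s)⟩
  have hnegr : ∀ {β : ℝ → ℝ × ℝ}, range (fun t => -β t) = loopTrace σ r φ τ x →
      range β = loopTrace σ r φ τ x := by
    intro β h
    ext p
    constructor
    · rintro ⟨t, rfl⟩
      simpa using neg_mem_loopTrace (h ▸ mem_range_self t : -β t ∈ loopTrace σ r φ τ x)
    · intro hp
      have : -p ∈ range fun t => -β t := h ▸ neg_mem_loopTrace hp
      obtain ⟨t, ht⟩ := this
      exact ⟨t, neg_injective ht⟩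
  obtain ⟨s, hs, y, hy, hys⟩ := (D.enter hM (hγ.2.2 M hM) (hW (mem_range_self 0))).2 le_rfl
  obtain ⟨β, hβ, hβ0, hβr⟩ := key hγ hs.1 hys
  obtain ⟨s', hs', hs'x⟩ := D.periodic_reaches hβ hx hfix hy hβ0
  obtain ⟨β', hβ', hβ'0, hβ'r⟩ := key hβ hs' hs'x
  have hfin := D.range_eq_loopTrace hβ' hx hfix hβ'0
  have hβfin : range β = loopTrace σ r φ τ x := by
    rcases hβ'r with h | h
    · rw [← h, hfin]
    · exact hnegr (by rw [← h, hfin])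
  rcases hβr with h | h
  · rw [← h, hβfin]
  · exact hnegr (by rw [← h, hβfin])

/-! ### Existence of the periodic orbit. -/

theorem lift_isSolution (D : LoopData Z σ a r δ c ε M τmin V W φ τ Q) {x : ℝ} (hx : |x + a| ≤ ε)
    (hσ : 0 ≤ σ * (x + r)) : IsSolution Z (centralField Z) (φ x) 0 (τ x) :=
  isSolution_of_pos (D.time_pos.le.trans (D.time_ge x hx)) D.contDiff.continuous
    (D.lift_deriv x hx) (D.lift_pos x hx hσ)

theorem exists_concat {Zp Zm : ℝ × ℝ → ℝ × ℝ} {β γ : ℝ → ℝ × ℝ} {S T : ℝ} (hS : 0 ≤ S)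
    (hT : 0 ≤ T) (hβ : IsSolution Zp Zm β 0 S) (hγ : IsSolution Zp Zm γ 0 T) (h : β S = γ 0) :
    ∃ ζ : ℝ → ℝ × ℝ, IsSolution Zp Zm ζ 0 (S + T) ∧ EqOn ζ β (Icc 0 S) ∧
      ∀ t ∈ Icc 0 T, ζ (S + t) = γ t := by
  refine ⟨fun t => if t ≤ S then β t else γ (-S + t), ?_, fun t ht => if_pos ht.2, fun t ht => ?_⟩
  · refine IsSolution.trans hS (by linarith) (hβ.congr hS fun t ht => (if_pos ht.2).symm) ?_
    have : IsSolution Zp Zm (fun t => γ (-S + t)) S (S + T) := by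
      refine IsSolution.comp_add_left ?_
      simpa using hγ
    refine this.congr (by linarith) fun t ht => ?_
    rcases ht.1.eq_or_lt with rfl | hlt
    · simp [h]
    · simp [hlt.not_ge]
  · rcases ht.1.eq_or_lt with rfl | hlt
    · simp [h]
    · simp [hlt.not_ge]

theorem exists_halfSolution (D : LoopData Z σ a r δ c ε M τmin V W φ τ Q) {x : ℝ}
    (hx : |x + a| ≤ ε) : ∃ S > 0, ∃ β : ℝ → ℝ × ℝ, β 0 = (x, 0) ∧
      β S = (-halfMap σ r Q x, 0) ∧ IsSolution Z (centralField Z) β 0 S ∧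
      β '' Icc 0 S = halfTrace σ r φ τ x := by
  have hk := D.clamp_mem hx
  have hτ : 0 < τ (foldClamp σ r x) := D.time_pos.trans_le (D.time_ge _ hk)
  have hlift := D.lift_isSolution hk (foldClamp_nonneg σ r x)
  have hslide : ∃ S, 0 ≤ S ∧ ∃ β : ℝ → ℝ × ℝ, β 0 = (x, 0) ∧ β S = (foldClamp σ r x, 0) ∧
      IsSolution Z (centralField Z) β 0 S ∧
      β '' Icc 0 S = (fun u : ℝ => (u, (0 : ℝ))) '' uIcc x (foldClamp σ r x) := by
    rcases le_or_gt 0 (σ * (x + r)) with hσ | hσ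
    · rw [foldClamp_of_nonneg hσ]
      exact ⟨0, le_rfl, fun _ => (x, 0), rfl, rfl, isSolution_refl, by simp⟩
    · rw [foldClamp_of_neg hσ]
      obtain ⟨S, hS, β, h⟩ := D.exists_slide (hx.trans D.eps_lt.le) (D.r_mem.trans D.eps_lt.le) hσ
      exact ⟨S, hS.le, β, h⟩
  obtain ⟨S, hS, β, hβ0, hβS, hβ, hβi⟩ := hslide
  obtain ⟨ζ, hζ, hζ1, hζ2⟩ := exists_concat hS hτ.le hβ hlift (by rw [hβS, D.lift_zero _ hk])
  refine ⟨S + τ (foldClamp σ r x), by linarith, ζ, ?_, ?_, hζ, ?_⟩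
  · rw [hζ1 (left_mem_Icc.2 hS), hβ0]
  · rw [hζ2 _ (right_mem_Icc.2 hτ.le), D.lift_end _ hk]
    rfl
  · rw [← Icc_union_Icc_eq_Icc hS (by linarith : S ≤ S + τ (foldClamp σ r x)), image_union,
      hζ1.image_eq, hβi, halfTrace]
    congr 1
    ext p
    constructor
    · rintro ⟨t, ht, rfl⟩
      refine ⟨t - S, ⟨by linarith [ht.1], by linarith [ht.2]⟩, ?_⟩
      rw [← hζ2 (t - S) ⟨by linarith [ht.1], by linarith [ht.2]⟩, add_sub_cancel]
    · rintro ⟨t, ht, rfl⟩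
      exact ⟨S + t, ⟨by linarith [ht.1], by linarith [ht.2]⟩, hζ2 t ht⟩

/-- A half solution from a fixed point ends at the reflection of its starting point, so it closes up
with its own reflection; reduction of time modulo the period extends it to the line. -/
theorem isPeriodicOrbit (D : LoopData Z σ a r δ c ε M τmin V W φ τ Q) {x : ℝ}
    (hx : |x + a| ≤ ε) (hfix : halfMap σ r Q x = x) :
    IsPeriodicOrbit Z (centralField Z) (loopTrace σ r φ τ x) := by
  obtain ⟨S, hS, β, hβ0, hβS, hβ, hβi⟩ := D.exists_halfSolution hx
  rw [hfix] at hβS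
  obtain ⟨ζ, hζ, hζ1, hζ2⟩ := exists_concat hS.le hS.le hβ hβ.neg (by simp [hβ0, hβS])
  have hP : 0 < S + S := by linarith
  have hζ0 : ζ 0 = (x, 0) := by rw [hζ1 (left_mem_Icc.2 hS.le), hβ0]
  have hζS : ζ S = (-x, 0) := by rw [hζ1 (right_mem_Icc.2 hS.le), hβS]
  have hζP : ζ (S + S) = (x, 0) := by simp [hζ2 S (right_mem_Icc.2 hS.le), hβS]
  have hper : Function.Periodic (fun t => ζ (toIcoMod hP 0 t)) (S + S) := fun t => by
    simp only [toIcoMod_add_right]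
  have heq : EqOn ζ (fun t => ζ (toIcoMod hP 0 t)) (Icc 0 (S + S)) := by
    intro t ht
    rcases ht.2.eq_or_lt with rfl | hlt
    · have : toIcoMod hP 0 (S + S) = 0 := by
        have := toIcoMod_add_right hP 0 0
        rwa [zero_add, toIcoMod_apply_left] at this
      simp only [this, hζ0, hζP]
    · have : toIcoMod hP 0 t = t := by
        rw [toIcoMod_eq_self]
        simpa using ⟨ht.1, hlt⟩
      simp only [this]
  have hsol := hζ.congr hP.le heq
  have e0 : ζ (toIcoMod hP 0 0) = (x, 0) := (heq (left_mem_Icc.2 hP.le)).symm.trans hζ0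
  have eS : ζ (toIcoMod hP 0 S) = (-x, 0) := (heq ⟨hS.le, by linarith⟩).symm.trans hζS
  refine ⟨_, _, hP, hper, hsol, ⟨S, ?_⟩, ?_⟩
  · intro h
    rw [e0, eS, Prod.mk.injEq] at h
    linarith [D.neg_base hx, h.1]
  · exact (D.range_eq_loopTrace (IsPeriodicSolution.of_isSolution hP hper hsol) hx hfix
      e0).symm

end LoopData

namespace LoopData

variable {Z : ℝ × ℝ → ℝ × ℝ} {σ a r δ c ε M τmin : ℝ} {V W A : Set (ℝ × ℝ)}
  {φ : ℝ → ℝ → ℝ × ℝ} {τ Q : ℝ → ℝ} {γ : ℝ → ℝ × ℝ} {x s : ℝ}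

theorem fold_mem (D : LoopData Z σ a r δ c ε M τmin V W φ τ Q) : |-r + a| ≤ ε := by
  have := D.r_mem
  rwa [show -r + a = -(r - a) by ring, abs_neg]

/-! ### Position of the fixed point -/

/-- If `x` were not a crossing point, its clamp would be the fold, so `x = Q (-r)`, which by
assumption is a crossing point. -/
theorem crossing_of_displacement (hfix : halfMap σ r Q x = x) (hd : 0 < σ * (Q (-r) + r)) :
    0 < σ * (x + r) := by
  by_contra! hle
  have hk : foldClamp σ r x = -r := by
    rcases hle.eq_or_lt with h | h
    · rw [foldClamp_of_nonneg h.ge]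
      have hσ0 : σ ≠ 0 := by
        rintro rfl
        simp at hd
      rcases mul_eq_zero.1 h with h' | h'
      · exact absurd h' hσ0
      · linarith
    · exact foldClamp_of_neg h
  rw [halfMap, hk] at hfix
  rw [hfix] at hd
  linarith

theorem eq_of_fixed (D : LoopData Z σ a r δ c ε M τmin V W φ τ Q) {y : ℝ} (hx : |x + a| ≤ ε)
    (hfix : halfMap σ r Q x = x) (hy : |y + a| ≤ ε) (hfix' : halfMap σ r Q y = y) : x = y :=
  (D.eq_of_iterate_eq hx hfix hy one_ne_zero hfix').symm

theorem critical_of_displacement (D : LoopData Z σ a r δ c ε M τmin V W φ τ Q)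
    (hx : |x + a| ≤ ε) (hfix : halfMap σ r Q x = x) (hd : Q (-r) = -r) : x = -r := by
  refine D.eq_of_fixed hx hfix D.fold_mem ?_
  rw [halfMap, foldClamp_of_nonneg (by simp), hd]

/-- Here `Q (-r)` is on the sliding side, so its clamp is the fold again and it is itself the fixed
point. -/
theorem sliding_of_displacement (D : LoopData Z σ a r δ c ε M τmin V W φ τ Q)
    (hx : |x + a| ≤ ε) (hfix : halfMap σ r Q x = x) (hd : σ * (Q (-r) + r) < 0) :
    σ * (x + r) < 0 := by
  have h : x = Q (-r) := by
    refine D.eq_of_fixed hx hfix (D.map_mem _ D.fold_mem).le ?_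
    rw [halfMap, foldClamp_of_neg hd]
  rwa [h]

/-! ### The periodic orbit -/

theorem loopTrace_inter (D : LoopData Z σ a r δ c ε M τmin V W φ τ Q) (hx : |x + a| ≤ ε)
    (hfix : halfMap σ r Q x = x) (p : ℝ × ℝ) : p ∈ loopTrace σ r φ τ x ∩ switchingLine ↔
      p.2 = 0 ∧ (p.1 ∈ uIcc x (foldClamp σ r x) ∨ -p.1 ∈ uIcc x (foldClamp σ r x)) := by
  obtain ⟨u, y⟩ := p
  simp only [mem_inter_iff, switchingLine, mem_ofPred_eq, loopTrace]
  rw [and_comm]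
  refine and_congr_right fun hy => ?_
  subst hy
  rw [Prod.neg_mk, neg_zero, D.halfTrace_of_snd_eq_zero hx, D.halfTrace_of_snd_eq_zero hx, hfix]
  constructor
  · rintro ((h | h) | (h | h))
    · exact Or.inl h
    · exact Or.inr (by rw [h, neg_neg]; exact left_mem_uIcc)
    · exact Or.inr h
    · exact Or.inl (by rw [neg_inj.1 h]; exact left_mem_uIcc)
  · rintro (h | h)
    · exact Or.inl (Or.inl h)
    · exact Or.inr (Or.inl h)

theorem loopTrace_subset (D : LoopData Z σ a r δ c ε M τmin V W φ τ Q) (hx : |x + a| ≤ ε) :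
    loopTrace σ r φ τ x ⊆ V := by
  rintro p (hp | hp)
  · exact D.halfTrace_subset hx hp
  · simpa using D.neg_mem_V _ (D.halfTrace_subset hx hp)

theorem isIsolatedOrbit (D : LoopData Z σ a r δ c ε M τmin V W φ τ Q) (hx : |x + a| ≤ ε)
    (hfix : halfMap σ r Q x = x) (hW : W ∈ 𝓝ˢ (loopTrace σ r φ τ x)) :
    IsIsolatedOrbit Z (centralField Z) (loopTrace σ r φ τ x) :=
  ⟨W, hW, fun _ h h' => D.periodic_unique hx hfix h h'⟩

theorem isOnlyPeriodicOrbitIn (D : LoopData Z σ a r δ c ε M τmin V W φ τ Q) (hx : |x + a| ≤ ε)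
    (hfix : halfMap σ r Q x = x) (hA : loopTrace σ r φ τ x ⊆ A) (hAW : A ⊆ W) :
    IsOnlyPeriodicOrbitIn Z (centralField Z) A (loopTrace σ r φ τ x) :=
  ⟨hA, fun _ h h' => D.periodic_unique hx hfix h (h'.trans hAW)⟩

theorem occupiesBothSides (D : LoopData Z σ a r δ c ε M τmin V W φ τ Q) (hx : |x + a| ≤ ε) :
    OccupiesBothSides (loopTrace σ r φ τ x) := by
  have hk := D.clamp_mem hx
  have hτ : 0 < τ (foldClamp σ r x) := D.time_pos.trans_le (D.time_ge _ hk)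
  have hpos := D.lift_pos _ hk (foldClamp_nonneg σ r x) (τ (foldClamp σ r x) / 2)
    ⟨by linarith, by linarith⟩
  have hmem : φ (foldClamp σ r x) (τ (foldClamp σ r x) / 2) ∈ halfTrace σ r φ τ x :=
    Or.inr ⟨_, ⟨by linarith, by linarith⟩, rfl⟩
  exact ⟨⟨_, Or.inl hmem, hpos⟩, ⟨_, Or.inr (by rwa [neg_neg]), by simpa using hpos⟩⟩

theorem lower_pos' (D : LoopData Z σ a r δ c ε M τmin V W φ τ Q) {u : ℝ} (hu : |u + a| ≤ ε) :
    0 < (centralField Z (u, 0)).2 :=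
  D.lower_pos _ (mk_zero_mem_cornerBox (hu.trans D.eps_lt.le))

theorem isTangentPoint_fold (D : LoopData Z σ a r δ c ε M τmin V W φ τ Q) :
    IsTangentPoint Z (-r, 0) := by
  refine ⟨rfl, fun h => ?_, D.fold⟩
  have := D.drift _ (mk_zero_mem_cornerBox (D.fold_mem.trans D.eps_lt.le))
  rw [h] at this
  simp only [Prod.fst_zero, mul_zero] at this
  linarith [D.c_pos]

theorem hit_set_of_crossing (D : LoopData Z σ a r δ c ε M τmin V W φ τ Q) (hx : |x + a| ≤ ε)
    (hfix : halfMap σ r Q x = x) (hσ : 0 ≤ σ * (x + r)) :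
    loopTrace σ r φ τ x ∩ switchingLine = {(x, 0), (-x, 0)} := by
  ext p
  rw [D.loopTrace_inter hx hfix, foldClamp_of_nonneg hσ, uIcc_self]
  obtain ⟨u, y⟩ := p
  simp only [mem_singleton_iff, mem_insert_iff, Prod.mk.injEq, neg_eq_iff_eq_neg]
  tauto

theorem isReturnMapAt (D : LoopData Z σ a r δ c ε M τmin V W φ τ Q) (hx : |x + a| ≤ ε)
    (hfix : halfMap σ r Q x = x) (hσ : 0 < σ * (x + r)) :
    IsReturnMapAt Z (centralField Z) x (Q ∘ Q) := by
  have hQx : Q x = x := by rwa [halfMap, foldClamp_of_nonneg hσ.le] at hfix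
  have hxs : |x + a| < ε := by
    have := D.map_mem x hx
    rwa [hQx] at this
  obtain ⟨μ, hμ, -⟩ := D.map_diff x hx
  have hev : ∀ᶠ y in 𝓝 x, |y + a| < ε ∧ 0 < σ * (y + r) := by
    have c1 : Continuous fun y : ℝ => |y + a| := by fun_prop
    have c2 : Continuous fun y : ℝ => σ * (y + r) := by fun_prop
    exact (c1.continuousAt.eventually (gt_mem_nhds hxs)).and
      (c2.continuousAt.eventually (lt_mem_nhds hσ))
  have hevQ : ∀ᶠ y in 𝓝 x, 0 < σ * (Q y + r) := by
    have h1 := hμ.continuousAt.tendsto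
    rw [hQx] at h1
    filter_upwards [h1.eventually hev] with y hy using hy.2
  have ha : 0 < a := by linarith [D.eps_le, D.eps_pos]
  -- Half-width `a` keeps the intermediate hit near `(a, 0)` out of the section, since `2 * ε ≤ a`,
  -- and still contains the return point.
  refine ⟨a, ha, ?_⟩
  filter_upwards [hev, hevQ] with y hy hyQ
  have hQy := (D.map_mem y hy.1.le).le
  have hτ1 : 0 < τ y := D.time_pos.trans_le (D.time_ge y hy.1.le)
  have hτ2 : 0 < τ (Q y) := D.time_pos.trans_le (D.time_ge _ hQy)
  refine ⟨τ y + τ (Q y), by linarith, ?_, fun γ hγ0 hγ => ?_⟩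
  · obtain ⟨ζ, hζ, hζ1, -⟩ := exists_concat hτ1.le hτ2.le (D.lift_isSolution hy.1.le hy.2.le)
      (D.lift_isSolution hQy hyQ.le).neg (by simp [D.lift_end _ hy.1.le, D.lift_zero _ hQy])
    exact ⟨ζ, by rw [hζ1 (left_mem_Icc.2 hτ1.le), D.lift_zero _ hy.1.le], hζ⟩
  · have h1 := D.lift (by linarith) (hy.1.trans D.eps_lt) hy.2.le hγ hγ0 (D.lift_zero _ hy.1.le)
      (D.lift_deriv _ hy.1.le) (D.lift_pos _ hy.1.le hy.2.le)
    have hγτ : γ (τ y) = (-Q y, 0) := by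
      rw [h1 _ ⟨hτ1.le, by linarith⟩ le_rfl, D.lift_end _ hy.1.le]
    have h2 := D.lift (by linarith) (hQy.trans_lt D.eps_lt) hyQ.le
      (hγ.neg_comp_add hτ1.le (by linarith)) (by simp [hγτ]) (D.lift_zero _ hQy)
      (D.lift_deriv _ hQy) (D.lift_pos _ hQy hyQ.le)
    rw [add_sub_cancel_left] at h2
    have hend : γ (τ y + τ (Q y)) = (Q (Q y), 0) := by
      have := h2 _ (right_mem_Icc.2 hτ2.le) le_rfl
      rw [D.lift_end _ hQy, neg_eq_iff_eq_neg] at this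
      simpa using this
    refine ⟨hend, ?_, fun t ht => ?_⟩
    · have h3 := (D.map_mem _ hQy).le
      rw [Function.comp_apply, abs_lt]
      rw [abs_le] at hx h3
      constructor <;> linarith [D.eps_le, D.eps_pos, abs_lt.1 hxs, (abs_lt.1 (D.map_mem _ hQy)).1,
        (abs_lt.1 (D.map_mem _ hQy)).2, (abs_lt.1 hxs).1, (abs_lt.1 hxs).2]
    · rintro ⟨ht0, htx⟩
      rcases lt_trichotomy t (τ y) with hlt | rfl | hgt
      · have := D.lift_pos _ hy.1.le hy.2.le t ⟨ht.1, hlt⟩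
        rw [← h1 t ⟨ht.1.le, ht.2.le⟩ hlt.le] at this
        linarith
      · rw [hγτ, abs_lt] at htx
        have h3 := abs_le.1 hQy
        have h4 := abs_le.1 hx
        linarith [D.eps_le, htx.2]
      · have h3 := h2 (t - τ y) ⟨by linarith, by linarith [ht.2]⟩ (by linarith [ht.2])
        have h4 := D.lift_pos _ hQy hyQ.le (t - τ y) ⟨by linarith, by linarith [ht.2]⟩
        rw [← h3] at h4
        simp only [add_sub_cancel, Prod.snd_neg] at h4
        linarith

theorem isHyperbolicallyStable (D : LoopData Z σ a r δ c ε M τmin V W φ τ Q) (hx : |x + a| ≤ ε)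
    (hfix : halfMap σ r Q x = x) (hσ : 0 < σ * (x + r)) :
    IsHyperbolicallyStable Z (centralField Z) (loopTrace σ r φ τ x) := by
  have hQx : Q x = x := by rwa [halfMap, foldClamp_of_nonneg hσ.le] at hfix
  obtain ⟨μ, hμ, hμ1⟩ := D.map_diff x hx
  refine ⟨x, Q ∘ Q, μ * μ, ⟨?_, rfl, ?_⟩, D.isReturnMapAt hx hfix hσ, by simp [hQx], ?_, ?_⟩
  · exact Or.inl (Or.inl ⟨x, left_mem_uIcc, rfl⟩)
  · exact mul_pos (D.crossing x (hx.trans D.eps_lt.le) hσ) (D.lower_pos' hx)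
  · have : HasDerivAt Q μ (Q x) := by rwa [hQx]
    exact this.comp x hμ
  · rw [abs_mul]
    nlinarith [abs_nonneg μ]

theorem pos_mul_iff {k σ y : ℝ} (hk : 0 < k) : 0 < k * σ * y ↔ 0 < σ * y := by
  rw [mul_assoc]
  exact mul_pos_iff_of_pos_left hk

theorem crossingPhase (D : LoopData Z σ a r δ c ε M τmin V W φ τ Q) (hx : |x + a| ≤ ε)
    (hfix : halfMap σ r Q x = x) (hs : ∃ k > 0, s = k * σ)
    (hA : loopTrace σ r φ τ x ⊆ interior A) (hAW : A ⊆ W) (hd : 0 < σ * (Q (-r) + r)) :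
    CrossingPhase Z (centralField Z) A s r := by
  obtain ⟨k, hk, rfl⟩ := hs
  have hσ := crossing_of_displacement hfix hd
  have hW : W ∈ 𝓝ˢ (loopTrace σ r φ τ x) :=
    mem_of_superset (isOpen_interior.mem_nhdsSet.2 hA) (interior_subset.trans hAW)
  have hneg := D.neg_base hx
  have hset := D.hit_set_of_crossing hx hfix hσ.le
  refine ⟨loopTrace σ r φ τ x, ⟨D.isPeriodicOrbit hx hfix, D.isIsolatedOrbit hx hfix hW,
    D.occupiesBothSides hx, ?_⟩, D.isHyperbolicallyStable hx hfix hσ,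
    ⟨-x, by linarith, ?_, ?_⟩,
    D.isOnlyPeriodicOrbitIn hx hfix (hA.trans interior_subset) hAW⟩
  · rw [hset]
    have h1 := D.crossing x (hx.trans D.eps_lt.le) hσ
    have h2 := D.lower_pos' hx
    rintro p (rfl | rfl)
    · exact ⟨rfl, mul_pos h1 h2⟩
    · refine ⟨rfl, ?_⟩
      simp only [centralField, Prod.neg_mk, neg_neg, neg_zero, Prod.snd_neg] at h2 ⊢
      nlinarith
  · rw [pos_mul_iff hk, sub_neg_eq_add, add_comm]
    exact hσ
  · rw [hset, neg_neg]

theorem criticalPhase (D : LoopData Z σ a r δ c ε M τmin V W φ τ Q) (hx : |x + a| ≤ ε)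
    (hfix : halfMap σ r Q x = x)
    (hA : loopTrace σ r φ τ x ⊆ interior A) (hAW : A ⊆ W) (hd : Q (-r) = -r)
    (hstab : ∀ E, IsStableFrom Z (centralField Z) E (loopTrace σ r φ τ x)) :
    CriticalPhase Z (centralField Z) A s r := by
  have hxr := D.critical_of_displacement hx hfix hd
  have hW : W ∈ 𝓝ˢ (loopTrace σ r φ τ x) :=
    mem_of_superset (isOpen_interior.mem_nhdsSet.2 hA) (interior_subset.trans hAW)
  have hset := D.hit_set_of_crossing hx hfix (by simp [hxr])
  refine ⟨loopTrace σ r φ τ x, ⟨D.isPeriodicOrbit hx hfix, D.isIsolatedOrbit hx hfix hW,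
    ⟨(-r, 0), ?_, Or.inl D.isTangentPoint_fold⟩,
    D.occupiesBothSides hx, ?_⟩, fun _ => hstab _, fun _ => hstab _, ?_,
    D.isOnlyPeriodicOrbitIn hx hfix (hA.trans interior_subset) hAW⟩
  · rw [← hxr]
    exact Or.inl (Or.inl ⟨x, left_mem_uIcc, rfl⟩)
  · rw [hset]
    have h := D.fold
    rintro p (rfl | rfl)
    · rw [hxr]
      exact Or.inr ⟨rfl, by rw [h, zero_mul]⟩
    · rw [hxr]
      refine Or.inr ⟨rfl, ?_⟩
      simp only [centralField, Prod.neg_mk, neg_neg, neg_zero, Prod.snd_neg, h, mul_zero]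
  · rw [hset, hxr, neg_neg]

theorem slidingInterior_symm {p : ℝ × ℝ} (h : p ∈ slidingInterior Z (centralField Z)) :
    -p ∈ slidingInterior Z (centralField Z) := by
  refine ⟨by simpa using h.1, ?_⟩
  have h1 := (continuous_neg (G := ℝ)).continuousAt (x := -p.1)
  have h2 : Tendsto Neg.neg (𝓝 (-p).1) (𝓝 p.1) := by
    have := h1.tendsto
    rwa [neg_neg] at this
  filter_upwards [h2.eventually h.2] with y hy
  refine ⟨rfl, ?_⟩
  have := hy.2
  simp only [centralField, Prod.neg_mk, neg_neg, neg_zero, Prod.snd_neg] at this ⊢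
  linarith

/-- The only point of the closed slide at which the upper normal component is not negative is the
fold. It is not interior to the sliding set, because crossing points accumulate at it. -/
theorem stable_of_slidingInterior (D : LoopData Z σ a r δ c ε M τmin V W φ τ Q)
    (hx : |x + a| ≤ ε) (hσ : σ * (x + r) < 0) {p : ℝ × ℝ} (hp0 : p.2 = 0)
    (hp : p.1 ∈ uIcc x (-r)) (hint : p ∈ slidingInterior Z (centralField Z)) :
    (Z p).2 < 0 ∧ 0 < (centralField Z p).2 := by
  obtain ⟨u, y⟩ := p
  simp only at hp0 hp
  subst hp0
  have hu : |u + a| ≤ ε := D.uIcc_mem hx (by rwa [foldClamp_of_neg hσ])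
  refine ⟨D.attracting u (hu.trans D.eps_lt.le) ?_, D.lower_pos' hu⟩
  have hle : σ * (u + r) ≤ 0 := by
    rw [mem_uIcc] at hp
    rcases eq_or_eq_neg_of_abs_eq D.sign with h | h <;> subst h <;> rcases hp with hp | hp <;>
      linarith [hp.1, hp.2]
  refine lt_of_le_of_ne hle fun h0 => ?_
  have hσ0 : σ ≠ 0 := by
    rintro rfl
    simpa using D.sign
  have hur : u = -r := by
    rcases mul_eq_zero.1 h0 with h' | h'
    · exact absurd h' hσ0
    · linarith
  have hev := hint.2
  simp only [hur] at hev
  have hbox : ∀ᶠ z in 𝓝 (-r), |z + a| < δ := by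
    have c1 : Continuous fun z : ℝ => |z + a| := by fun_prop
    exact c1.continuousAt.eventually (gt_mem_nhds (D.fold_mem.trans_lt D.eps_lt))
  obtain ⟨e, he, hball⟩ := Metric.eventually_nhds_iff.1 (hev.and hbox)
  have hσσ : σ * σ = 1 := by
    rcases eq_or_eq_neg_of_abs_eq D.sign with h | h <;> rw [h] <;> norm_num
  have hb := hball (y := -r + σ * (e / 2)) (by
    rw [Real.dist_eq, add_sub_cancel_left, abs_mul, D.sign, one_mul, abs_of_pos (by linarith)]
    linarith)
  have h1 := D.crossing _ hb.2.le (by nlinarith)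
  have h2 := D.lower_pos _ (mk_zero_mem_cornerBox hb.2.le)
  exact absurd hb.1.2 (not_le.2 (mul_pos h1 h2))

theorem slidingPhase (D : LoopData Z σ a r δ c ε M τmin V W φ τ Q) (hx : |x + a| ≤ ε)
    (hfix : halfMap σ r Q x = x) (hs : ∃ k > 0, s = k * σ)
    (hA : loopTrace σ r φ τ x ⊆ interior A) (hAW : A ⊆ W) (hd : σ * (Q (-r) + r) < 0) :
    SlidingPhase Z (centralField Z) A s r := by
  obtain ⟨k, hk, rfl⟩ := hs
  have hσ := D.sliding_of_displacement hx hfix hd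
  have hW : W ∈ 𝓝ˢ (loopTrace σ r φ τ x) :=
    mem_of_superset (isOpen_interior.mem_nhdsSet.2 hA) (interior_subset.trans hAW)
  have hneg := D.neg_base hx
  have hr0 := D.neg_base D.fold_mem
  have hclamp := foldClamp_of_neg hσ
  have hinter := D.loopTrace_inter hx hfix
  rw [hclamp] at hinter
  have hne : x ≠ -r := by
    rintro rfl
    simp at hσ
  refine ⟨loopTrace σ r φ τ x, ⟨D.isPeriodicOrbit hx hfix, D.isIsolatedOrbit hx hfix hW,
    ⟨(-r, 0), ((hinter (-r, 0)).2 ⟨rfl, Or.inl right_mem_uIcc⟩).1, Or.inl D.isTangentPoint_fold⟩,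
    min x (-r), max x (-r), min_lt_max.2 hne, fun u hu => ?_⟩, ?_, ⟨-x, by linarith, ?_, ?_⟩,
    D.isOnlyPeriodicOrbitIn hx hfix (hA.trans interior_subset) hAW⟩
  · have hu' : u ∈ uIcc x (-r) := hu
    have hub : |u + a| ≤ ε := D.uIcc_mem hx (by rwa [hclamp])
    refine ⟨((hinter (u, 0)).2 ⟨rfl, Or.inl hu'⟩).1, rfl, ?_⟩
    refine mul_nonpos_of_nonpos_of_nonneg (D.upper_nonpos (hub.trans D.eps_lt.le) ?_)
      (D.lower_pos' hub).le
    rw [mem_uIcc] at hu'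
    rcases eq_or_eq_neg_of_abs_eq D.sign with h | h <;> subst h <;> rcases hu' with hp | hp <;>
      linarith [hp.1, hp.2]
  · rintro p ⟨hp, hint⟩
    obtain ⟨hp0, hmem⟩ := (hinter p).1 ⟨hp, hint.1⟩
    rcases hmem with hmem | hmem
    · exact D.stable_of_slidingInterior hx hσ hp0 hmem hint
    · have := D.stable_of_slidingInterior hx hσ (p := -p) (by simpa using hp0) hmem
        (slidingInterior_symm hint)
      simp only [centralField, neg_neg, Prod.snd_neg] at this ⊢
      constructor <;> linarith [this.1, this.2]
  · rw [pos_mul_iff hk]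
    linarith
  · ext p
    rw [hinter p]
    simp only [mem_ofPred_eq]
    refine and_congr_right fun _ => ?_
    simp only [mem_uIcc]
    rcases abs_cases p.1 with ⟨h1, h2⟩ | ⟨h1, h2⟩ <;> rw [h1]
    · constructor
      · rintro ((h | h) | (h | h))
        · linarith [h.1, h.2]
        · linarith [h.1, h.2]
        · exact Or.inl ⟨by linarith [h.1, h.2], by linarith [h.1, h.2]⟩
        · exact Or.inr ⟨by linarith [h.1, h.2], by linarith [h.1, h.2]⟩
      · rintro (h | h)
        · exact Or.inr (Or.inl ⟨by linarith [h.1, h.2], by linarith [h.1, h.2]⟩)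
        · exact Or.inr (Or.inr ⟨by linarith [h.1, h.2], by linarith [h.1, h.2]⟩)
    · constructor
      · rintro ((h | h) | (h | h))
        · exact Or.inl ⟨by linarith [h.1, h.2], by linarith [h.1, h.2]⟩
        · exact Or.inr ⟨by linarith [h.1, h.2], by linarith [h.1, h.2]⟩
        · linarith [h.1, h.2]
        · linarith [h.1, h.2]
      · rintro (h | h)
        · exact Or.inl (Or.inl ⟨by linarith [h.1, h.2], by linarith [h.1, h.2]⟩)
        · exact Or.inl (Or.inr ⟨by linarith [h.1, h.2], by linarith [h.1, h.2]⟩)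

/-! ### Stability -/

/-- Attraction follows from trapping: the successive hits on Σ converge geometrically to the fixed
point, so the solution enters each trapping neighbourhood and stays close from then on. -/
theorem isStableFrom (D : LoopData Z σ a r δ c ε M τmin V W φ τ Q) (hx : |x + a| ≤ ε)
    (hfix : halfMap σ r Q x = x) (hW : W ∈ 𝓝ˢ (loopTrace σ r φ τ x))
    (hst : ∀ V' ∈ 𝓝ˢ (loopTrace σ r φ τ x), ∃ W' ∈ 𝓝ˢ (loopTrace σ r φ τ x),
      ∀ (γ : ℝ → ℝ × ℝ) (T : ℝ), 0 ≤ T → IsSolution Z (centralField Z) γ 0 T → γ 0 ∈ W' →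
        γ T ∈ V') (E : Set (ℝ × ℝ)) :
    IsStableFrom Z (centralField Z) E (loopTrace σ r φ τ x) := by
  set Γ := loopTrace σ r φ τ x with hΓ
  refine ⟨fun V' hV' => ?_, W, hW, fun γ hγ hγ0 => ?_⟩
  · obtain ⟨W', hW', h⟩ := hst V' hV'
    exact ⟨W', hW', fun γ T hT hγ h0 => h γ T hT hγ h0.1⟩
  rw [Metric.tendsto_atTop]
  intro e he
  -- Distances of both `p` and `-p` are controlled, since it may be the reflected solution that is
  -- seen to enter.
  have hopen : IsOpen {p : ℝ × ℝ | Metric.infDist p Γ < e ∧ Metric.infDist (-p) Γ < e} :=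
    (isOpen_lt (Metric.continuous_infDist_pt Γ) continuous_const).inter
      (isOpen_lt ((Metric.continuous_infDist_pt Γ).comp continuous_neg) continuous_const)
  obtain ⟨W', hW', hstay⟩ := hst _ (hopen.mem_nhdsSet.2 fun p hp => by
    have h1 : -p ∈ Γ := neg_mem_loopTrace hp
    constructor
    · rwa [Metric.infDist_zero_of_mem hp]
    · rwa [Metric.infDist_zero_of_mem h1])
  have hM := D.time_bound_nonneg
  obtain ⟨t₀, ht₀, y, hy, hγy⟩ := (D.enter hM (hγ M hM) hγ0.1).2 le_rfl
  have hlim : Tendsto (fun n => (((halfMap σ r Q)^[n] y, 0) : ℝ × ℝ)) atTop (𝓝 (x, 0)) := by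
    refine Tendsto.prodMk_nhds ?_ tendsto_const_nhds
    rw [tendsto_iff_dist_tendsto_zero]
    have h0 : Tendsto (fun n : ℕ => ((1 : ℝ) / 2) ^ n * |y - x|) atTop (𝓝 0) := by
      simpa using (tendsto_pow_atTop_nhds_zero_of_lt_one (r := (1 : ℝ) / 2) (by norm_num)
        (by norm_num)).mul_const |y - x|
    refine squeeze_zero (fun _ => dist_nonneg) (fun n => ?_) h0
    have := D.iterate_lip hy hx n
    rwa [Function.iterate_fixed hfix] at this
  have hxΓ : ((x, 0) : ℝ × ℝ) ∈ Γ := Or.inl (Or.inl ⟨x, left_mem_uIcc, rfl⟩)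
  obtain ⟨n, hn⟩ := (hlim.eventually (mem_nhdsSet_iff_forall.1 hW' _ hxΓ)).exists
  have hB := D.passage_bound_pos
  obtain ⟨T₁, hT₁⟩ := exists_gt (n * (M + 2 * ε / c))
  have hT₁0 : 0 ≤ T₁ := (mul_nonneg n.cast_nonneg hB.le).trans hT₁.le
  have hfin : ∃ t₂, 0 ≤ t₂ ∧ (γ t₂ ∈ W' ∨ -γ t₂ ∈ W') := by
    have hs := (hγ (t₀ + T₁) (by linarith [ht₀.1])).neg_comp_add ht₀.1 (by linarith)
    rw [add_sub_cancel_left] at hs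
    rcases hγy with h | h
    · obtain ⟨t, ht, -, hh⟩ := D.hits n hT₁ hs.neg (by simpa using h) hy
      refine ⟨t₀ + t, by linarith [ht.1, ht₀.1], ?_⟩
      simp only [neg_neg] at hh
      rcases hh with hh | hh
      · exact Or.inl (by rw [hh]; exact hn)
      · exact Or.inr (by rw [hh]; exact hn)
    · obtain ⟨t, ht, -, hh⟩ := D.hits n hT₁ hs (by simpa using h) hy
      refine ⟨t₀ + t, by linarith [ht.1, ht₀.1], ?_⟩
      simp only [neg_neg] at hh
      rcases hh with hh | hh
      · exact Or.inr (by rw [hh]; exact hn)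
      · exact Or.inl (by rw [hh]; exact hn)
  obtain ⟨t₂, ht₂, hmem⟩ := hfin
  refine ⟨t₂, fun t ht => ?_⟩
  rw [Real.dist_eq, sub_zero, abs_of_nonneg Metric.infDist_nonneg]
  have hs := (hγ t (ht₂.trans ht)).neg_comp_add ht₂ ht
  rcases hmem with hmem | hmem
  · have := hstay _ (t - t₂) (sub_nonneg.2 ht) hs.neg (by simpa using hmem)
    simpa using this.1
  · have := hstay _ (t - t₂) (sub_nonneg.2 ht) hs (by simpa using hmem)
    simpa using this.2

end LoopData

/-! ### Smooth dependence of solutions of differential equations on data -/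

section Nemytskii

universe u

/-- Pointwise application of a continuous family of continuous linear maps. -/
noncomputable def pointwiseApply (X : Type*) [TopologicalSpace X] [CompactSpace X] (E G : Type*)
    [NormedAddCommGroup E] [NormedSpace ℝ E] [NormedAddCommGroup G] [NormedSpace ℝ G] :
    C(X, E →L[ℝ] G) →L[ℝ] C(X, E) →L[ℝ] C(X, G) :=
  LinearMap.mkContinuous₂
    (LinearMap.mk₂ ℝ
      (fun (A : C(X, E →L[ℝ] G)) (v : C(X, E)) => (⟨fun s => A s (v s), by fun_prop⟩ : C(X, G)))
      (fun A B v => by ext s; simp) (fun c A v => by ext s; simp)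
      (fun A v w => by ext s; simp) (fun c A v => by ext s; simp)) 1 fun A v => by
    rw [one_mul]
    refine (ContinuousMap.norm_le _ (by positivity)).2 fun s => ?_
    exact (A s).le_of_opNorm_le_of_le (A.norm_coe_le_norm s) (v.norm_coe_le_norm s)

variable {X : Type u} [TopologicalSpace X] [CompactSpace X]

@[simp]
theorem pointwiseApply_apply {E G : Type*} [NormedAddCommGroup E] [NormedSpace ℝ E]
    [NormedAddCommGroup G] [NormedSpace ℝ G] (A : C(X, E →L[ℝ] G)) (v : C(X, E)) (s : X) :
    pointwiseApply X E G A v s = A s (v s) := rfl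

variable {E G : Type u} [NormedAddCommGroup E] [NormedSpace ℝ E] [NormedAddCommGroup G]
  [NormedSpace ℝ G]

/-- The pointwise mean value inequality becomes uniform because postcomposition with `D` is
continuous for the sup norm. -/
theorem hasFDerivAt_postcomp {F : C(E, G)} {D : C(E, E →L[ℝ] G)}
    (hF : ∀ x, HasFDerivAt F (D x) x) (u : C(X, E)) :
    HasFDerivAt (fun u : C(X, E) => F.comp u) (pointwiseApply X E G (D.comp u)) u := by
  rw [hasFDerivAt_iff_isLittleO_nhds_zero, Asymptotics.isLittleO_iff]
  intro c hc
  have hcont : ContinuousAt (fun v : C(X, E) => D.comp v) u :=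
    (ContinuousMap.continuous_postcomp D).continuousAt
  have hev : ∀ᶠ v in 𝓝 u, dist (D.comp v) (D.comp u) < c :=
    hcont (Metric.ball_mem_nhds (D.comp u) hc)
  obtain ⟨δ, hδ, hball⟩ := Metric.eventually_nhds_iff.1 hev
  filter_upwards [Metric.ball_mem_nhds (0 : C(X, E)) hδ] with h hh
  rw [mem_ball_zero_iff] at hh
  refine (ContinuousMap.norm_le _ (by positivity)).2 fun s => ?_
  have hder : ∀ z ∈ Metric.ball (u s) δ, ‖D z - D (u s)‖ ≤ c := by
    intro z hz
    -- Translating the whole path by a constant moves `u s` to `z`, so closeness of paths gives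
    -- closeness of `D` at the single point `z`.
    have h1 : dist (u + ContinuousMap.const X (z - u s)) u < δ := by
      rw [dist_eq_norm, add_sub_cancel_left]
      refine lt_of_le_of_lt ((ContinuousMap.norm_le _ (norm_nonneg (z - u s))).2
        fun _ => le_rfl) ?_
      rwa [← dist_eq_norm]
    have h2 := (ContinuousMap.dist_le hc.le).1 (hball h1).le s
    rw [dist_eq_norm] at h2
    simpa using h2
  have hmv := (convex_ball (u s) δ).norm_image_sub_le_of_norm_hasFDerivWithin_le'
    (f := F) (f' := D) (φ := D (u s)) (C := c) (x := u s) (y := u s + h s)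
    (fun z _ => (hF z).hasFDerivWithinAt) hder
    (Metric.mem_ball_self hδ) (by
      rw [Metric.mem_ball, dist_eq_norm, add_sub_cancel_left]
      exact (h.norm_coe_le_norm s).trans_lt hh)
  rw [add_sub_cancel_left] at hmv
  exact hmv.trans (mul_le_mul_of_nonneg_left (h.norm_coe_le_norm s) hc.le)

/-- The derivative is again a postcomposition, now by `fderiv ℝ F`, followed by a bounded linear
map. The induction changes the target to `E →L[ℝ] G`, so `G` is generalized and shares its universe
with `E`. -/
theorem contDiff_postcomp (n : ℕ) {G : Type u} [NormedAddCommGroup G] [NormedSpace ℝ G]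
    {F : C(E, G)} (hF : ContDiff ℝ n F) : ContDiff ℝ n (fun u : C(X, E) => F.comp u) := by
  induction n generalizing G with
  | zero => exact contDiff_zero.2 (ContinuousMap.continuous_postcomp F)
  | succ n ih =>
    have hF' : ContDiff ℝ (n + 1) F := by exact_mod_cast hF
    obtain ⟨hd, -, hD⟩ := contDiff_succ_iff_fderiv.1 hF'
    have hder := hasFDerivAt_postcomp (X := X) (F := F) (D := ⟨fderiv ℝ F, hD.continuous⟩)
      fun x => (hd x).hasFDerivAt
    have h : ContDiff ℝ (n + 1) (fun u : C(X, E) => F.comp u) := by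
      refine contDiff_succ_iff_fderiv.2 ⟨fun u => (hder u).differentiableAt, by simp, ?_⟩
      rw [funext fun u => (hder u).fderiv]
      exact (pointwiseApply X E G).contDiff.comp (ih (F := ⟨fderiv ℝ F, hD.continuous⟩) hD)
    exact_mod_cast h

end Nemytskii

/-! ### Invertibility of Volterra operators. -/

section Volterra

open unitInterval

variable {E : Type*} [NormedAddCommGroup E] [NormedSpace ℝ E] [CompleteSpace E]

/-- The primitive that vanishes at `0`. -/
noncomputable def primitiveL (E : Type*) [NormedAddCommGroup E] [NormedSpace ℝ E]
    [CompleteSpace E] : C(I, E) →L[ℝ] C(I, E) :=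
  LinearMap.mkContinuous
    { toFun := fun v => ⟨fun t => ∫ s in (0 : ℝ)..t, v (projIcc 0 1 zero_le_one s), by
        have h : Continuous fun s => v (projIcc 0 1 zero_le_one s) := by fun_prop
        exact (intervalIntegral.continuous_primitive (fun a b => h.intervalIntegrable a b) 0).comp
          continuous_subtype_val⟩
      map_add' := fun v w => by
        ext t
        have h : ∀ v : C(I, E), Continuous fun s => v (projIcc 0 1 zero_le_one s) := fun v => by
          fun_prop
        exact intervalIntegral.integral_add ((h v).intervalIntegrable _ _)
          ((h w).intervalIntegrable _ _)
      map_smul' := fun c v => by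
        ext t
        exact intervalIntegral.integral_smul _ _ } 1 fun v => by
    rw [one_mul]
    refine (ContinuousMap.norm_le _ (norm_nonneg _)).2 fun t => ?_
    refine (intervalIntegral.norm_integral_le_of_norm_le_const
      (fun s _ => v.norm_coe_le_norm _)).trans ?_
    rw [sub_zero, abs_of_nonneg t.2.1]
    exact mul_le_of_le_one_right (norm_nonneg _) t.2.2

theorem primitiveL_apply (v : C(I, E)) (t : I) :
    primitiveL E v t = ∫ s in (0 : ℝ)..t, v (projIcc 0 1 zero_le_one s) := rfl

theorem norm_volterra_pow_apply_le (A : C(I, E →L[ℝ] E)) (n : ℕ) (v : C(I, E)) (t : I) :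
    ‖((primitiveL E ∘L pointwiseApply I E E A) ^ n) v t‖ ≤
      (‖A‖ * t) ^ n / n.factorial * ‖v‖ := by
  induction n generalizing t with
  | zero => simpa using v.norm_coe_le_norm t
  | succ n ih =>
    rw [pow_succ', mul_apply_eq_comp, ContinuousLinearMap.comp_apply,
      primitiveL_apply]
    set w := ((primitiveL E ∘L pointwiseApply I E E A) ^ n) v with hw
    have hb : ∀ s ∈ Ioc (0 : ℝ) t, ‖pointwiseApply I E E A w (projIcc 0 1 zero_le_one s)‖ ≤
        (‖A‖ ^ (n + 1) / n.factorial * ‖v‖) * s ^ n := by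
      intro s hs
      have hs' : s ∈ Icc (0 : ℝ) 1 := ⟨hs.1.le, hs.2.trans t.2.2⟩
      have h1 := ih ⟨s, hs'⟩
      rw [pointwiseApply_apply, projIcc_of_mem zero_le_one hs']
      refine ((A ⟨s, hs'⟩).le_of_opNorm_le_of_le (A.norm_coe_le_norm _) h1).trans_eq ?_
      simp only
      ring
    refine (intervalIntegral.norm_integral_le_of_norm_le t.2.1 (ae_of_all _ hb)
      ((continuous_const.mul (continuous_pow n)).intervalIntegrable _ _)).trans_eq ?_
    rw [intervalIntegral.integral_const_mul, integral_pow, Nat.factorial_succ]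
    have : (n.factorial : ℝ) ≠ 0 := by positivity
    push_cast
    field_simp
    ring

/-- Powers of the Volterra operator `K` decay like `‖A‖ ^ n / n!`, so `1 - K ^ n` is invertible for
some `n` by the Neumann series, and `1 - K` is a commuting factor of it. No smallness of `A` or of
the time interval is required. -/
theorem isUnit_one_sub_volterra (A : C(I, E →L[ℝ] E)) :
    IsUnit (1 - primitiveL E ∘L pointwiseApply I E E A) := by
  set K := primitiveL E ∘L pointwiseApply I E E A with hK
  have hlim := FloorSemiring.tendsto_pow_div_factorial_atTop ‖A‖
  obtain ⟨n, hn⟩ := (hlim.eventually (gt_mem_nhds one_pos)).exists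
  have hKn : ‖K ^ n‖ < 1 := by
    refine lt_of_le_of_lt (ContinuousLinearMap.opNorm_le_bound _ (by positivity) fun v => ?_) hn
    refine (ContinuousMap.norm_le _ (by positivity)).2 fun t => ?_
    refine (norm_volterra_pow_apply_le A n v t).trans ?_
    have ht : ‖A‖ * t ≤ ‖A‖ := mul_le_of_le_one_right (norm_nonneg A) t.2.2
    have ht0 : 0 ≤ ‖A‖ * t := mul_nonneg (norm_nonneg A) t.2.1
    gcongr
  have h1 : IsUnit (1 - K ^ n) := isUnit_one_sub_of_norm_lt_one (R := C(I, E) →L[ℝ] C(I, E)) hKn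
  rw [← mul_neg_geom_sum] at h1
  have hcomm : Commute (1 - K) (∑ i ∈ Finset.range n, K ^ i) := by
    rw [Commute, SemiconjBy, mul_neg_geom_sum, geom_sum_mul_neg]
  exact (hcomm.isUnit_mul_iff.1 h1).1

end Volterra

/-! ### The flow by the implicit function theorem in path space. -/

section SmoothFlow

open unitInterval

section Extension

variable {E : Type} [TopologicalSpace E]

/-- Extension of a path on `[0, 1]` to a function on the line. -/
noncomputable def extendPath (u : C(I, E)) (t : ℝ) : E := u (projIcc 0 1 zero_le_one t)

theorem continuous_extendPath (u : C(I, E)) : Continuous (extendPath u) := by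
  unfold extendPath; fun_prop

theorem extendPath_coe (u : C(I, E)) (t : I) : extendPath u t = u t := by
  rw [extendPath, projIcc_val]

end Extension

variable {E : Type} [NormedAddCommGroup E] [NormedSpace ℝ E] [CompleteSpace E]

theorem primitiveL_eq (v : C(I, E)) (t : I) :
    primitiveL E v t = ∫ s in (0 : ℝ)..t, extendPath v s := rfl

theorem hasDerivWithinAt_extendPath {u v : C(I, E)} {e : E}
    (h : u = ContinuousMap.const I e + primitiveL E v) {t : ℝ} (ht : t ∈ Icc (0 : ℝ) 1) :
    HasDerivWithinAt (extendPath u) (extendPath v t) (Icc 0 1) t := by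
  have hv := continuous_extendPath v
  have h1 : HasDerivAt (fun t => e + ∫ s in (0 : ℝ)..t, extendPath v s) (extendPath v t) t :=
    (intervalIntegral.integral_hasDerivAt_right (hv.intervalIntegrable _ _)
      (hv.stronglyMeasurableAtFilter _ _) hv.continuousAt).const_add e
  refine h1.hasDerivWithinAt.congr_of_mem (fun s hs => ?_) ht
  rw [extendPath, projIcc_of_mem zero_le_one hs, h]
  rfl

theorem extendPath_zero {u v : C(I, E)} {e : E}
    (h : u = ContinuousMap.const I e + primitiveL E v) : extendPath u 0 = e := by
  have : extendPath u 0 = u 0 := extendPath_coe u 0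
  rw [this, h, ContinuousMap.add_apply, primitiveL_eq]
  simp

theorem eq_const_add_primitiveL {u v : C(I, E)}
    (h : ∀ t ∈ Icc (0 : ℝ) 1, HasDerivWithinAt (extendPath u) (extendPath v t) (Icc 0 1) t) :
    u = ContinuousMap.const I (u 0) + primitiveL E v := by
  ext t
  have h0 : extendPath u 0 = u 0 := extendPath_coe u 0
  rw [ContinuousMap.add_apply, ContinuousMap.const_apply, primitiveL_eq,
    intervalIntegral.integral_eq_sub_of_hasDerivAt_of_le t.2.1
      (continuous_extendPath u).continuousOn (fun s hs => ?_)
      ((continuous_extendPath v).intervalIntegrable _ _), extendPath_coe, h0]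
  · abel
  · exact (h s ⟨hs.1.le, hs.2.le.trans t.2.2⟩).hasDerivAt
      (Icc_mem_nhds hs.1 (hs.2.trans_le t.2.2))

/-- A local flow near a reference solution, in the form of a smooth family of paths on the unit
interval: `ψ (T, x)` is the solution from `x` on `[0, T]`, run through in unit time. -/
theorem exists_smooth_flow {n : ℕ} (hn : n ≠ 0) (F : C(E, E)) (hF : ContDiff ℝ n F)
    {γ : ℝ → E} {T : ℝ} (hT : 0 ≤ T)
    (hγ : ∀ t ∈ Icc 0 T, HasDerivWithinAt γ (F (γ t)) (Icc 0 T) t) :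
    ∃ ψ : ℝ × E → C(I, E), ContDiffAt ℝ n ψ (T, γ 0) ∧ (∀ s : I, ψ (T, γ 0) s = γ (T * s)) ∧
      ∀ᶠ q in 𝓝 (T, γ 0), ψ q = ContinuousMap.const I q.2 + primitiveL E (q.1 • F.comp (ψ q)) := by
  have hmaps : ∀ s : I, T * s ∈ Icc 0 T := fun s =>
    ⟨mul_nonneg hT s.2.1, mul_le_of_le_one_right hT s.2.2⟩
  have hcont : ContinuousOn γ (Icc 0 T) := fun t ht => (hγ t ht).continuousWithinAt
  let u₀ : C(I, E) := ⟨fun s => γ (T * s), hcont.comp_continuous (by fun_prop) hmaps⟩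
  have hu₀ : u₀ = ContinuousMap.const I (γ 0) + primitiveL E (T • F.comp u₀) := by
    have h := eq_const_add_primitiveL (u := u₀) (v := T • F.comp u₀) fun t ht => by
      have h1 : HasDerivWithinAt (fun s : ℝ => T * s) T (Icc 0 1) t := by
        simpa using ((hasDerivAt_id t).const_mul T).hasDerivWithinAt
      have h2 := (hγ (T * t) (hmaps ⟨t, ht⟩)).scomp t h1 fun s hs => hmaps ⟨s, hs⟩
      have h3 : extendPath (T • F.comp u₀) t = T • F (γ (T * t)) := by
        rw [extendPath, projIcc_of_mem zero_le_one ht]; rfl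
      rw [h3]
      refine h2.congr_of_mem (fun s hs => ?_) ht
      rw [extendPath, projIcc_of_mem zero_le_one hs]; rfl
    have h0 : u₀ 0 = γ 0 := by simp [u₀]
    rwa [h0] at h
  -- The zeros of `G` are the solutions in integral form. Rescaling to unit time turns the length
  -- `T` of the time interval into an ordinary parameter.
  let G : (ℝ × E) × C(I, E) → C(I, E) := fun z =>
    z.2 - ContinuousMap.const I z.1.2 - primitiveL E (z.1.1 • F.comp z.2)
  have hconst : ContDiff ℝ n fun x : E => ContinuousMap.const I x :=
    (ContinuousLinearMap.const ℝ I (M := E)).contDiff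
  have hG : ContDiff ℝ n G := by
    have h1 : ContDiff ℝ n fun z : (ℝ × E) × C(I, E) => F.comp z.2 :=
      (contDiff_postcomp n hF).comp contDiff_snd
    exact (contDiff_snd.sub (hconst.comp (contDiff_snd.comp contDiff_fst))).sub
      ((primitiveL E).contDiff.comp ((contDiff_fst.comp contDiff_fst).smul h1))
  have hn' : ((n : ℕ∞) : WithTop ℕ∞) ≠ 0 := by exact_mod_cast hn
  have hG0 : ContDiffAt ℝ n G ((T, γ 0), u₀) := hG.contDiffAt
  have hFd : ContDiff ℝ 1 F := hF.of_le (by exact_mod_cast Nat.one_le_iff_ne_zero.2 hn)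
  let D : C(E, E →L[ℝ] E) := ⟨fderiv ℝ F, hFd.continuous_fderiv one_ne_zero⟩
  have hD : ∀ x, HasFDerivAt F (D x) x := fun x =>
    (hFd.differentiable one_ne_zero x).hasFDerivAt
  -- The partial derivative in the path is the identity minus a Volterra operator, hence invertible.
  have hpart : fderiv ℝ G ((T, γ 0), u₀) ∘L .inr ℝ (ℝ × E) C(I, E) =
      1 - primitiveL E ∘L pointwiseApply I E E (T • D.comp u₀) := by
    have h1 : HasFDerivAt (fun u => G ((T, γ 0), u))
        (fderiv ℝ G ((T, γ 0), u₀) ∘L .inr ℝ (ℝ × E) C(I, E)) u₀ :=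
      (hG0.differentiableAt hn').hasFDerivAt.comp u₀ (hasFDerivAt_prodMk_right (T, γ 0) u₀)
    have h2 : HasFDerivAt (fun u => G ((T, γ 0), u))
        (1 - (primitiveL E) ∘L (T • pointwiseApply I E E (D.comp u₀))) u₀ :=
      ((hasFDerivAt_id u₀).sub_const (ContinuousMap.const I (γ 0))).sub
        ((primitiveL E).hasFDerivAt.comp u₀ ((hasFDerivAt_postcomp hD u₀).const_smul T))
    rw [h1.unique h2, map_smul]
  have hinv : (fderiv ℝ G ((T, γ 0), u₀) ∘L .inr ℝ (ℝ × E) C(I, E)).IsInvertible := by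
    rw [hpart]
    obtain ⟨v, hv⟩ := isUnit_one_sub_volterra (T • D.comp u₀)
    exact ⟨ContinuousLinearEquiv.unitsEquiv ℝ C(I, E) v, by ext1 w; rw [← hv]; rfl⟩
  refine ⟨hG0.implicitFunction hn' hinv, hG0.contDiffAt_implicitFunction hn' hinv, fun s => ?_, ?_⟩
  · have := hG0.implicitFunction_apply_self hn' hinv
    simp only at this
    rw [this]; rfl
  · have hz : G ((T, γ 0), u₀) = 0 := by
      change u₀ - ContinuousMap.const I (γ 0) - primitiveL E (T • F.comp u₀) = 0
      rw [sub_sub, ← hu₀, sub_self]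
    filter_upwards [hG0.eventually_apply_implicitFunction hn' hinv] with q hq
    rw [hz] at hq
    change _ - _ - _ = _ at hq
    rw [sub_sub, sub_eq_zero] at hq
    exact hq

/-- The derivative of the flow solves the linearised integral equation. -/
theorem fderiv_flow_eq {n : ℕ} (hn : n ≠ 0) {F : C(E, E)} (D : C(E, E →L[ℝ] E))
    (hD : ∀ x, HasFDerivAt F (D x) x) {ψ : ℝ × E → C(I, E)} {q₀ : ℝ × E}
    (hψ : ContDiffAt ℝ n ψ q₀)
    (heq : ∀ᶠ q in 𝓝 q₀, ψ q = ContinuousMap.const I q.2 + primitiveL E (q.1 • F.comp (ψ q)))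
    (d : ℝ × E) :
    fderiv ℝ ψ q₀ d = ContinuousMap.const I d.2 + primitiveL E (d.1 • F.comp (ψ q₀) +
      q₀.1 • pointwiseApply I E E (D.comp (ψ q₀)) (fderiv ℝ ψ q₀ d)) := by
  have hn' : ((n : ℕ∞) : WithTop ℕ∞) ≠ 0 := by exact_mod_cast hn
  have h1 : HasFDerivAt ψ (fderiv ℝ ψ q₀) q₀ := (hψ.differentiableAt hn').hasFDerivAt
  have h2 : HasFDerivAt (fun q => F.comp (ψ q))
      (pointwiseApply I E E (D.comp (ψ q₀)) ∘L fderiv ℝ ψ q₀) q₀ :=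
    (hasFDerivAt_postcomp hD (ψ q₀)).comp q₀ h1
  have h3 := (hasFDerivAt_fst (𝕜 := ℝ) (p := q₀)).smul h2
  have h4 := ((ContinuousLinearMap.const ℝ I (M := E)).hasFDerivAt.comp q₀
    (hasFDerivAt_snd (𝕜 := ℝ) (p := q₀))).add ((primitiveL E).hasFDerivAt.comp q₀ h3)
  have h5 := h1.unique (h4.congr_of_eventuallyEq heq)
  conv_lhs => rw [h5]
  simp only [add_apply, ContinuousLinearMap.comp_apply]
  congr 2
  rw [add_comm]
  rfl

/-- Differentiating the flow with respect to the elapsed time returns the vector field. -/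
theorem fderiv_flow_time {n : ℕ} (hn : n ≠ 0) {F : C(E, E)} (D : C(E, E →L[ℝ] E))
    (hD : ∀ x, HasFDerivAt F (D x) x) {ψ : ℝ × E → C(I, E)} {q₀ : ℝ × E}
    (hψ : ContDiffAt ℝ n ψ q₀)
    (heq : ∀ᶠ q in 𝓝 q₀, ψ q = ContinuousMap.const I q.2 + primitiveL E (q.1 • F.comp (ψ q))) :
    fderiv ℝ ψ q₀ (1, 0) 1 = F (ψ q₀ 1) := by
  set w := fderiv ℝ ψ q₀ (1, 0) with hw
  have hweq := fderiv_flow_eq hn D hD hψ heq (1, 0)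
  rw [← hw] at hweq
  set u := ψ q₀ with hu
  have hueq : u = ContinuousMap.const I q₀.2 + primitiveL E (q₀.1 • F.comp u) := heq.self_of_nhds
  -- Since `ψ (T, x) s` is the solution at time `T * s`, its `T`-derivative should be `s • F (u s)`.
  -- This path solves the linearised equation, whose solution is unique because the Volterra
  -- equation is invertible.
  let z : C(I, E) := ⟨fun s => (s : ℝ) • F (u s), by fun_prop⟩
  have hz : z = ContinuousMap.const I (z 0) + primitiveL E (F.comp u +
      q₀.1 • pointwiseApply I E E (D.comp u) z) := by
    refine eq_const_add_primitiveL fun t ht => ?_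
    have h1 := (hD (extendPath u t)).comp_hasDerivWithinAt t (hasDerivWithinAt_extendPath hueq ht)
    have h2 := (hasDerivWithinAt_id t (Icc (0 : ℝ) 1)).smul h1
    refine (h2.congr_of_mem (f₁ := extendPath z) (fun s hs => ?_) ht).congr_deriv ?_
    · rw [extendPath, projIcc_of_mem zero_le_one hs]
      simp [z, extendPath, projIcc_of_mem zero_le_one hs]
    · have h0 : extendPath u t = u ⟨t, ht⟩ := by rw [extendPath, projIcc_of_mem zero_le_one ht]
      simp only [extendPath, projIcc_of_mem zero_le_one ht]
      simp [h0, z, smul_smul, mul_comm, add_comm]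
  have hz0 : z 0 = 0 := by simp [z]
  rw [hz0] at hz
  obtain ⟨v, hv⟩ := isUnit_one_sub_volterra (q₀.1 • D.comp u)
  have hzero : (1 - primitiveL E ∘L pointwiseApply I E E (q₀.1 • D.comp u)) (w - z) = 0 := by
    have e1 : w - z = primitiveL E (q₀.1 • pointwiseApply I E E (D.comp u) (w - z)) := by
      conv_lhs => rw [hweq, hz]
      rw [add_sub_add_left_eq_sub, ← map_sub, one_smul, add_sub_add_left_eq_sub, ← smul_sub,
        ← map_sub]
    rw [map_smul]
    simp only [sub_apply, ContinuousLinearMap.comp_apply,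
      smul_apply, one_apply_eq_self]
    exact sub_eq_zero.2 e1
  have hwz : w - z = 0 := by
    rw [← hv] at hzero
    have := congrArg (v⁻¹ : (C(I, E) →L[ℝ] C(I, E))ˣ).val hzero
    rw [← mul_apply_eq_comp, Units.inv_mul] at this
    simpa using this
  rw [sub_eq_zero.1 hwz]
  simp [z]

end SmoothFlow

/-! ### Partial derivatives and the Melnikov integral -/

section Melnikov

variable {m : ℕ} {f g : ℝ → ℝ → (Fin m → ℝ) → ℝ}

/-- A function of `x`, `y` and the parameter as a function on the product space. -/
def uncurry₃ (f : ℝ → ℝ → (Fin m → ℝ) → ℝ) (q : (ℝ × ℝ) × (Fin m → ℝ)) : ℝ := f q.1.1 q.1.2 q.2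

variable {p : ℝ × ℝ} {α : Fin m → ℝ}

theorem partialX_eq (hf : DifferentiableAt ℝ (uncurry₃ f) (p, α)) :
    partialX f p α = fderiv ℝ (uncurry₃ f) (p, α) ((1, 0), 0) := by
  have h : HasDerivAt (fun x : ℝ => ((x, p.2), α)) (((1 : ℝ), (0 : ℝ)), (0 : Fin m → ℝ)) p.1 :=
    ((hasDerivAt_id p.1).prodMk (hasDerivAt_const _ _)).prodMk (hasDerivAt_const _ _)
  exact (hf.hasFDerivAt.comp_hasDerivAt p.1 h).deriv

theorem partialY_eq (hf : DifferentiableAt ℝ (uncurry₃ f) (p, α)) :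
    partialY f p α = fderiv ℝ (uncurry₃ f) (p, α) ((0, 1), 0) := by
  have h : HasDerivAt (fun y : ℝ => ((p.1, y), α)) (((0 : ℝ), (1 : ℝ)), (0 : Fin m → ℝ)) p.2 :=
    ((hasDerivAt_const _ _).prodMk (hasDerivAt_id p.2)).prodMk (hasDerivAt_const _ _)
  exact (hf.hasFDerivAt.comp_hasDerivAt p.2 h).deriv

theorem partialParam_eq (hf : DifferentiableAt ℝ (uncurry₃ f) (p, α)) (i : Fin m) :
    partialParam f i p α = fderiv ℝ (uncurry₃ f) (p, α) (0, Pi.single i 1) := by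
  have h : HasDerivAt (fun u : ℝ => (p, Function.update α i u))
      ((0 : ℝ × ℝ), (Pi.single i (1 : ℝ) : Fin m → ℝ)) (α i) :=
    (hasDerivAt_const _ _).prodMk (hasDerivAt_update α i (α i))
  refine HasDerivAt.deriv (HasFDerivAt.comp_hasDerivAt (l := uncurry₃ f) (α i) ?_ h)
  rw [Function.update_eq_self]
  exact hf.hasFDerivAt

theorem fderiv_uncurry₃ (hf : DifferentiableAt ℝ (uncurry₃ f) (p, α)) (w : ℝ × ℝ) (e : Fin m → ℝ) :
    fderiv ℝ (uncurry₃ f) (p, α) (w, e) =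
      w.1 * partialX f p α + w.2 * partialY f p α + ∑ i, e i * partialParam f i p α := by
  simp only [partialX_eq hf, partialY_eq hf, partialParam_eq hf]
  have h : ((w, e) : (ℝ × ℝ) × (Fin m → ℝ)) = w.1 • ((1, 0), 0) + w.2 • ((0, 1), 0) +
      ∑ i, e i • ((0 : ℝ × ℝ), (Pi.single i (1 : ℝ) : Fin m → ℝ)) := by
    refine Prod.ext ?_ ?_
    · rw [Prod.fst_add, Prod.fst_sum]; simp
    · rw [Prod.snd_add, Prod.snd_sum]
      simp only [Prod.snd_add, Prod.smul_snd, smul_zero, zero_add]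
      exact pi_eq_sum_univ' e
  rw [h]
  simp only [map_add, map_smul, map_sum, smul_eq_mul]

variable {γ₀ : ℝ → ℝ × ℝ} {τ₀ : ℝ}

/-- The Melnikov identity: the determinant of the vector field and a solution of the variational
equation along an orbit. -/
theorem melnikov_identity (hτ₀ : 0 ≤ τ₀) (hf : ContDiff ℝ 1 (uncurry₃ f))
    (hg : ContDiff ℝ 1 (uncurry₃ g))
    (hγ₀ : ∀ t ∈ Icc 0 τ₀, HasDerivWithinAt γ₀ (upperField f g 0 (γ₀ t)) (Icc 0 τ₀) t)
    {w : ℝ → ℝ × ℝ} {c : ℝ} {e : Fin m → ℝ}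
    (hw : ∀ t ∈ Icc 0 τ₀, HasDerivWithinAt w (c • upperField f g 0 (γ₀ t) +
      (fderiv ℝ (uncurry₃ f) (γ₀ t, 0) (w t, e), fderiv ℝ (uncurry₃ g) (γ₀ t, 0) (w t, e)))
      (Icc 0 τ₀) t) :
    (upperField f g 0 (γ₀ τ₀)).1 * (w τ₀).2 - (upperField f g 0 (γ₀ τ₀)).2 * (w τ₀).1 =
      lambdaCoeff f g γ₀ τ₀ 0 *
        ((upperField f g 0 (γ₀ 0)).1 * (w 0).2 - (upperField f g 0 (γ₀ 0)).2 * (w 0).1) +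
      ∑ i, kappaCoeff f g γ₀ τ₀ i * e i := by
  have hdf := hf.differentiable one_ne_zero
  have hdg := hg.differentiable one_ne_zero
  have hcγ : ContinuousOn γ₀ (Icc 0 τ₀) := fun t ht => (hγ₀ t ht).continuousWithinAt
  have hcw : ContinuousOn w (Icc 0 τ₀) := fun t ht => (hw t ht).continuousWithinAt
  have hpair : ContinuousOn (fun t => (γ₀ t, (0 : Fin m → ℝ))) (Icc 0 τ₀) :=
    hcγ.prodMk continuousOn_const
  have hcpart : ∀ {h : ℝ → ℝ → (Fin m → ℝ) → ℝ}, ContDiff ℝ 1 (uncurry₃ h) → ∀ v,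
      ContinuousOn (fun t => fderiv ℝ (uncurry₃ h) (γ₀ t, 0) v) (Icc 0 τ₀) := fun hh v =>
    ((hh.continuous_fderiv one_ne_zero).clm_apply continuous_const).comp_continuousOn hpair
  have hcX : ContinuousOn (fun t => partialX f (γ₀ t) 0 + partialY g (γ₀ t) 0) (Icc 0 τ₀) := by
    simp only [partialX_eq (hdf _), partialY_eq (hdg _)]
    exact (hcpart hf _).add (hcpart hg _)
  have hcf : ContinuousOn (fun t => f (γ₀ t).1 (γ₀ t).2 0) (Icc 0 τ₀) :=
    hf.continuous.comp_continuousOn hpair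
  have hcg : ContinuousOn (fun t => g (γ₀ t).1 (γ₀ t).2 0) (Icc 0 τ₀) :=
    hg.continuous.comp_continuousOn hpair
  have hint : ∀ {h : ℝ → ℝ} {x y : ℝ}, ContinuousOn h (Icc 0 τ₀) → x ∈ Icc 0 τ₀ → y ∈ Icc 0 τ₀ →
      IntervalIntegrable h volume x y := fun hh hx hy =>
    (hh.mono (uIcc_subset_Icc hx hy)).intervalIntegrable
  have hclam : ContinuousOn (lambdaCoeff f g γ₀ τ₀) (Icc 0 τ₀) := by
    refine Real.continuous_exp.comp_continuousOn ?_
    have := intervalIntegral.continuousOn_primitive_interval_left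
      (μ := volume) (f := fun t => partialX f (γ₀ t) 0 + partialY g (γ₀ t) 0) (a := 0) (b := τ₀)
      (by rw [uIcc_of_le hτ₀]; exact hcX.integrableOn_Icc)
    rwa [uIcc_of_le hτ₀] at this
  have hdlam : ∀ t ∈ Ioo 0 τ₀, HasDerivAt (lambdaCoeff f g γ₀ τ₀)
      (-(partialX f (γ₀ t) 0 + partialY g (γ₀ t) 0) * lambdaCoeff f g γ₀ τ₀ t) t := fun t ht => by
    have h1 := intervalIntegral.integral_hasDerivAt_left
      (hint hcX (Ioo_subset_Icc_self ht) (right_mem_Icc.2 hτ₀))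
      ((hcX.mono Ioo_subset_Icc_self).stronglyMeasurableAtFilter isOpen_Ioo t ht)
      (hcX.continuousAt (Icc_mem_nhds ht.1 ht.2))
    refine h1.exp.congr_deriv ?_
    rw [lambdaCoeff]; ring
  set Mel : Fin m → ℝ → ℝ := fun i t => lambdaCoeff f g γ₀ τ₀ t *
    (f (γ₀ t).1 (γ₀ t).2 0 * partialParam g i (γ₀ t) 0 -
      g (γ₀ t).1 (γ₀ t).2 0 * partialParam f i (γ₀ t) 0) with hMel
  have hcMel : ∀ i, ContinuousOn (Mel i) (Icc 0 τ₀) := fun i => by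
    simp only [hMel, partialParam_eq (hdf _), partialParam_eq (hdg _)]
    exact hclam.mul ((hcf.mul (hcpart hg _)).sub (hcg.mul (hcpart hf _)))
  -- In the derivative of the determinant the linear terms combine to the divergence times the
  -- determinant, which the factor λ cancels. The summand `c •` field has zero determinant with the
  -- field. Only the parameter terms, the Melnikov integrands, remain.
  set Δ : ℝ → ℝ := fun t => lambdaCoeff f g γ₀ τ₀ t *
    (f (γ₀ t).1 (γ₀ t).2 0 * (w t).2 - g (γ₀ t).1 (γ₀ t).2 0 * (w t).1) with hΔ
  have hcΔ : ContinuousOn Δ (Icc 0 τ₀) :=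
    hclam.mul ((hcf.mul (continuous_snd.comp_continuousOn hcw)).sub
      (hcg.mul (continuous_fst.comp_continuousOn hcw)))
  have hdΔ : ∀ t ∈ Ioo 0 τ₀, HasDerivAt Δ (∑ i, e i * Mel i t) t := fun t ht => by
    have hn := Icc_mem_nhds ht.1 ht.2
    have hγt := (hγ₀ t (Ioo_subset_Icc_self ht)).hasDerivAt hn
    have hwt := (hw t (Ioo_subset_Icc_self ht)).hasDerivAt hn
    have hpt := hγt.prodMk (hasDerivAt_const t (0 : Fin m → ℝ))
    have hft := (hdf (γ₀ t, 0)).hasFDerivAt.comp_hasDerivAt t hpt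
    have hgt := (hdg (γ₀ t, 0)).hasFDerivAt.comp_hasDerivAt t hpt
    rw [fderiv_uncurry₃ (hdf _)] at hft hwt
    rw [fderiv_uncurry₃ (hdg _)] at hgt hwt
    have h := (hdlam t ht).mul ((hft.mul (hasDerivAt_snd_comp hwt)).sub
      (hgt.mul (hasDerivAt_fst_comp hwt)))
    refine h.congr_deriv ?_
    simp only [uncurry₃, upperField, Function.comp, Pi.zero_apply, zero_mul, Finset.sum_const_zero,
      add_zero, Prod.fst_add, Prod.snd_add, Prod.smul_fst, Prod.smul_snd, smul_eq_mul, hMel,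
      Pi.sub_apply, Pi.mul_apply]
    have e1 : ∑ i, e i * (lambdaCoeff f g γ₀ τ₀ t *
        (f (γ₀ t).1 (γ₀ t).2 0 * partialParam g i (γ₀ t) 0 -
          g (γ₀ t).1 (γ₀ t).2 0 * partialParam f i (γ₀ t) 0)) =
        lambdaCoeff f g γ₀ τ₀ t * (f (γ₀ t).1 (γ₀ t).2 0 * ∑ i, e i * partialParam g i (γ₀ t) 0 -
          g (γ₀ t).1 (γ₀ t).2 0 * ∑ i, e i * partialParam f i (γ₀ t) 0) := by
      rw [Finset.mul_sum, Finset.mul_sum, ← Finset.sum_sub_distrib, Finset.mul_sum]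
      exact Finset.sum_congr rfl fun i _ => by ring
    rw [e1]
    ring
  have hftc := intervalIntegral.integral_eq_sub_of_hasDerivAt_of_le hτ₀ hcΔ hdΔ
    (hint (continuousOn_finsetSum _ fun i _ => continuousOn_const.mul (hcMel i))
      (left_mem_Icc.2 hτ₀) (right_mem_Icc.2 hτ₀))
  rw [intervalIntegral.integral_finsetSum (f := fun i t => e i * Mel i t) fun i _ =>
    hint (h := fun t => e i * Mel i t) (continuousOn_const.mul (hcMel i))
      (left_mem_Icc.2 hτ₀) (right_mem_Icc.2 hτ₀)] at hftc
  simp only [intervalIntegral.integral_const_mul] at hftc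
  have h1 : lambdaCoeff f g γ₀ τ₀ τ₀ = 1 := by simp [lambdaCoeff]
  have h2 : ∑ i, kappaCoeff f g γ₀ τ₀ i * e i = ∑ i, e i * ∫ t in (0 : ℝ)..τ₀, Mel i t :=
    Finset.sum_congr rfl fun i _ => by rw [mul_comm]; rfl
  rw [h2, hftc]
  simp only [hΔ, h1, upperField]
  ring

end Melnikov

/-! ### Flow of the parametrised family. -/

section FamilyFlow

open unitInterval

variable {m : ℕ} {f g : ℝ → ℝ → (Fin m → ℝ) → ℝ}

theorem hasDerivWithinAt_unscale {E : Type} [NormedAddCommGroup E] [NormedSpace ℝ E]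
    [CompleteSpace E] {F : C(E, E)} {u : C(I, E)} {T : ℝ} {x : E} (hT : 0 < T)
    (h : u = ContinuousMap.const I x + primitiveL E (T • F.comp u)) {t : ℝ} (ht : t ∈ Icc 0 T) :
    HasDerivWithinAt (fun t => extendPath u (t / T)) (F (extendPath u (t / T))) (Icc 0 T) t := by
  have hmaps : MapsTo (fun t => t / T) (Icc 0 T) (Icc 0 1) := fun s hs =>
    ⟨div_nonneg hs.1 hT.le, (div_le_one hT).2 hs.2⟩
  have h1 : HasDerivWithinAt (fun s : ℝ => s / T) (1 / T) (Icc 0 T) t :=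
    ((hasDerivAt_id t).div_const T).hasDerivWithinAt
  refine ((hasDerivWithinAt_extendPath h (hmaps ht)).scomp t h1 hmaps).congr_deriv ?_
  change (1 / T) • T • F (extendPath u (t / T)) = _
  rw [smul_smul, one_div_mul_cancel hT.ne', one_smul]

/-- The vector field of the upper subsystem, extended by the constant parameter. -/
def familyField (f g : ℝ → ℝ → (Fin m → ℝ) → ℝ) (q : (ℝ × ℝ) × (Fin m → ℝ)) :
    (ℝ × ℝ) × (Fin m → ℝ) := (upperField f g q.2 q.1, 0)

theorem contDiff_familyField {n : WithTop ℕ∞} (hf : ContDiff ℝ n (uncurry₃ f))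
    (hg : ContDiff ℝ n (uncurry₃ g)) : ContDiff ℝ n (familyField f g) :=
  (hf.prodMk hg).prodMk contDiff_const

theorem contDiff_upperField {n : WithTop ℕ∞} (hf : ContDiff ℝ n (uncurry₃ f))
    (hg : ContDiff ℝ n (uncurry₃ g)) (α : Fin m → ℝ) : ContDiff ℝ n (upperField f g α) :=
  contDiff_fst.comp ((contDiff_familyField hf hg).comp (contDiff_id.prodMk contDiff_const))

theorem continuous_upperField (hf : ContDiff ℝ 1 (uncurry₃ f)) (hg : ContDiff ℝ 1 (uncurry₃ g)) :
    Continuous fun q : (ℝ × ℝ) × (Fin m → ℝ) => upperField f g q.2 q.1 :=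
  continuous_fst.comp (contDiff_familyField hf hg).continuous

theorem fderiv_familyField (hf : ContDiff ℝ 1 (uncurry₃ f)) (hg : ContDiff ℝ 1 (uncurry₃ g))
    (q v : (ℝ × ℝ) × (Fin m → ℝ)) : fderiv ℝ (familyField f g) q v =
      ((fderiv ℝ (uncurry₃ f) q v, fderiv ℝ (uncurry₃ g) q v), 0) := by
  have h := (((hf.differentiable one_ne_zero q).hasFDerivAt.prodMk
    (hg.differentiable one_ne_zero q).hasFDerivAt).prodMk
      (hasFDerivAt_const (0 : Fin m → ℝ) q))
  rw [show fderiv ℝ (familyField f g) q = _ from HasFDerivAt.fderiv h]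
  rfl

/-- A smooth flow of the family near a reference solution. -/
structure FamilyFlow (k : ℕ) (f g : ℝ → ℝ → (Fin m → ℝ) → ℝ) (T : ℝ) (γ : ℝ → ℝ × ℝ)
    (α₀ : Fin m → ℝ) (ψ : ℝ × ((ℝ × ℝ) × (Fin m → ℝ)) → C(I, (ℝ × ℝ) × (Fin m → ℝ))) :
    Prop where
  contDiffAt : ContDiffAt ℝ k ψ (T, (γ 0, α₀))
  apply_base : ∀ s : I, ψ (T, (γ 0, α₀)) s = (γ (T * s), α₀)
  integral_eq : ∀ F : C((ℝ × ℝ) × (Fin m → ℝ), (ℝ × ℝ) × (Fin m → ℝ)), ⇑F = familyField f g →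
    ∀ᶠ q in 𝓝 (T, (γ 0, α₀)), ψ q = ContinuousMap.const I q.2 + primitiveL _ (q.1 • F.comp (ψ q))

theorem exists_familyFlow {k : ℕ} (hk : k ≠ 0) (hf : ContDiff ℝ k (uncurry₃ f))
    (hg : ContDiff ℝ k (uncurry₃ g)) {T : ℝ} {γ : ℝ → ℝ × ℝ} {α₀ : Fin m → ℝ} (hT : 0 ≤ T)
    (hγ : ∀ t ∈ Icc 0 T, HasDerivWithinAt γ (upperField f g α₀ (γ t)) (Icc 0 T) t) :
    ∃ ψ, FamilyFlow k f g T γ α₀ ψ := by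
  have hF := contDiff_familyField hf hg
  obtain ⟨ψ, h1, h2, h3⟩ := exists_smooth_flow hk ⟨familyField f g, hF.continuous⟩ hF hT
    (γ := fun t => (γ t, α₀)) fun t ht => (hγ t ht).prodMk (hasDerivWithinAt_const t _ α₀)
  refine ⟨ψ, h1, h2, fun F hFF => ?_⟩
  have : F = ⟨familyField f g, hF.continuous⟩ := ContinuousMap.ext fun x => congrFun hFF x
  rw [this]
  exact h3

namespace FamilyFlow

variable {k : ℕ} {T : ℝ} {γ : ℝ → ℝ × ℝ} {α₀ : Fin m → ℝ}
  {ψ : ℝ × ((ℝ × ℝ) × (Fin m → ℝ)) → C(I, (ℝ × ℝ) × (Fin m → ℝ))}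

theorem eventually_close (h : FamilyFlow k f g T γ α₀ ψ) {ε : ℝ} (hε : 0 < ε) :
    ∀ᶠ q in 𝓝 (T, (γ 0, α₀)), ∀ s : I, dist (ψ q s).1 (γ (T * s)) < ε := by
  filter_upwards [h.contDiffAt.continuousAt (Metric.ball_mem_nhds _ hε)] with q hq s
  have h1 := (ContinuousMap.dist_apply_le_dist s).trans_lt (Metric.mem_ball.1 hq)
  rw [h.apply_base] at h1
  exact (le_max_left _ _).trans_lt h1

theorem eventually_solves (h : FamilyFlow k f g T γ α₀ ψ)
    (hf : ContDiff ℝ k (uncurry₃ f)) (hg : ContDiff ℝ k (uncurry₃ g)) :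
    ∀ᶠ q in 𝓝 (T, (γ 0, α₀)), extendPath (ψ q) 0 = q.2 ∧
      (0 < q.1 → ∀ t ∈ Icc 0 q.1, HasDerivWithinAt (fun t => (extendPath (ψ q) (t / q.1)).1)
        (upperField f g q.2.2 (extendPath (ψ q) (t / q.1)).1) (Icc 0 q.1) t) := by
  have hF := contDiff_familyField hf hg
  filter_upwards [h.integral_eq ⟨familyField f g, hF.continuous⟩ rfl] with q hq
  refine ⟨extendPath_zero hq, fun hT t ht => ?_⟩
  -- The parameter is carried along as a state with zero velocity, so it keeps its initial value.
  have hpar : ∀ s ∈ Icc (0 : ℝ) 1, (extendPath (ψ q) s).2 = q.2.2 := by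
    have h1 : ∀ s ∈ Icc (0 : ℝ) 1,
        HasDerivWithinAt (fun s => (extendPath (ψ q) s).2) 0 (Icc 0 1) s := fun s hs => by
      have h2 := (hasDerivWithinAt_extendPath hq hs).hasFDerivWithinAt.snd.hasDerivWithinAt
      refine h2.congr_deriv ?_
      simp only [extendPath]
      simp [familyField]
    intro s hs
    have h3 := constant_of_derivWithin_zero (f := fun s => (extendPath (ψ q) s).2)
      (fun s hs => (h1 s hs).differentiableWithinAt) (fun s hs =>
        (h1 s ⟨hs.1, hs.2.le⟩).derivWithin (uniqueDiffOn_Icc zero_lt_one s ⟨hs.1, hs.2.le⟩)) s hs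
    rw [h3, extendPath_zero hq]
  have h4 := (hasDerivWithinAt_unscale hT hq ht).hasFDerivWithinAt.fst.hasDerivWithinAt
  refine h4.congr_deriv ?_
  rw [← hpar (t / q.1) ⟨div_nonneg ht.1 hT.le, (div_le_one hT).2 ht.2⟩]
  simp [familyField]

end FamilyFlow

/-- Solutions of the family near a reference solution exist on the same time interval and stay
close to it. -/
theorem eventually_exists_solution (hf : ContDiff ℝ 1 (uncurry₃ f))
    (hg : ContDiff ℝ 1 (uncurry₃ g)) {T : ℝ} {γ : ℝ → ℝ × ℝ} {α₀ : Fin m → ℝ} (hT : 0 < T)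
    (hγ : ∀ t ∈ Icc 0 T, HasDerivWithinAt γ (upperField f g α₀ (γ t)) (Icc 0 T) t) {ε : ℝ}
    (hε : 0 < ε) : ∀ᶠ q : (ℝ × ℝ) × (Fin m → ℝ) in 𝓝 (γ 0, α₀), ∃ u : ℝ → ℝ × ℝ, u 0 = q.1 ∧
      (∀ t ∈ Icc 0 T, HasDerivWithinAt u (upperField f g q.2 (u t)) (Icc 0 T) t) ∧
      ∀ t ∈ Icc 0 T, dist (u t) (γ t) < ε := by
  obtain ⟨ψ, h⟩ := exists_familyFlow (k := 1) one_ne_zero (by exact_mod_cast hf)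
    (by exact_mod_cast hg) hT.le hγ
  have hq : Tendsto (fun q : (ℝ × ℝ) × (Fin m → ℝ) => (T, q)) (𝓝 (γ 0, α₀))
      (𝓝 (T, (γ 0, α₀))) := (Continuous.prodMk_right T).tendsto _
  filter_upwards [hq.eventually (h.eventually_close hε), hq.eventually
    (h.eventually_solves (by exact_mod_cast hf) (by exact_mod_cast hg))]
    with q hclose ⟨h0, hsol⟩
  refine ⟨fun t => (extendPath (ψ (T, q)) (t / T)).1, ?_, hsol hT, fun t ht => ?_⟩
  · simp only [zero_div]; rw [h0]
  · have hs : t / T ∈ Icc (0 : ℝ) 1 := ⟨div_nonneg ht.1 hT.le, (div_le_one hT).2 ht.2⟩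
    have := hclose ⟨t / T, hs⟩
    rw [mul_div_cancel₀ _ hT.ne'] at this
    change dist (extendPath (ψ (T, q)) (t / T)).1 _ < _
    rwa [extendPath, projIcc_of_mem zero_le_one hs]

/-- A solution can be continued beyond the end of its interval of definition. -/
theorem exists_extension (hf : ContDiff ℝ 1 (uncurry₃ f)) (hg : ContDiff ℝ 1 (uncurry₃ g))
    {T : ℝ} {γ : ℝ → ℝ × ℝ} {α₀ : Fin m → ℝ} (hT : 0 < T)
    (hγ : ∀ t ∈ Icc 0 T, HasDerivWithinAt γ (upperField f g α₀ (γ t)) (Icc 0 T) t) :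
    ∃ T' > T, ∃ γ' : ℝ → ℝ × ℝ, EqOn γ' γ (Icc 0 T) ∧
      ∀ t ∈ Icc 0 T', HasDerivWithinAt γ' (upperField f g α₀ (γ' t)) (Icc 0 T') t := by
  obtain ⟨ψ, h⟩ := exists_familyFlow (k := 1) one_ne_zero (by exact_mod_cast hf)
    (by exact_mod_cast hg) hT.le hγ
  have hq : Tendsto (fun T' : ℝ => (T', (γ 0, α₀))) (𝓝[>] T) (𝓝 (T, (γ 0, α₀))) :=
    ((Continuous.prodMk_left (γ 0, α₀)).tendsto T).mono_left nhdsWithin_le_nhds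
  obtain ⟨T', ⟨h0, hsol⟩, hT'⟩ := ((hq.eventually (h.eventually_solves
    (by exact_mod_cast hf) (by exact_mod_cast hg))).and self_mem_nhdsWithin).exists
  have hsol' := hsol (hT.trans hT')
  refine ⟨T', hT', _, ?_, hsol'⟩
  refine (contDiff_upperField hf hg α₀).eqOn_of_hasDerivWithinAt (fun t ht => ?_) hγ ?_
  · exact (hsol' t ⟨ht.1, ht.2.trans hT'.le⟩).mono (Icc_subset_Icc_right hT'.le)
  · simp only [zero_div]; rw [h0]

end FamilyFlow

/-! ### The hitting map and its derivative. -/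

section HittingMap

open unitInterval

variable {m : ℕ} {f g : ℝ → ℝ → (Fin m → ℝ) → ℝ}

/-- An upper orbit that leaves `Σ` at a visible fold `(-a, 0)` and returns to it transversally in
`(a, 0)`. -/
structure FoldLoop (k : ℕ) (f g : ℝ → ℝ → (Fin m → ℝ) → ℝ) (a τ₀ : ℝ) (γ₀ : ℝ → ℝ × ℝ) : Prop where
  contDiff_f : ContDiff ℝ k (uncurry₃ f)
  contDiff_g : ContDiff ℝ k (uncurry₃ g)
  pos : 0 < a
  time_pos : 0 < τ₀
  deriv : ∀ t ∈ Icc 0 τ₀, HasDerivWithinAt γ₀ (upperField f g 0 (γ₀ t)) (Icc 0 τ₀) t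
  arc_start : γ₀ 0 = (-a, 0)
  arc_end : γ₀ τ₀ = (a, 0)
  arc_pos : ∀ t ∈ Ioo 0 τ₀, 0 < (γ₀ t).2
  fold : g (-a) 0 0 = 0
  visible : 0 < f (-a) 0 0 * partialX g (-a, 0) 0
  regular : g a 0 0 < 0

/-- The first-return map `P` of the upper subsystems near the arc, with the return time `τ` and the
orbits `φ`. -/
structure HittingMap (k : ℕ) (f g : ℝ → ℝ → (Fin m → ℝ) → ℝ) (a τ₀ : ℝ) (γ₀ : ℝ → ℝ × ℝ)
    (τ P : ℝ × (Fin m → ℝ) → ℝ) (φ : ℝ × (Fin m → ℝ) → ℝ → ℝ × ℝ) : Prop where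
  time_continuousAt : ContinuousAt τ (-a, 0)
  time_base : τ (-a, 0) = τ₀
  contDiffAt : ContDiffAt ℝ k P (-a, 0)
  base : P (-a, 0) = a
  fderiv_eq : ∀ d : ℝ × (Fin m → ℝ), fderiv ℝ P (-a, 0) d =
    -((∑ i, kappaCoeff f g γ₀ τ₀ i * d.2 i) / g a 0 0)
  solves : ∀ᶠ z in 𝓝 ((-a, 0) : ℝ × (Fin m → ℝ)), φ z 0 = (z.1, 0) ∧ φ z (τ z) = (P z, 0) ∧
    ∀ t ∈ Icc 0 (τ z), HasDerivWithinAt (φ z) (upperField f g z.2 (φ z t)) (Icc 0 (τ z)) t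
  close : ∀ ε > 0, ∀ᶠ z in 𝓝 ((-a, 0) : ℝ × (Fin m → ℝ)), ∀ s ∈ Icc (0 : ℝ) 1,
    dist (φ z (τ z * s)) (γ₀ (τ₀ * s)) < ε

/-- The arc meets Σ transversally at `(a, 0)`, so the hitting time is an implicit C^k function. The
derivative of the hitting point comes from the Melnikov identity applied to the total variation of
the orbit. -/
theorem FoldLoop.exists_hittingMap {k : ℕ} (hk : k ≠ 0) {a τ₀ : ℝ} {γ₀ : ℝ → ℝ × ℝ}
    (L : FoldLoop k f g a τ₀ γ₀) : ∃ τ P φ, HittingMap k f g a τ₀ γ₀ τ P φ := by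
  have hf := L.contDiff_f
  have hg := L.contDiff_g
  have hk1 : (1 : WithTop ℕ∞) ≤ ((k : ℕ∞) : WithTop ℕ∞) := by
    exact_mod_cast Nat.one_le_iff_ne_zero.2 hk
  have hk' : ((k : ℕ∞) : WithTop ℕ∞) ≠ 0 := by exact_mod_cast hk
  have hF := contDiff_familyField (hf.of_le hk1) (hg.of_le hk1)
  obtain ⟨ψ, h⟩ := exists_familyFlow hk hf hg L.time_pos.le L.deriv
  have hψ := h.contDiffAt
  have hψ1 := hψ.differentiableAt hk'
  have hbase := h.apply_base
  have hsolves := h.eventually_solves hf hg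
  have hclose := fun ε (hε : (0 : ℝ) < ε) => h.eventually_close hε
  set q₀ : ℝ × ((ℝ × ℝ) × (Fin m → ℝ)) := (τ₀, (γ₀ 0, 0)) with hq₀
  let F : C((ℝ × ℝ) × (Fin m → ℝ), (ℝ × ℝ) × (Fin m → ℝ)) := ⟨familyField f g, hF.continuous⟩
  let D : C((ℝ × ℝ) × (Fin m → ℝ), (ℝ × ℝ) × (Fin m → ℝ) →L[ℝ] (ℝ × ℝ) × (Fin m → ℝ)) :=
    ⟨fderiv ℝ F, hF.continuous_fderiv one_ne_zero⟩
  have hD : ∀ x, HasFDerivAt F (D x) x := fun x =>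
    (hF.differentiable one_ne_zero x).hasFDerivAt
  have heq := h.integral_eq F rfl
  have hend : ψ q₀ 1 = ((a, 0), 0) := by rw [hbase]; simp [L.arc_end]
  let ι : (ℝ × (Fin m → ℝ)) × ℝ →L[ℝ] ℝ × ((ℝ × ℝ) × (Fin m → ℝ)) :=
    (ContinuousLinearMap.snd ℝ _ _).prod
      ((((ContinuousLinearMap.fst ℝ ℝ (Fin m → ℝ)).prod 0).prod
        (ContinuousLinearMap.snd ℝ ℝ (Fin m → ℝ))) ∘L ContinuousLinearMap.fst ℝ _ _)
  have hι : ∀ z T, ι (z, T) = (T, ((z.1, 0), z.2)) := fun z T => rfl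
  have hι₀ : ι ((-a, 0), τ₀) = q₀ := by rw [hι, hq₀, L.arc_start]
  let ev : C(I, (ℝ × ℝ) × (Fin m → ℝ)) →L[ℝ] (ℝ × ℝ) × (Fin m → ℝ) :=
    ContinuousMap.evalCLM ℝ 1
  let y : (ℝ × ℝ) × (Fin m → ℝ) →L[ℝ] ℝ :=
    ContinuousLinearMap.snd ℝ ℝ ℝ ∘L ContinuousLinearMap.fst ℝ _ _
  let x : (ℝ × ℝ) × (Fin m → ℝ) →L[ℝ] ℝ :=
    ContinuousLinearMap.fst ℝ ℝ ℝ ∘L ContinuousLinearMap.fst ℝ _ _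
  let H : (ℝ × (Fin m → ℝ)) × ℝ → ℝ := fun u => y (ev (ψ (ι u)))
  have hψι : ContDiffAt ℝ k ψ (ι ((-a, 0), τ₀)) := by rwa [hι₀]
  have hH : ContDiffAt ℝ k H ((-a, 0), τ₀) :=
    (y.contDiff.comp ev.contDiff).contDiffAt.comp _ (hψι.comp _ ι.contDiff.contDiffAt)
  have hdH : HasFDerivAt H (y ∘L ev ∘L fderiv ℝ ψ q₀ ∘L ι) ((-a, 0), τ₀) := by
    have h1 : HasFDerivAt ψ (fderiv ℝ ψ q₀) (ι ((-a, 0), τ₀)) := by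
      rw [hι₀]; exact hψ1.hasFDerivAt
    exact y.hasFDerivAt.comp _ (ev.hasFDerivAt.comp _ (h1.comp _ ι.hasFDerivAt))
  -- The derivative of the final height in the elapsed time is the normal velocity `g a 0 0`, which
  -- is nonzero.
  have hinv : (fderiv ℝ H ((-a, 0), τ₀) ∘L .inr ℝ (ℝ × (Fin m → ℝ)) ℝ).IsInvertible := by
    refine ⟨ContinuousLinearEquiv.unitsEquivAut ℝ (Units.mk0 (g a 0 0) L.regular.ne), ?_⟩
    ext1
    rw [hdH.fderiv]
    have h1 : ι (0, 1) = (1, 0) := rfl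
    have h2 := fderiv_flow_time hk D hD hψ heq
    rw [hend] at h2
    have h3 : y (ev (fderiv ℝ ψ q₀ (1, 0))) = g a 0 0 := by
      change y (fderiv ℝ ψ q₀ (1, 0) 1) = _
      rw [h2]; rfl
    simp only [ContinuousLinearMap.comp_apply, ContinuousLinearMap.inr_apply, h1, h3]
    simp
  set τ := hH.implicitFunction hk' hinv with hτ
  have hτ0 : τ (-a, 0) = τ₀ := hH.implicitFunction_apply_self hk' hinv
  have hτd : ContDiffAt ℝ k τ (-a, 0) := hH.contDiffAt_implicitFunction hk' hinv
  have hH0 : H ((-a, 0), τ₀) = 0 := by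
    change y (ψ (ι ((-a, 0), τ₀)) 1) = 0
    rw [hι₀, hend]; rfl
  have hHτ : ∀ᶠ z in 𝓝 (-a, 0), H (z, τ z) = 0 := by
    simpa only [hH0] using hH.eventually_apply_implicitFunction hk' hinv
  have hpair : ContDiffAt ℝ k (fun z => ι (z, τ z)) (-a, 0) :=
    ι.contDiff.contDiffAt.comp _ (contDiffAt_id.prodMk hτd)
  have hpair0 : ι ((-a, 0), τ (-a, 0)) = q₀ := by rw [hτ0, hι₀]
  have htend : Tendsto (fun z => ι (z, τ z)) (𝓝 (-a, 0)) (𝓝 q₀) := by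
    have := hpair.continuousAt.tendsto
    rwa [hpair0] at this
  let P : ℝ × (Fin m → ℝ) → ℝ := fun z => x (ev (ψ (ι (z, τ z))))
  have hψτ : ContDiffAt ℝ k ψ (ι ((-a, 0), τ (-a, 0))) := by rwa [hpair0]
  have hP : ContDiffAt ℝ k P (-a, 0) :=
    (x.contDiff.comp ev.contDiff).contDiffAt.comp _ (hψτ.comp (-a, 0) hpair)
  have hτpos : ∀ᶠ z in 𝓝 (-a, 0), 0 < τ z :=
    hτd.continuousAt.eventually (lt_mem_nhds (by rw [hτ0]; exact L.time_pos))
  refine ⟨τ, P, fun z t => (extendPath (ψ (ι (z, τ z))) (t / τ z)).1, hτd.continuousAt, hτ0, hP,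
    ?_, fun d => ?_, ?_, fun ε hε => ?_⟩
  · change x (ψ (ι ((-a, 0), τ (-a, 0))) 1) = a
    rw [hpair0, hend]; rfl
  -- `c` is the first-order change of the hitting time and `w` the resulting variation of the whole
  -- path, in unit time. Its end is horizontal because the hitting point stays on Σ.
  · set c := fderiv ℝ τ (-a, 0) d with hc
    set w := fderiv ℝ ψ q₀ (ι (d, c)) with hw
    have hdτ : HasFDerivAt (fun z => ι (z, τ z))
        (ι ∘L ((ContinuousLinearMap.id ℝ _).prod (fderiv ℝ τ (-a, 0)))) (-a, 0) :=
      ι.hasFDerivAt.comp _ ((hasFDerivAt_id _).prodMk (hτd.differentiableAt hk').hasFDerivAt)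
    have hdψ : HasFDerivAt (fun z => ψ (ι (z, τ z))) (fderiv ℝ ψ q₀ ∘L
        (ι ∘L ((ContinuousLinearMap.id ℝ _).prod (fderiv ℝ τ (-a, 0))))) (-a, 0) := by
      have h1 : HasFDerivAt ψ (fderiv ℝ ψ q₀) (ι ((-a, 0), τ (-a, 0))) := by
        rw [hpair0]; exact hψ1.hasFDerivAt
      exact HasFDerivAt.comp (g := ψ) (f := fun z => ι (z, τ z)) (-a, 0) h1 hdτ
    have hPw : fderiv ℝ P (-a, 0) d = x (w 1) := by
      have h1 : HasFDerivAt P _ (-a, 0) := x.hasFDerivAt.comp _ (ev.hasFDerivAt.comp _ hdψ)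
      rw [h1.fderiv]; rfl
    have hyw : y (w 1) = 0 := by
      have h1 : HasFDerivAt (fun z => H (z, τ z)) _ (-a, 0) :=
        y.hasFDerivAt.comp _ (ev.hasFDerivAt.comp _ hdψ)
      have h2 := h1.unique ((hasFDerivAt_const (0 : ℝ) _).congr_of_eventuallyEq hHτ)
      have h3 := congrArg (fun A => A d) h2
      exact h3
    have hweq := fderiv_flow_eq hk D hD hψ heq (ι (d, c))
    rw [← hw] at hweq
    set v : C(I, (ℝ × ℝ) × (Fin m → ℝ)) := (ι (d, c)).1 • F.comp (ψ q₀) +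
      q₀.1 • pointwiseApply I _ _ (D.comp (ψ q₀)) w with hv
    have hψs : ∀ s ∈ Icc (0 : ℝ) 1, extendPath (ψ q₀) s = (γ₀ (τ₀ * s), 0) := fun s hs => by
      rw [extendPath, projIcc_of_mem zero_le_one hs, hbase]
    have hvs : ∀ s, extendPath v s = c • familyField f g (extendPath (ψ q₀) s) +
        τ₀ • fderiv ℝ (familyField f g) (extendPath (ψ q₀) s) (extendPath w s) := fun s => rfl
    have hw2 : ∀ s ∈ Icc (0 : ℝ) 1, (extendPath w s).2 = d.2 := by
      have h1 : ∀ s ∈ Icc (0 : ℝ) 1,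
          HasDerivWithinAt (fun s => (extendPath w s).2) 0 (Icc 0 1) s := fun s hs => by
        have h2 := (hasDerivWithinAt_extendPath hweq hs).hasFDerivWithinAt.snd.hasDerivWithinAt
        refine h2.congr_deriv ?_
        rw [hvs, fderiv_familyField (hf.of_le hk1) (hg.of_le hk1)]
        simp [familyField]
      intro s hs
      have h3 := constant_of_derivWithin_zero (f := fun s => (extendPath w s).2)
        (fun s hs => (h1 s hs).differentiableWithinAt) (fun s hs =>
          (h1 s ⟨hs.1, hs.2.le⟩).derivWithin (uniqueDiffOn_Icc zero_lt_one s ⟨hs.1, hs.2.le⟩)) s hs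
      rw [h3, extendPath_zero hweq]
      rfl
    have hτ₀ := L.time_pos
    have hmaps : MapsTo (fun t => t / τ₀) (Icc 0 τ₀) (Icc 0 1) := fun s hs =>
      ⟨div_nonneg hs.1 hτ₀.le, (div_le_one hτ₀).2 hs.2⟩
    -- At the start the variation is `(d.1, 0)` and `g` vanishes at the fold, so the initial
    -- determinant is zero; this is why ∂P/∂x = 0. At the end only `-g a 0 0` times the horizontal
    -- variation is left. The rate `c / τ₀` accounts for the return to real time.
    have hmel := melnikov_identity hτ₀.le (hf.of_le hk1) (hg.of_le hk1) L.deriv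
      (w := fun t => (extendPath w (t / τ₀)).1) (c := c / τ₀) (e := d.2) fun t ht => by
        have h1 : HasDerivWithinAt (fun s : ℝ => s / τ₀) (1 / τ₀) (Icc 0 τ₀) t :=
          ((hasDerivAt_id t).div_const τ₀).hasDerivWithinAt
        have h2 := ((hasDerivWithinAt_extendPath hweq (hmaps ht)).scomp t h1
          hmaps).hasFDerivWithinAt.fst.hasDerivWithinAt
        have h3 : extendPath w (t / τ₀) = ((extendPath w (t / τ₀)).1, d.2) :=
          Prod.ext rfl (hw2 _ (hmaps ht))
        have h4 : ∀ A B : (ℝ × ℝ) × (Fin m → ℝ),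
            ((1 / τ₀) • (c • A + τ₀ • B)).1 = (c / τ₀) • A.1 + B.1 := fun A B => by
          rw [smul_add, smul_smul, smul_smul, one_div_mul_cancel hτ₀.ne', one_smul,
            one_div_mul_eq_div]
          rfl
        have h5 : ((1 / τ₀) • extendPath v (t / τ₀)).1 = (c / τ₀) • upperField f g 0 (γ₀ t) +
            (fderiv ℝ (uncurry₃ f) (γ₀ t, 0) (extendPath w (t / τ₀)),
              fderiv ℝ (uncurry₃ g) (γ₀ t, 0) (extendPath w (t / τ₀))) := by
          rw [hvs, hψs _ (hmaps ht), h4, mul_div_cancel₀ _ hτ₀.ne',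
            fderiv_familyField (hf.of_le hk1) (hg.of_le hk1)]
          rfl
        rw [h3] at h5
        refine h2.congr_deriv (Eq.trans ?_ h5)
        simp
    have hw0 : extendPath w 0 = ((d.1, 0), d.2) := extendPath_zero hweq
    have hw1 : extendPath w 1 = w 1 := extendPath_coe w 1
    simp only [div_self hτ₀.ne', zero_div, hw0, hw1, L.arc_start, L.arc_end, upperField, L.fold] at hmel
    have hga := L.regular.ne
    rw [hPw]
    change (w 1).1.2 = 0 at hyw
    rw [hyw] at hmel
    change (w 1).1.1 = _
    field_simp
    linarith
  · filter_upwards [htend.eventually hsolves, hτpos, hHτ] with z ⟨h1, h2⟩ h3 h4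
    refine ⟨?_, ?_, h2 h3⟩
    · simp only [zero_div]; rw [h1]; rfl
    · simp only [div_self h3.ne']
      have h5 : extendPath (ψ (ι (z, τ z))) 1 = ψ (ι (z, τ z)) 1 := extendPath_coe _ 1
      rw [h5]
      exact Prod.ext rfl h4
  · filter_upwards [htend.eventually (hclose ε hε), hτpos] with z h1 h2 s hs
    have h3 := h1 ⟨s, hs⟩
    simp only [mul_div_cancel_left₀ _ h2.ne']
    rwa [extendPath, projIcc_of_mem zero_le_one hs]

end HittingMap

/-! ### The fold position and the displacement function. -/

section Displacement

variable {m k : ℕ} {f g : ℝ → ℝ → (Fin m → ℝ) → ℝ} {a τ₀ : ℝ} {γ₀ : ℝ → ℝ × ℝ}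

/-- The position `(-r(α), 0)` of the fold of the upper subsystem. -/
structure FoldPosition (k : ℕ) (g : ℝ → ℝ → (Fin m → ℝ) → ℝ) (a : ℝ) (r : (Fin m → ℝ) → ℝ) :
    Prop where
  contDiffAt : ContDiffAt ℝ k r 0
  base : r 0 = a
  fold : ∀ᶠ α in 𝓝 0, g (-r α) 0 α = 0
  fderiv_eq : ∀ e, fderiv ℝ r 0 e =
    (∑ i, partialParam g i (-a, 0) 0 * e i) / partialX g (-a, 0) 0

theorem FoldLoop.exists_foldPosition (hk : k ≠ 0) (L : FoldLoop k f g a τ₀ γ₀) :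
    ∃ r, FoldPosition k g a r := by
  have hg := L.contDiff_g
  have hk' : ((k : ℕ∞) : WithTop ℕ∞) ≠ 0 := by exact_mod_cast hk
  have hgx : partialX g (-a, 0) 0 ≠ 0 := fun h => by
    have := L.visible
    rw [h, mul_zero] at this
    exact this.false
  have hgd : DifferentiableAt ℝ (uncurry₃ g) ((-a, 0), 0) := hg.differentiable hk' _
  let ι : (Fin m → ℝ) × ℝ →L[ℝ] (ℝ × ℝ) × (Fin m → ℝ) :=
    ((-ContinuousLinearMap.snd ℝ (Fin m → ℝ) ℝ).prod 0).prod (ContinuousLinearMap.fst ℝ _ _)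
  have hι : ∀ α x, ι (α, x) = ((-x, 0), α) := fun α x => rfl
  let H : (Fin m → ℝ) × ℝ → ℝ := fun u => uncurry₃ g (ι u)
  have hH : ContDiffAt ℝ k H (0, a) := (hg.comp ι.contDiff).contDiffAt
  have hdH : HasFDerivAt H (fderiv ℝ (uncurry₃ g) ((-a, 0), 0) ∘L ι) (0, a) :=
    HasFDerivAt.comp (g := uncurry₃ g) (f := ι) (0, a) hgd.hasFDerivAt ι.hasFDerivAt
  have hinv : (fderiv ℝ H (0, a) ∘L .inr ℝ (Fin m → ℝ) ℝ).IsInvertible := by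
    refine ⟨ContinuousLinearEquiv.unitsEquivAut ℝ (Units.mk0 _ (neg_ne_zero.2 hgx)), ?_⟩
    ext1
    rw [hdH.fderiv]
    simp only [ContinuousLinearMap.comp_apply, ContinuousLinearMap.inr_apply, hι,
      fderiv_uncurry₃ hgd]
    simp
  set r := hH.implicitFunction hk' hinv with hr
  have hr0 : r 0 = a := hH.implicitFunction_apply_self hk' hinv
  have hrd : ContDiffAt ℝ k r 0 := hH.contDiffAt_implicitFunction hk' hinv
  have hH0 : H (0, a) = 0 := L.fold
  have hHr : ∀ᶠ α in 𝓝 0, H (α, r α) = 0 := by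
    simpa only [hH0] using hH.eventually_apply_implicitFunction hk' hinv
  refine ⟨r, hrd, hr0, hHr, fun e => ?_⟩
  have h0 : HasFDerivAt H (fderiv ℝ (uncurry₃ g) ((-a, 0), 0) ∘L ι) (0, r 0) := by
    rw [hr0]; exact hdH
  have h1 := HasFDerivAt.comp (g := H) (f := fun α => (α, r α)) 0 h0
    ((hasFDerivAt_id 0).prodMk (hrd.differentiableAt hk').hasFDerivAt)
  have h2 := h1.unique ((hasFDerivAt_const (0 : ℝ) _).congr_of_eventuallyEq hHr)
  have h3 : fderiv ℝ (uncurry₃ g) ((-a, 0), 0) ((-fderiv ℝ r 0 e, 0), e) = 0 :=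
    congrArg (fun A => A e) h2
  rw [fderiv_uncurry₃ hgd] at h3
  rw [eq_div_iff hgx, Finset.sum_congr rfl fun i _ => mul_comm _ _]
  simp only at h3
  linarith

/-- A function of class `C²` differs from its linear part by a quadratic error. -/
theorem isBigO_sub_fderiv_of_contDiffAt {E F : Type*} [NormedAddCommGroup E] [NormedSpace ℝ E]
    [NormedAddCommGroup F] [NormedSpace ℝ F] {d : E → F} (hd : ContDiffAt ℝ 2 d 0) :
    (fun x => d x - d 0 - fderiv ℝ d 0 x) =O[𝓝 0] fun x => ‖x‖ ^ 2 := by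
  have h1 : ContDiffAt ℝ 1 (fderiv ℝ d) 0 := hd.fderiv_right (by norm_num)
  obtain ⟨C, hC⟩ := ((h1.differentiableAt one_ne_zero).isBigO_sub).bound
  have h2 : ∀ᶠ x in 𝓝 (0 : E), DifferentiableAt ℝ d x :=
    (hd.eventually (by simp)).mono fun x hx => hx.differentiableAt two_ne_zero
  obtain ⟨ρ, hρ, hball⟩ := Metric.eventually_nhds_iff.1 (hC.and h2)
  refine Asymptotics.IsBigO.of_bound (max C 0) ?_
  filter_upwards [Metric.ball_mem_nhds (0 : E) hρ] with x hx
  rw [mem_ball_zero_iff] at hx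
  have hin : ∀ z ∈ Metric.closedBall (0 : E) ‖x‖, dist z 0 < ρ := fun z hz =>
    (Metric.mem_closedBall.1 hz).trans_lt hx
  have h3 := (convex_closedBall (0 : E) ‖x‖).norm_image_sub_le_of_norm_hasFDerivWithin_le'
    (f := d) (f' := fderiv ℝ d) (φ := fderiv ℝ d 0) (C := max C 0 * ‖x‖) (x := 0) (y := x)
    (fun z hz => (hball (hin z hz)).2.hasFDerivAt.hasFDerivWithinAt) (fun z hz => by
      refine (hball (hin z hz)).1.trans ?_
      rw [sub_zero]
      exact mul_le_mul (le_max_left _ _) (by simpa using hz) (norm_nonneg _) (le_max_right _ _))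
    (Metric.mem_closedBall_self (norm_nonneg _)) (by simp)
  rw [sub_zero] at h3
  rw [norm_pow, norm_norm, pow_two, ← mul_assoc]
  exact h3

variable {τ P : ℝ × (Fin m → ℝ) → ℝ} {φ : ℝ × (Fin m → ℝ) → ℝ → ℝ × ℝ} {r : (Fin m → ℝ) → ℝ}

/-- The displacement between the fold of the lower subsystem and the point in which the orbit from
the fold of the upper subsystem meets `Σ`. -/
def displacement (P : ℝ × (Fin m → ℝ) → ℝ) (r : (Fin m → ℝ) → ℝ) (α : Fin m → ℝ) : ℝ :=
  P (-r α, α) - r α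

theorem contDiffAt_displacement (hP : HittingMap k f g a τ₀ γ₀ τ P φ) (hr : FoldPosition k g a r) :
    ContDiffAt ℝ k (displacement P r) 0 := by
  refine ContDiffAt.sub ?_ hr.contDiffAt
  have h : ContDiffAt ℝ k P (-r 0, 0) := by rw [hr.base]; exact hP.contDiffAt
  exact ContDiffAt.comp (g := P) (f := fun α => (-r α, α)) 0 h
    (hr.contDiffAt.neg.prodMk contDiffAt_id)

theorem displacement_zero (hP : HittingMap k f g a τ₀ γ₀ τ P φ) (hr : FoldPosition k g a r) :
    displacement P r 0 = 0 := by
  rw [displacement, hr.base, hP.base, sub_self]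

/-- As ∂P/∂x = 0 at the base point, the motion of the upper fold does not influence the hitting
point to first order. The two terms of θ stem from the parameter dependence of `P` and from the
target `r`. -/
theorem fderiv_displacement (hk : k ≠ 0) (hP : HittingMap k f g a τ₀ γ₀ τ P φ)
    (hr : FoldPosition k g a r) (e : Fin m → ℝ) :
    fderiv ℝ (displacement P r) 0 e = ∑ i, thetaCoeff f g γ₀ a τ₀ i * e i := by
  have hk' : ((k : ℕ∞) : WithTop ℕ∞) ≠ 0 := by exact_mod_cast hk
  have hdr := (hr.contDiffAt.differentiableAt hk').hasFDerivAt
  have h0 : HasFDerivAt P (fderiv ℝ P (-a, 0)) (-r 0, 0) := by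
    rw [hr.base]; exact (hP.contDiffAt.differentiableAt hk').hasFDerivAt
  have h1 := (HasFDerivAt.comp (g := P) (f := fun α => (-r α, α)) 0 h0
    (hdr.neg.prodMk (hasFDerivAt_id 0))).sub hdr
  have h2 : fderiv ℝ (displacement P r) 0 e =
      fderiv ℝ P (-a, 0) (-fderiv ℝ r 0 e, e) - fderiv ℝ r 0 e := by
    rw [show fderiv ℝ (displacement P r) 0 = _ from HasFDerivAt.fderiv h1]; rfl
  rw [h2, hP.fderiv_eq, hr.fderiv_eq]
  simp only [thetaCoeff, sub_mul, neg_mul, Finset.sum_sub_distrib, Finset.sum_neg_distrib,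
    div_mul_eq_mul_div, Finset.sum_div]

end Displacement

/-! ### Uniform estimates at the fold corner. -/

section Corner

variable {m k : ℕ} {f g : ℝ → ℝ → (Fin m → ℝ) → ℝ} {a τ₀ σ : ℝ} {γ₀ : ℝ → ℝ × ℝ}

/-- If `w` is almost tangential and `u` is not, a tangential convex combination gives `u` a small
weight `s`. Its horizontal component is then close to that of `w`, with a loss of at most `s * (2 *
c + B) ≤ c`. -/
theorem le_mul_of_mem_segment {σ c b B : ℝ} (hσ : |σ| = 1) {u w v : ℝ × ℝ} (hc : 0 < c)
    (hb : 0 < b) (hu2 : b ≤ u.2) (hu1 : |u.1| ≤ B) (hw1 : 2 * c ≤ σ * w.1)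
    (hw2 : (2 * c + B) * |w.2| ≤ c * b) (hv : v ∈ segment ℝ u w) (hv2 : v.2 = 0) :
    c ≤ σ * v.1 := by
  obtain ⟨s, t, hs, ht, hst, rfl⟩ := hv
  simp only [Prod.snd_add, Prod.smul_snd, smul_eq_mul, Prod.fst_add, Prod.smul_fst] at hv2 ⊢
  have hB : 0 ≤ B := (abs_nonneg _).trans hu1
  have h1 : s * b ≤ |w.2| := by
    have h2 : s * b ≤ s * u.2 := mul_le_mul_of_nonneg_left hu2 hs
    have h3 : -(t * w.2) ≤ t * |w.2| := by
      rw [← mul_neg]; exact mul_le_mul_of_nonneg_left (neg_le_abs _) ht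
    have h4 : t * |w.2| ≤ 1 * |w.2| := mul_le_mul_of_nonneg_right (by linarith) (abs_nonneg _)
    linarith
  have h2 : s * (2 * c + B) ≤ c := by
    have : (2 * c + B) * (s * b) ≤ c * b :=
      (mul_le_mul_of_nonneg_left h1 (by positivity)).trans hw2
    exact le_of_mul_le_mul_right (by linarith) hb
  have h3 : -B ≤ σ * u.1 := by
    have : |σ * u.1| ≤ B := by rw [abs_mul, hσ, one_mul]; exact hu1
    exact (abs_le.1 this).1
  have h4 : s * -B ≤ s * (σ * u.1) := mul_le_mul_of_nonneg_left h3 hs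
  have h5 : t * (2 * c) ≤ t * (σ * w.1) := mul_le_mul_of_nonneg_left hw1 ht
  obtain rfl : t = 1 - s := by linarith
  linarith

theorem FoldLoop.exists_foldCorner (hk : k ≠ 0) (L : FoldLoop k f g a τ₀ γ₀) (hσ : |σ| = 1)
    (hσf : 0 < σ * f (-a) 0 0) : ∃ δ > 0, ∃ c > 0, ∀ᶠ α in 𝓝 (0 : Fin m → ℝ), ∀ r, |r - a| ≤ δ →
      g (-r) 0 α = 0 → FoldCorner (upperField f g α) σ a r δ c := by
  have hk1 : (1 : WithTop ℕ∞) ≤ ((k : ℕ∞) : WithTop ℕ∞) := by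
    exact_mod_cast Nat.one_le_iff_ne_zero.2 hk
  have hf := L.contDiff_f.of_le hk1
  have hg := L.contDiff_g.of_le hk1
  have hgx : 0 < σ * partialX g (-a, 0) 0 := by
    have h1 := L.visible
    have h2 : σ * σ = 1 := by rw [← abs_mul_abs_self, hσ, one_mul]
    have h3 : 0 < (σ * f (-a) 0 0) * (σ * partialX g (-a, 0) 0) := by
      calc 0 < f (-a) 0 0 * partialX g (-a, 0) 0 := h1
        _ = (σ * σ) * (f (-a) 0 0 * partialX g (-a, 0) 0) := by rw [h2, one_mul]
        _ = _ := by ring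
    exact (mul_pos_iff_of_pos_left hσf).1 h3
  -- A quarter, because the drift is first required to exceed `2 * c` on a neighbourhood and the
  -- tangential combinations then lose up to `c`.
  set c := σ * f (-a) 0 0 / 4 with hc
  set b := -g a 0 0 / 2 with hb
  set B := |f a 0 0| + 1 with hB
  have hcp : 0 < c := by positivity
  have hbp : 0 < b := by have := L.regular; rw [hb]; linarith
  have hBp : 0 < B := by positivity
  let Ω := (ℝ × ℝ) × (Fin m → ℝ)
  have hneg : Continuous fun q : Ω => ((-q.1, q.2) : Ω) := by fun_prop
  have cf := hf.continuous
  have cg := hg.continuous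
  have e0 : ∀ h : ℝ → ℝ → (Fin m → ℝ) → ℝ, uncurry₃ h (-((-a, 0) : ℝ × ℝ), 0) = h a 0 0 :=
    fun h => by simp [uncurry₃]
  have h1 : ∀ᶠ q : Ω in 𝓝 ((-a, 0), 0), b < -uncurry₃ g (-q.1, q.2) :=
    (cg.comp hneg).neg.continuousAt.eventually (lt_mem_nhds (by
      have := L.regular
      change b < -uncurry₃ g (-((-a, 0) : ℝ × ℝ), 0)
      rw [e0, hb]; linarith))
  have h2 : ∀ᶠ q : Ω in 𝓝 ((-a, 0), 0), |uncurry₃ f (-q.1, q.2)| < B :=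
    (cf.comp hneg).abs.continuousAt.eventually (gt_mem_nhds (by
      change |uncurry₃ f (-((-a, 0) : ℝ × ℝ), 0)| < B
      rw [e0, hB]; linarith))
  have h3 : ∀ᶠ q : Ω in 𝓝 ((-a, 0), 0), 2 * c < σ * uncurry₃ f q :=
    (continuous_const.mul cf).continuousAt.eventually (lt_mem_nhds (by
      change 2 * c < σ * f (-a) 0 0
      rw [hc]; linarith))
  have h4 : ∀ᶠ q : Ω in 𝓝 ((-a, 0), 0), (2 * c + B) * |uncurry₃ g q| < c * b :=
    (continuous_const.mul cg.abs).continuousAt.eventually (gt_mem_nhds (by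
      change (2 * c + B) * |g (-a) 0 0| < c * b
      rw [L.fold, abs_zero, mul_zero]; positivity))
  have h5 : ∀ᶠ q : Ω in 𝓝 ((-a, 0), 0), 0 < σ * partialX g q.1 q.2 := by
    have hd := hg.differentiable one_ne_zero
    have e1 : (fun q : Ω => σ * partialX g q.1 q.2) =
        fun q : Ω => σ * fderiv ℝ (uncurry₃ g) q ((1, 0), 0) := funext fun q => by
      rw [partialX_eq (hd _)]
    have hcont : Continuous fun q : Ω => σ * partialX g q.1 q.2 := by
      rw [e1]
      exact continuous_const.mul ((hg.continuous_fderiv one_ne_zero).clm_apply continuous_const)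
    exact hcont.continuousAt.eventually (lt_mem_nhds hgx)
  obtain ⟨ρ, hρ, hball⟩ := Metric.eventually_nhds_iff.1 (h1.and (h2.and (h3.and (h4.and h5))))
  refine ⟨ρ / 2, by positivity, c, hcp, ?_⟩
  filter_upwards [Metric.ball_mem_nhds (0 : Fin m → ℝ) hρ] with α hα r hr hfold
  have hbox : ∀ p ∈ cornerBox a (ρ / 2), dist ((p, α) : Ω) ((-a, 0), 0) < ρ := fun p hp => by
    have hp1 : dist p.1 (-a) < ρ := by
      rw [Real.dist_eq, sub_neg_eq_add]; exact hp.1.trans_lt (by linarith)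
    have hp2 : dist p.2 0 < ρ := by rw [Real.dist_0_eq_abs]; exact hp.2.trans_lt (by linarith)
    exact max_lt (max_lt hp1 hp2) hα
  have hline : ∀ x, |x + a| ≤ ρ / 2 → (x, (0 : ℝ)) ∈ cornerBox a (ρ / 2) := fun x hx =>
    ⟨hx, by simp only [abs_zero]; positivity⟩
  -- Visibility makes `σ * g` strictly increasing along Σ, so its zero at `-r` separates crossing
  -- from sliding on the whole segment.
  have hmono : StrictMonoOn (fun x => σ * g x 0 α) (Icc (-a - ρ / 2) (-a + ρ / 2)) := by
    have hder : ∀ x, HasDerivAt (fun x => σ * g x 0 α) (σ * partialX g (x, 0) α) x := fun x => by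
      have h6 : DifferentiableAt ℝ (fun x => g x 0 α) x :=
        ((hg.differentiable one_ne_zero).comp (g := uncurry₃ g)
          (f := fun x : ℝ => (((x, 0), α) : Ω)) (by fun_prop)) x
      exact h6.hasDerivAt.const_mul σ
    refine strictMonoOn_of_hasDerivWithinAt_pos (convex_Icc _ _)
      (fun x _ => (hder x).continuousAt.continuousWithinAt)
      (fun x _ => (hder x).hasDerivWithinAt) fun x hx => ?_
    rw [interior_Icc] at hx
    exact (hball (hbox (x, 0) (hline x (abs_le.2 ⟨by linarith [hx.1], by linarith [hx.2]⟩)))).2.2.2.2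
  have hrI : -r ∈ Icc (-a - ρ / 2) (-a + ρ / 2) := by
    rw [abs_le] at hr; exact ⟨by linarith, by linarith⟩
  have hxI : ∀ x, |x + a| ≤ ρ / 2 → x ∈ Icc (-a - ρ / 2) (-a + ρ / 2) := fun x hx => by
    rw [abs_le] at hx; exact ⟨by linarith, by linarith⟩
  have hsign : ∀ x, |x + a| ≤ ρ / 2 → (-r < x → 0 < σ * g x 0 α) ∧ (x < -r → σ * g x 0 α < 0) :=
    fun x hx => by
      refine ⟨fun h => ?_, fun h => ?_⟩
      · simpa [hfold] using hmono hrI (hxI x hx) h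
      · simpa [hfold] using hmono (hxI x hx) hrI h
  exact
    { sign := hσ
      c_pos := hcp
      contDiff := contDiff_upperField hf hg α
      lower_pos := fun p hp => hbp.trans (hball (hbox p hp)).1
      drift := fun p hp => by
        have : 2 * c < σ * (upperField f g α p).1 := (hball (hbox p hp)).2.2.1
        linarith
      sliding := fun x hx v hv hv2 => by
        have h := hball (hbox (x, 0) (hline x hx))
        refine le_mul_of_mem_segment hσ hcp hbp (B := B) h.1.le ?_ h.2.2.1.le h.2.2.2.1.le hv hv2
        change |-uncurry₃ f (-(x, 0), α)| ≤ B
        rw [abs_neg]; exact h.2.1.le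
      crossing := fun x hx h => by
        change 0 < g x 0 α
        have hs := hsign x hx
        rcases eq_or_eq_neg_of_abs_eq hσ with h' | h' <;> rw [h'] at h hs
        · linarith [hs.1 (by linarith)]
        · linarith [hs.2 (by linarith)]
      attracting := fun x hx h => by
        change g x 0 α < 0
        have hs := hsign x hx
        rcases eq_or_eq_neg_of_abs_eq hσ with h' | h' <;> rw [h'] at h hs
        · linarith [hs.2 (by linarith)]
        · linarith [hs.1 (by linarith)]
      fold := hfold }

end Corner

/-! ### Upper orbits stay above Σ until they return. -/

section Lift

variable {m k : ℕ} {f g : ℝ → ℝ → (Fin m → ℝ) → ℝ} {a τ₀ σ : ℝ} {γ₀ : ℝ → ℝ × ℝ}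
  {τ P : ℝ × (Fin m → ℝ) → ℝ} {φ : ℝ × (Fin m → ℝ) → ℝ → ℝ × ℝ} {r : (Fin m → ℝ) → ℝ}

theorem secondLie_upperField (hg : ContDiff ℝ 1 (uncurry₃ g)) (α : Fin m → ℝ) (p : ℝ × ℝ) :
    secondLie (upperField f g α) p =
      fderiv ℝ (uncurry₃ g) (p, α) (upperField f g α p, 0) := by
  have h : HasFDerivAt (fun q : ℝ × ℝ => (q, α)) (.inl ℝ (ℝ × ℝ) (Fin m → ℝ)) p :=
    hasFDerivAt_prodMk_left p α
  have h1 := HasFDerivAt.comp (g := uncurry₃ g) (f := fun q : ℝ × ℝ => (q, α)) p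
    (hg.differentiable one_ne_zero (p, α)).hasFDerivAt h
  rw [secondLie, show fderiv ℝ (fun q => (upperField f g α q).2) p = _ from HasFDerivAt.fderiv h1]
  rfl

theorem FoldLoop.eventually_secondLie_pos (hk : k ≠ 0) (L : FoldLoop k f g a τ₀ γ₀) :
    ∀ᶠ q : (ℝ × ℝ) × (Fin m → ℝ) in 𝓝 ((-a, 0), 0), 0 < secondLie (upperField f g q.2) q.1 := by
  have hk1 : (1 : WithTop ℕ∞) ≤ ((k : ℕ∞) : WithTop ℕ∞) := by
    exact_mod_cast Nat.one_le_iff_ne_zero.2 hk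
  have hf := L.contDiff_f.of_le hk1
  have hg := L.contDiff_g.of_le hk1
  simp only [secondLie_upperField hg]
  have hcont : Continuous fun q : (ℝ × ℝ) × (Fin m → ℝ) =>
      fderiv ℝ (uncurry₃ g) (q.1, q.2) (upperField f g q.2 q.1, 0) :=
    (hg.continuous_fderiv one_ne_zero).clm_apply
      ((continuous_upperField hf hg).prodMk continuous_const)
  refine hcont.continuousAt.eventually (lt_mem_nhds ?_)
  simp only
  rw [fderiv_uncurry₃ (hg.differentiable one_ne_zero _)]
  simpa [upperField, L.fold] using L.visible

theorem FoldLoop.arc_nonneg (L : FoldLoop k f g a τ₀ γ₀) {t : ℝ} (ht : t ∈ Icc 0 τ₀) :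
    0 ≤ (γ₀ t).2 := by
  rcases ht.1.eq_or_lt with h | h
  · rw [← h, L.arc_start]
  rcases ht.2.eq_or_lt with h' | h'
  · rw [h', L.arc_end]
  · exact (L.arc_pos t ⟨h, h'⟩).le

theorem FoldLoop.continuousOn (L : FoldLoop k f g a τ₀ γ₀) : ContinuousOn γ₀ (Icc 0 τ₀) :=
  fun t ht => (L.deriv t ht).continuousWithinAt

/-- Near its two ends the arc is close to `Σ`, in between it is bounded away from `Σ`. -/
theorem FoldLoop.exists_split (L : FoldLoop k f g a τ₀ γ₀) {ρ : ℝ} (hρ : 0 < ρ) :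
    ∃ s₁ s₂ c : ℝ, 0 < s₁ ∧ s₁ < s₂ ∧ s₂ < 1 ∧ 0 < c ∧
      (∀ s ∈ Icc 0 s₁, dist (γ₀ (τ₀ * s)) (-a, 0) < ρ) ∧
      (∀ s ∈ Icc s₂ 1, dist (γ₀ (τ₀ * s)) (a, 0) < ρ) ∧
      ∀ s ∈ Icc s₁ s₂, c ≤ (γ₀ (τ₀ * s)).2 := by
  have hτ := L.time_pos
  have hmaps : MapsTo (fun s => τ₀ * s) (Icc (0 : ℝ) 1) (Icc 0 τ₀) := fun s hs =>
    ⟨mul_nonneg hτ.le hs.1, mul_le_of_le_one_right hτ.le hs.2⟩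
  have hc : ContinuousOn (fun s => γ₀ (τ₀ * s)) (Icc (0 : ℝ) 1) :=
    L.continuousOn.comp (by fun_prop) hmaps
  have h0 : ∀ᶠ s in 𝓝[Icc 0 1] (0 : ℝ), dist (γ₀ (τ₀ * s)) (-a, 0) < ρ :=
    (hc 0 (left_mem_Icc.2 zero_le_one)).eventually
      (p := fun q => dist q (-a, 0) < ρ) (by
      simp only [mul_zero, L.arc_start]; exact Metric.ball_mem_nhds _ hρ)
  have h1 : ∀ᶠ s in 𝓝[Icc 0 1] (1 : ℝ), dist (γ₀ (τ₀ * s)) (a, 0) < ρ :=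
    (hc 1 (right_mem_Icc.2 zero_le_one)).eventually
      (p := fun q => dist q (a, 0) < ρ) (by
      simp only [mul_one, L.arc_end]; exact Metric.ball_mem_nhds _ hρ)
  rw [eventually_nhdsWithin_iff, Metric.eventually_nhds_iff] at h0 h1
  obtain ⟨ρ₁, hρ₁, h0⟩ := h0
  obtain ⟨ρ₂, hρ₂, h1⟩ := h1
  set e := min (1 / 4) (min (ρ₁ / 2) (ρ₂ / 2)) with he
  have he0 : 0 < e := by positivity
  have he1 : e ≤ 1 / 4 := min_le_left _ _
  have he2 : e < ρ₁ := ((min_le_right _ _).trans (min_le_left _ _)).trans_lt (by linarith)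
  have he3 : e < ρ₂ := ((min_le_right _ _).trans (min_le_right _ _)).trans_lt (by linarith)
  have hsub : Icc e (1 - e) ⊆ Icc 0 1 := Icc_subset_Icc (by linarith) (by linarith)
  obtain ⟨s, hs, hmin⟩ := isCompact_Icc.exists_isMinOn (nonempty_Icc.2 (by linarith))
    (continuous_snd.comp_continuousOn (hc.mono hsub))
  refine ⟨e, 1 - e, (γ₀ (τ₀ * s)).2, he0, by linarith, by linarith, ?_, fun u hu => ?_,
    fun u hu => ?_, fun u hu => hmin hu⟩
  · refine L.arc_pos _ ⟨mul_pos hτ (by linarith [hs.1]), ?_⟩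
    calc τ₀ * s < τ₀ * 1 := mul_lt_mul_of_pos_left (by linarith [hs.2]) hτ
      _ = τ₀ := mul_one _
  · refine h0 ?_ ⟨hu.1, by linarith [hu.2]⟩
    rw [Real.dist_0_eq_abs, abs_of_nonneg hu.1]
    linarith [hu.2]
  · refine h1 ?_ ⟨by linarith [hu.1], hu.2⟩
    rw [Real.dist_eq, abs_sub_comm, abs_of_nonneg (by linarith [hu.2])]
    linarith [hu.1]

/-- A solution that starts on `Σ` with a nonnegative normal velocity, and along which the normal
velocity is increasing, enters the upper half plane. -/
theorem snd_pos_of_secondLie_pos (hf : ContDiff ℝ 1 (uncurry₃ f)) (hg : ContDiff ℝ 1 (uncurry₃ g))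
    {α : Fin m → ℝ} {u : ℝ → ℝ × ℝ} {T : ℝ}
    (hu : ∀ t ∈ Icc 0 T, HasDerivWithinAt u (upperField f g α (u t)) (Icc 0 T) t)
    (h0 : (u 0).2 = 0) (h0' : 0 ≤ (upperField f g α (u 0)).2)
    (hpos : ∀ t ∈ Icc 0 T, 0 < secondLie (upperField f g α) (u t)) {t : ℝ} (ht : t ∈ Ioc 0 T) :
    0 < (u t).2 := by
  have hcu : ContinuousOn u (Icc 0 T) := fun t ht => (hu t ht).continuousWithinAt
  have hder : ∀ t ∈ Icc 0 T, HasDerivWithinAt (fun t => (upperField f g α (u t)).2)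
      (secondLie (upperField f g α) (u t)) (Icc 0 T) t := fun t ht => by
    have h1 : DifferentiableAt ℝ (fun q => (upperField f g α q).2) (u t) :=
      (contDiff_snd.comp (contDiff_upperField hf hg α)).differentiable one_ne_zero _
    exact h1.hasFDerivAt.comp_hasDerivWithinAt t (hu t ht)
  have h1 : StrictMonoOn (fun t => (upperField f g α (u t)).2) (Icc 0 T) := by
    refine strictMonoOn_of_hasDerivWithinAt_pos (convex_Icc _ _)
      (fun t ht => (hder t ht).continuousWithinAt)
      (fun t ht => (hder t (interior_subset ht)).mono interior_subset)
      fun t ht => hpos t (interior_subset ht)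
  have h2 : StrictMonoOn (fun t => (u t).2) (Icc 0 T) := by
    refine strictMonoOn_of_hasDerivWithinAt_pos (convex_Icc _ _)
      (continuous_snd.comp_continuousOn hcu)
      (fun t ht => (hasDerivWithinAt_snd_comp (hu t (interior_subset ht))).mono interior_subset)
      fun t ht => ?_
    have ht' := interior_subset ht
    rw [interior_Icc] at ht
    exact h0'.trans_lt (h1 (left_mem_Icc.2 (ht'.1.trans ht'.2)) ht' ht.1)
  have hT : 0 ≤ T := ht.1.le.trans ht.2
  have := h2 (left_mem_Icc.2 hT) ⟨ht.1.le, ht.2⟩ ht.1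
  simpa only [h0] using this

/-- A solution that ends on `Σ` with negative normal velocity stays in the upper half plane. -/
theorem snd_pos_of_snd_neg {Z : ℝ × ℝ → ℝ × ℝ} {u : ℝ → ℝ × ℝ} {b T : ℝ}
    (hu : ∀ t ∈ Icc b T, HasDerivWithinAt u (Z (u t)) (Icc b T) t)
    (hneg : ∀ t ∈ Icc b T, (Z (u t)).2 < 0) (hT : (u T).2 = 0) {t : ℝ} (ht : t ∈ Ico b T) :
    0 < (u t).2 := by
  have h2 : StrictAntiOn (fun t => (u t).2) (Icc b T) := by
    refine strictAntiOn_of_hasDerivWithinAt_neg (convex_Icc _ _)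
      (fun t ht => (hasDerivWithinAt_snd_comp (hu t ht)).continuousWithinAt)
      (fun t ht => (hasDerivWithinAt_snd_comp (hu t (interior_subset ht))).mono interior_subset)
      fun t ht => hneg t (interior_subset ht)
  have := h2 ⟨ht.1, ht.2.le⟩ (right_mem_Icc.2 (ht.1.trans ht.2.le)) ht.2
  simpa only [hT] using this

/-- Closeness to the arc gives positivity in the middle only. Near the fold the height has a
positive second derivative and nonnegative initial slope; near `(a, 0)` it decreases to zero. -/
theorem HittingMap.eventually_lift_pos (hk : k ≠ 0) (L : FoldLoop k f g a τ₀ γ₀)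
    (hP : HittingMap k f g a τ₀ γ₀ τ P φ) :
    ∀ᶠ z in 𝓝 ((-a, 0) : ℝ × (Fin m → ℝ)), 0 ≤ g z.1 0 z.2 →
      ∀ t ∈ Ioo 0 (τ z), 0 < (φ z t).2 := by
  have hk1 : (1 : WithTop ℕ∞) ≤ ((k : ℕ∞) : WithTop ℕ∞) := by
    exact_mod_cast Nat.one_le_iff_ne_zero.2 hk
  have hf := L.contDiff_f.of_le hk1
  have hg := L.contDiff_g.of_le hk1
  obtain ⟨ρ₁, hρ₁, h1⟩ := Metric.eventually_nhds_iff.1 (L.eventually_secondLie_pos hk)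
  have hreg : ∀ᶠ q : (ℝ × ℝ) × (Fin m → ℝ) in 𝓝 ((a, 0), 0), uncurry₃ g q < 0 :=
    hg.continuous.continuousAt.eventually (gt_mem_nhds L.regular)
  obtain ⟨ρ₂, hρ₂, h2⟩ := Metric.eventually_nhds_iff.1 hreg
  set ρ := min ρ₁ ρ₂ / 2 with hρ
  have hρ0 : 0 < ρ := by positivity
  have hρ1 : 2 * ρ ≤ ρ₁ := by rw [hρ]; linarith [min_le_left ρ₁ ρ₂]
  have hρ2 : 2 * ρ ≤ ρ₂ := by rw [hρ]; linarith [min_le_right ρ₁ ρ₂]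
  obtain ⟨s₁, s₂, c, hs₁, hs12, hs₂, hc, hleft, hright, hmid⟩ := L.exists_split hρ0
  have hα : ∀ᶠ z in 𝓝 ((-a, 0) : ℝ × (Fin m → ℝ)), dist z.2 0 < 2 * ρ :=
    continuous_snd.continuousAt.eventually (Metric.ball_mem_nhds _ (by positivity))
  have hτ : ∀ᶠ z in 𝓝 ((-a, 0) : ℝ × (Fin m → ℝ)), 0 < τ z :=
    hP.time_continuousAt.eventually (lt_mem_nhds (by rw [hP.time_base]; exact L.time_pos))
  filter_upwards [hα, hτ, hP.solves, hP.close ρ hρ0, hP.close c hc]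
    with z hα hτ ⟨h0, hend, hsol⟩ hcl hclc hg0 t ht
  have hs : ∀ t ∈ Icc 0 (τ z), t / τ z ∈ Icc (0 : ℝ) 1 := fun t ht =>
    ⟨div_nonneg ht.1 hτ.le, (div_le_one hτ).2 ht.2⟩
  have hmul : ∀ t, τ z * (t / τ z) = t := fun t => mul_div_cancel₀ _ hτ.ne'
  rcases le_or_gt (t / τ z) s₁ with hts | hts
  · have hsub : Icc 0 t ⊆ Icc 0 (τ z) := Icc_subset_Icc_right ht.2.le
    refine snd_pos_of_secondLie_pos hf hg (u := φ z) (T := t)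
      (fun w hw => (hsol w (hsub hw)).mono hsub) (by rw [h0]) (by rw [h0]; exact hg0)
      (fun w hw => ?_) ⟨ht.1, le_rfl⟩
    have hws : w / τ z ≤ s₁ := (div_le_div_of_nonneg_right hw.2 hτ.le).trans hts
    have e1 := hcl _ (hs w (hsub hw))
    have e2 := hleft _ ⟨(hs w (hsub hw)).1, hws⟩
    rw [hmul] at e1
    refine h1 (y := (φ z w, z.2)) (max_lt ?_ (hα.trans_le hρ1))
    exact (dist_triangle _ _ _).trans_lt (by linarith)
  rcases lt_or_ge (t / τ z) s₂ with hts' | hts'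
  · have e1 := hclc _ (hs t (Ioo_subset_Icc_self ht))
    have e2 := hmid _ ⟨hts.le, hts'.le⟩
    rw [hmul] at e1
    have e3 := (le_max_right _ _).trans_lt e1
    rw [Real.dist_eq, abs_lt] at e3
    linarith [e3.1]
  · have hsub : Icc t (τ z) ⊆ Icc 0 (τ z) := Icc_subset_Icc_left ht.1.le
    refine snd_pos_of_snd_neg (u := φ z) (b := t)
      (fun w hw => (hsol w (hsub hw)).mono hsub) (fun w hw => ?_) (by rw [hend]) ⟨le_rfl, ht.2⟩
    have hws : s₂ ≤ w / τ z := hts'.trans (div_le_div_of_nonneg_right hw.1 hτ.le)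
    have e1 := hcl _ (hs w (hsub hw))
    have e2 := hright _ ⟨hws, (hs w (hsub hw)).2⟩
    rw [hmul] at e1
    refine h2 (y := (φ z w, z.2)) (max_lt ?_ (hα.trans_le hρ2))
    exact (dist_triangle _ _ _).trans_lt (by linarith)

end Lift

/-! ### Orbits that start near the loop. -/

section LoopExistence

variable {m k : ℕ} {f g : ℝ → ℝ → (Fin m → ℝ) → ℝ} {a τ₀ σ : ℝ} {γ₀ : ℝ → ℝ × ℝ}
  {τ P : ℝ × (Fin m → ℝ) → ℝ} {φ : ℝ × (Fin m → ℝ) → ℝ → ℝ × ℝ} {r : (Fin m → ℝ) → ℝ}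

/-- The arc is continued slightly below Σ, so that orbits close to it are forced to cross Σ. -/
theorem FoldLoop.exists_extension (hk : k ≠ 0) (L : FoldLoop k f g a τ₀ γ₀) {ρ : ℝ} (hρ : 0 < ρ) :
    ∃ T₁ > τ₀, ∃ γ₁ : ℝ → ℝ × ℝ, EqOn γ₁ γ₀ (Icc 0 τ₀) ∧
      (∀ t ∈ Icc 0 T₁, HasDerivWithinAt γ₁ (upperField f g 0 (γ₁ t)) (Icc 0 T₁) t) ∧
      (γ₁ T₁).2 < 0 ∧ ∀ t ∈ Icc τ₀ T₁, dist (γ₁ t) (a, 0) < ρ := by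
  have hk1 : (1 : WithTop ℕ∞) ≤ ((k : ℕ∞) : WithTop ℕ∞) := by
    exact_mod_cast Nat.one_le_iff_ne_zero.2 hk
  have hf := L.contDiff_f.of_le hk1
  have hg := L.contDiff_g.of_le hk1
  have hτ := L.time_pos
  obtain ⟨T', hT', γ₁, heq, hsol⟩ := _root_.exists_extension hf hg hτ L.deriv
  have hreg : ∀ᶠ p : ℝ × ℝ in 𝓝 (a, 0), (upperField f g 0 p).2 < 0 :=
    (contDiff_upperField hf hg 0).continuous.snd.continuousAt.eventually (gt_mem_nhds L.regular)
  have hbase : γ₁ τ₀ = (a, 0) := by rw [heq (right_mem_Icc.2 hτ.le), L.arc_end]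
  have hcont : ContinuousAt γ₁ τ₀ :=
    ((hsol τ₀ ⟨hτ.le, hT'.le⟩).hasDerivAt (Icc_mem_nhds hτ hT')).continuousAt
  have hev : ∀ᶠ t in 𝓝 τ₀, (upperField f g 0 (γ₁ t)).2 < 0 ∧ dist (γ₁ t) (a, 0) < ρ := by
    refine hcont.eventually (p := fun p => (upperField f g 0 p).2 < 0 ∧ dist p (a, 0) < ρ) ?_
    rw [hbase]
    exact hreg.and (Metric.ball_mem_nhds _ hρ)
  obtain ⟨e, he, hball⟩ := Metric.eventually_nhds_iff.1 hev
  set T₁ := τ₀ + min (e / 2) (T' - τ₀) with hT₁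
  have hmin : 0 < min (e / 2) (T' - τ₀) := lt_min (by linarith) (by linarith)
  have h1 : τ₀ < T₁ := by linarith
  have h2 : T₁ ≤ T' := by linarith [min_le_right (e / 2) (T' - τ₀)]
  have h3 : T₁ < τ₀ + e := by linarith [min_le_left (e / 2) (T' - τ₀)]
  have hsol' : ∀ t ∈ Icc 0 T₁, HasDerivWithinAt γ₁ (upperField f g 0 (γ₁ t)) (Icc 0 T₁) t :=
    fun t ht => (hsol t ⟨ht.1, ht.2.trans h2⟩).mono (Icc_subset_Icc_right h2)
  have hnear : ∀ t ∈ Icc τ₀ T₁, dist t τ₀ < e := fun t ht => by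
    rw [Real.dist_eq, abs_of_nonneg (by linarith [ht.1])]; linarith [ht.2]
  refine ⟨T₁, h1, γ₁, heq, hsol', ?_, fun t ht => (hball (hnear t ht)).2⟩
  have hsub : Icc τ₀ T₁ ⊆ Icc 0 T₁ := Icc_subset_Icc_left hτ.le
  have hanti : StrictAntiOn (fun t => (γ₁ t).2) (Icc τ₀ T₁) := by
    refine strictAntiOn_of_hasDerivWithinAt_neg (convex_Icc _ _)
      (fun t ht => ((hasDerivWithinAt_snd_comp (hsol' t (hsub ht))).continuousWithinAt).mono hsub)
      (fun t ht => (hasDerivWithinAt_snd_comp (hsol' t (hsub (interior_subset ht)))).mono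
        (interior_subset.trans hsub))
      fun t ht => (hball (hnear t (interior_subset ht))).1
  have := hanti (left_mem_Icc.2 h1.le) (right_mem_Icc.2 h1.le) h1
  simpa only [hbase] using this

/-- All upper orbits that start near the arc follow it to a neighbourhood of one of its two ends. -/
theorem FoldLoop.exists_entry (hk : k ≠ 0) (L : FoldLoop k f g a τ₀ γ₀) {ε : ℝ} (hε : 0 < ε)
    {V : Set (ℝ × ℝ)} (hV : IsOpen V) (hΓ : γ₀ '' Icc 0 τ₀ ⊆ V) :
    ∃ N ∈ 𝓝ˢ (γ₀ '' Icc 0 τ₀), ∃ M, ∀ᶠ α in 𝓝 (0 : Fin m → ℝ), ∀ p ∈ N, 0 ≤ p.2 →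
      ∃ (S : ℝ) (u : ℝ → ℝ × ℝ), 0 ≤ S ∧ u 0 = p ∧ S ≤ M ∧
        (∀ t ∈ Icc 0 S, HasDerivWithinAt u (upperField f g α (u t)) (Icc 0 S) t) ∧
        (∀ t ∈ Icc 0 S, u t ∈ V) ∧ (∀ t ∈ Ico 0 S, 0 < (u t).2) ∧ (u S).2 = 0 ∧
        (|(u S).1 + a| ≤ ε ∨ |-(u S).1 + a| ≤ ε) := by
  have hk1 : (1 : WithTop ℕ∞) ≤ ((k : ℕ∞) : WithTop ℕ∞) := by
    exact_mod_cast Nat.one_le_iff_ne_zero.2 hk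
  have hf := L.contDiff_f.of_le hk1
  have hg := L.contDiff_g.of_le hk1
  have hτ := L.time_pos
  have hK : IsCompact (γ₀ '' Icc 0 τ₀) := isCompact_Icc.image_of_continuousOn L.continuousOn
  obtain ⟨ρ, hρ, hthick⟩ := hK.exists_thickening_subset_open hV hΓ
  set ρ₀ := min ρ ε / 2 with hρ₀
  have hρ₀0 : 0 < ρ₀ := by positivity
  have hρ₀1 : 2 * ρ₀ ≤ ρ := by rw [hρ₀]; linarith [min_le_left ρ ε]
  have hρ₀2 : 2 * ρ₀ ≤ ε := by rw [hρ₀]; linarith [min_le_right ρ ε]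
  obtain ⟨s₁, s₂, c, hs₁, hs12, hs₂, hc, hleft, hright, hmid⟩ := L.exists_split hρ₀0
  obtain ⟨T₁, hT₁, γ₁, heq, hsol, hlast, htail⟩ := L.exists_extension hk hρ₀0
  -- Closeness `c` forbids zeros of the height in the middle of the arc, closeness `-(γ₁ T₁).2`
  -- forces the orbit to have reached Σ by the end, and `ρ₀` locates the hit near an end of the arc.
  set ρ' := min (min ρ₀ c) (-(γ₁ T₁).2) with hρ'
  have hρ'0 : 0 < ρ' := lt_min (lt_min hρ₀0 hc) (by linarith)
  have hρ'1 : ρ' ≤ ρ₀ := (min_le_left _ _).trans (min_le_left _ _)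
  have hρ'2 : ρ' ≤ c := (min_le_left _ _).trans (min_le_right _ _)
  have hρ'3 : ρ' ≤ -(γ₁ T₁).2 := min_le_right _ _
  let G : Set ((ℝ × ℝ) × (Fin m → ℝ)) := {q | 0 ≤ q.1.2 →
      ∃ (S : ℝ) (u : ℝ → ℝ × ℝ), 0 ≤ S ∧ u 0 = q.1 ∧ S ≤ T₁ ∧
        (∀ t ∈ Icc 0 S, HasDerivWithinAt u (upperField f g q.2 (u t)) (Icc 0 S) t) ∧
        (∀ t ∈ Icc 0 S, u t ∈ V) ∧ (∀ t ∈ Ico 0 S, 0 < (u t).2) ∧ (u S).2 = 0 ∧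
        (|(u S).1 + a| ≤ ε ∨ |-(u S).1 + a| ≤ ε)}
  have hG : G ∈ 𝓝ˢ ((γ₀ '' Icc 0 τ₀) ×ˢ {(0 : Fin m → ℝ)}) := by
    rw [mem_nhdsSet_iff_forall]
    rintro ⟨-, -⟩ ⟨⟨t₁, ht₁, rfl⟩, rfl⟩
    have hT : 0 < T₁ - t₁ := by linarith [ht₁.2]
    have hmaps : MapsTo (fun t => t₁ + t) (Icc 0 (T₁ - t₁)) (Icc 0 T₁) := fun t ht =>
      ⟨add_nonneg ht₁.1 ht.1, by linarith [ht.2]⟩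
    have hshift : ∀ t ∈ Icc 0 (T₁ - t₁), HasDerivWithinAt (fun t => γ₁ (t₁ + t))
        (upperField f g 0 (γ₁ (t₁ + t))) (Icc 0 (T₁ - t₁)) t := fun t ht => by
      have h1 : HasDerivWithinAt (fun t => t₁ + t) 1 (Icc 0 (T₁ - t₁)) t :=
        ((hasDerivAt_id t).const_add t₁).hasDerivWithinAt
      exact ((hsol _ (hmaps ht)).scomp t h1 hmaps).congr_deriv (one_smul _ _)
    have hev := eventually_exists_solution hf hg hT (γ := fun t => γ₁ (t₁ + t)) hshift hρ'0
    simp only [add_zero] at hev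
    rw [heq ht₁] at hev
    filter_upwards [hev] with ⟨p, α⟩ ⟨u, hu0, husol, hucl⟩ hp
    have hcu : ContinuousOn u (Icc 0 (T₁ - t₁)) := fun t ht => (husol t ht).continuousWithinAt
    have hfin : (u (T₁ - t₁)).2 ≤ 0 := by
      have h1 := (le_max_right _ _).trans_lt (hucl _ (right_mem_Icc.2 hT.le))
      rw [add_sub_cancel, Real.dist_eq, abs_lt] at h1
      linarith [h1.2]
    obtain ⟨S, hS, hS0, hSpos⟩ := exists_first_zero hT.le (continuous_snd.comp_continuousOn hcu)
      (by simpa only [Function.comp, hu0] using hp) hfin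
    have hsub : Icc 0 S ⊆ Icc 0 (T₁ - t₁) := Icc_subset_Icc_right hS.2
    have hfst : ∀ {b : ℝ}, dist (u S) (b, 0) < 2 * ρ₀ → |(u S).1 - b| ≤ ε := fun h => by
      have := (le_max_left _ _).trans_lt h
      rw [Real.dist_eq] at this
      linarith
    refine ⟨S, u, hS.1, hu0, by linarith [hS.2, ht₁.1],
      fun t ht => (husol t (hsub ht)).mono hsub, fun t ht => ?_, hSpos, hS0, ?_⟩
    · have hcl := hucl t (hsub ht)
      refine hthick (Metric.mem_thickening_iff.2 ?_)
      rcases le_or_gt (t₁ + t) τ₀ with h | h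
      · have hmem : t₁ + t ∈ Icc 0 τ₀ := ⟨add_nonneg ht₁.1 ht.1, h⟩
        refine ⟨_, mem_image_of_mem _ hmem, ?_⟩
        rw [← heq hmem]
        linarith
      · refine ⟨(a, 0), ⟨τ₀, right_mem_Icc.2 hτ.le, L.arc_end⟩, ?_⟩
        have h1 := htail _ ⟨h.le, (hmaps (hsub ht)).2⟩
        exact (dist_triangle _ _ _).trans_lt (by linarith)
    · have hcl := hucl S hS
      rcases le_or_gt (t₁ + S) τ₀ with h | h
      · have hmem : t₁ + S ∈ Icc 0 τ₀ := ⟨add_nonneg ht₁.1 hS.1, h⟩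
        have hs : (t₁ + S) / τ₀ ∈ Icc (0 : ℝ) 1 :=
          ⟨div_nonneg hmem.1 hτ.le, (div_le_one hτ).2 h⟩
        have hmul : τ₀ * ((t₁ + S) / τ₀) = t₁ + S := mul_div_cancel₀ _ hτ.ne'
        rw [heq hmem] at hcl
        rcases le_or_gt ((t₁ + S) / τ₀) s₁ with h' | h'
        · left
          have h1 := hleft _ ⟨hs.1, h'⟩
          rw [hmul] at h1
          simpa using hfst (b := -a) ((dist_triangle _ _ _).trans_lt (by linarith))
        rcases le_or_gt ((t₁ + S) / τ₀) s₂ with h'' | h''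
        · have h1 := hmid _ ⟨h'.le, h''⟩
          rw [hmul] at h1
          have h2 := (le_max_right _ _).trans_lt hcl
          simp only [Function.comp] at hS0
          rw [Real.dist_eq, hS0, abs_lt] at h2
          linarith [h2.1]
        · right
          have h1 := hright _ ⟨h''.le, hs.2⟩
          rw [hmul] at h1
          have := hfst (b := a) ((dist_triangle _ _ _).trans_lt (by linarith))
          rwa [neg_add_eq_sub, abs_sub_comm]
      · right
        have h1 := htail _ ⟨h.le, (hmaps hS).2⟩
        have := hfst (b := a) ((dist_triangle _ _ _).trans_lt (by linarith))
        rwa [neg_add_eq_sub, abs_sub_comm]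
  -- By compactness of the arc, the pointwise neighbourhoods yield one neighbourhood of the arc that
  -- serves for all small parameters.
  rw [hK.nhdsSet_prod_eq isCompact_singleton, nhdsSet_singleton, mem_prod_iff] at hG
  obtain ⟨N, hN, U, hU, hNU⟩ := hG
  refine ⟨N, hN, T₁, ?_⟩
  filter_upwards [hU] with α hα p hp
  exact hNU (mk_mem_prod hp hα)

theorem FoldLoop.isCompact_arc (L : FoldLoop k f g a τ₀ γ₀) : IsCompact (γ₀ '' Icc 0 τ₀) :=
  isCompact_Icc.image_of_continuousOn L.continuousOn

/-- A neighbourhood of the arc yields a symmetric neighbourhood of the loop whose upper half is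
contained in the given one. -/
theorem FoldLoop.symmetrize_mem (L : FoldLoop k f g a τ₀ γ₀) {N : Set (ℝ × ℝ)}
    (hN : N ∈ 𝓝ˢ (γ₀ '' Icc 0 τ₀)) :
    {p : ℝ × ℝ | (0 ≤ p.2 → p ∈ N) ∧ (p.2 ≤ 0 → -p ∈ N)} ∈ 𝓝ˢ (symmetricLoop γ₀ τ₀) := by
  have harc : ∀ t ∈ Icc 0 τ₀,
      {p : ℝ × ℝ | (0 ≤ p.2 → p ∈ N) ∧ (p.2 ≤ 0 → -p ∈ N)} ∈ 𝓝 (γ₀ t) := fun t ht => by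
    have h1 : N ∈ 𝓝 (γ₀ t) := mem_nhdsSet_iff_forall.1 hN _ (mem_image_of_mem _ ht)
    rcases (L.arc_nonneg ht).eq_or_lt with h | h
    · have h2 : N ∈ 𝓝 (-γ₀ t) := by
        have h3 : t = 0 ∨ t = τ₀ := by
          by_contra! hcon
          exact (L.arc_pos t ⟨ht.1.lt_of_ne' hcon.1, ht.2.lt_of_ne hcon.2⟩).ne h
        rcases h3 with rfl | rfl
        · have := mem_nhdsSet_iff_forall.1 hN _ (mem_image_of_mem γ₀ (right_mem_Icc.2 L.time_pos.le))
          rw [L.arc_start]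
          simpa [L.arc_end] using this
        · have := mem_nhdsSet_iff_forall.1 hN _ (mem_image_of_mem γ₀ (left_mem_Icc.2 L.time_pos.le))
          rw [L.arc_end]
          simpa [L.arc_start] using this
      filter_upwards [h1, continuous_neg.continuousAt.eventually h2] with p hp hp'
      exact ⟨fun _ => hp, fun _ => hp'⟩
    · filter_upwards [h1, continuous_snd.continuousAt.eventually (lt_mem_nhds h)] with p hp hp'
      exact ⟨fun _ => hp, fun h => absurd hp' (not_lt.2 h)⟩
  rw [mem_nhdsSet_iff_forall]
  rintro q (⟨t, ht, rfl⟩ | ⟨t, ht, rfl⟩)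
  · exact harc t ht
  · have h := harc t ht
    rw [← neg_neg (γ₀ t)] at h
    filter_upwards [continuous_neg.continuousAt.eventually h] with p ⟨hp1, hp2⟩
    refine ⟨fun h => ?_, fun h => hp1 (by simpa using h)⟩
    simpa using hp2 (by simpa using h)

/-- ∂P/∂x is continuous and vanishes at the base point; this is the source of the contraction. -/
theorem HittingMap.eventually_deriv_le (hk : k ≠ 0) (hP : HittingMap k f g a τ₀ γ₀ τ P φ) :
    ∀ᶠ z in 𝓝 ((-a, 0) : ℝ × (Fin m → ℝ)),
      ∃ μ, HasDerivAt (fun x => P (x, z.2)) μ z.1 ∧ |μ| ≤ 1 / 2 := by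
  have hk1 : (1 : WithTop ℕ∞) ≤ ((k : ℕ∞) : WithTop ℕ∞) := by
    exact_mod_cast Nat.one_le_iff_ne_zero.2 hk
  have hP1 : ContDiffAt ℝ 1 P (-a, 0) := hP.contDiffAt.of_le hk1
  have h1 : ∀ᶠ z in 𝓝 ((-a, 0) : ℝ × (Fin m → ℝ)), DifferentiableAt ℝ P z :=
    (hP1.eventually (by simp)).mono fun z hz => hz.differentiableAt one_ne_zero
  have hc : ContinuousAt (fun z => |fderiv ℝ P z (1, 0)|) (-a, 0) :=
    ((hP1.continuousAt_fderiv one_ne_zero).clm_apply continuousAt_const).abs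
  have h2 : ∀ᶠ z in 𝓝 ((-a, 0) : ℝ × (Fin m → ℝ)), |fderiv ℝ P z (1, 0)| < 1 / 2 :=
    hc.eventually (gt_mem_nhds (by simp only [hP.fderiv_eq]; simp))
  filter_upwards [h1, h2] with z h1 h2
  exact ⟨_, h1.hasFDerivAt.comp_hasDerivAt z.1
    ((hasDerivAt_id z.1).prodMk (hasDerivAt_const z.1 z.2)), h2.le⟩

end LoopExistence

/-! ### Loop data for all small parameters. -/

section LoopData

variable {m k : ℕ} {f g : ℝ → ℝ → (Fin m → ℝ) → ℝ} {a τ₀ σ : ℝ} {γ₀ : ℝ → ℝ × ℝ}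
  {τ P : ℝ × (Fin m → ℝ) → ℝ} {φ : ℝ × (Fin m → ℝ) → ℝ → ℝ × ℝ} {r : (Fin m → ℝ) → ℝ}

theorem neg_mem_symmetricLoop {p : ℝ × ℝ} (h : p ∈ symmetricLoop γ₀ τ₀) :
    -p ∈ symmetricLoop γ₀ τ₀ := by
  rcases h with ⟨t, ht, rfl⟩ | ⟨t, ht, rfl⟩
  · exact Or.inr ⟨t, ht, rfl⟩
  · exact Or.inl ⟨t, ht, by simp⟩

/-- The order of quantifiers is essential: the neighbourhoods and all constants depend on `A` alone
and serve for every small α. Orbits that start in `W` are confined to `V`, hence to the interior of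
`A`. -/
theorem FoldLoop.exists_loopData (hk : k ≠ 0) (L : FoldLoop k f g a τ₀ γ₀)
    (hP : HittingMap k f g a τ₀ γ₀ τ P φ) (hr : FoldPosition k g a r) (hσ : |σ| = 1)
    (hσf : 0 < σ * f (-a) 0 0) {A : Set (ℝ × ℝ)} (hA : A ∈ 𝓝ˢ (symmetricLoop γ₀ τ₀)) :
    ∃ V ⊆ interior A, ∃ W ∈ 𝓝ˢ (symmetricLoop γ₀ τ₀), ∃ δ > 0, ∃ c ε M τmin : ℝ,
      ∀ᶠ α in 𝓝 (0 : Fin m → ℝ), LoopData (upperField f g α) σ a (r α) δ c ε M τmin V W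
        (fun x => φ (x, α)) (fun x => τ (x, α)) (fun x => -P (x, α)) := by
  have ha := L.pos
  have hτ := L.time_pos
  set V : Set (ℝ × ℝ) := {p | p ∈ interior A ∧ -p ∈ interior A} with hV
  have hVo : IsOpen V := isOpen_interior.inter (isOpen_interior.preimage continuous_neg)
  have hΓA : symmetricLoop γ₀ τ₀ ⊆ interior A := subset_interior_iff_mem_nhdsSet.2 hA
  have hΓV : symmetricLoop γ₀ τ₀ ⊆ V := fun p hp => ⟨hΓA hp, hΓA (neg_mem_symmetricLoop hp)⟩
  have harcV : γ₀ '' Icc 0 τ₀ ⊆ V := subset_union_left.trans hΓV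
  obtain ⟨ρV, hρV, hthick⟩ := L.isCompact_arc.exists_thickening_subset_open hVo harcV
  obtain ⟨δ, hδ, c, hc, hcorner⟩ := L.exists_foldCorner hk hσ hσf
  have hev1 : ∀ᶠ z in 𝓝 ((-a, 0) : ℝ × (Fin m → ℝ)), τ₀ / 2 < τ z ∧ τ z < 2 * τ₀ :=
    hP.time_continuousAt.eventually (p := fun y => τ₀ / 2 < y ∧ y < 2 * τ₀) (by
      rw [hP.time_base]; exact Ioo_mem_nhds (by linarith) (by linarith))
  have hev2 : ∀ᶠ z in 𝓝 ((-a, 0) : ℝ × (Fin m → ℝ)), (z.1, (0 : ℝ)) ∈ V := by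
    have h1 : Continuous fun z : ℝ × (Fin m → ℝ) => (z.1, (0 : ℝ)) := by fun_prop
    refine h1.continuousAt.eventually (hVo.mem_nhds (harcV ⟨0, left_mem_Icc.2 hτ.le, ?_⟩))
    exact L.arc_start
  obtain ⟨ρ, hρ, hball⟩ := Metric.eventually_nhds_iff.1 (hev1.and (hev2.and (hP.solves.and
    ((hP.eventually_lift_pos hk L).and ((hP.close ρV hρV).and (hP.eventually_deriv_le hk))))))
  set ε := min (ρ / 2) (min (δ / 2) (a / 2)) with hε
  have hε0 : 0 < ε := by positivity
  have hε1 : ε < ρ := (min_le_left _ _).trans_lt (by linarith)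
  have hε2 : ε < δ := ((min_le_right _ _).trans (min_le_left _ _)).trans_lt (by linarith)
  have hε3 : ε ≤ a / 2 := (min_le_right _ _).trans (min_le_right _ _)
  obtain ⟨N, hN, M, hentry⟩ := L.exists_entry hk hε0 hVo harcV
  refine ⟨V, fun p hp => hp.1, _, L.symmetrize_mem hN, δ, hδ, c, ε, max M (2 * τ₀), τ₀ / 2, ?_⟩
  have hrε : ∀ᶠ α in 𝓝 (0 : Fin m → ℝ), |r α - a| < ε :=
    hr.contDiffAt.continuousAt.eventually (p := fun y => |y - a| < ε) (by
      rw [hr.base]; exact Metric.ball_mem_nhds _ hε0)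
  -- With Lipschitz constant 1/2 this makes the base segment of radius `ε` map strictly into itself.
  have hPε : ∀ᶠ α in 𝓝 (0 : Fin m → ℝ), |P (-a, α) - a| < ε / 2 := by
    have h1 : ContinuousAt (fun α => P (-a, α)) 0 :=
      ContinuousAt.comp (g := P) (f := fun α => (-a, α)) hP.contDiffAt.continuousAt
        (Continuous.prodMk_right (-a)).continuousAt
    exact h1.eventually (p := fun y => |y - a| < ε / 2) (by
      simp only [hP.base]; exact Metric.ball_mem_nhds _ (by positivity))
  filter_upwards [hrε, hPε, hcorner, hentry, hr.fold, Metric.ball_mem_nhds (0 : Fin m → ℝ) hρ]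
    with α hrα hPα hcα heα hfold hα
  have hC : ∀ x, |x + a| ≤ ε → dist ((x, α) : ℝ × (Fin m → ℝ)) (-a, 0) < ρ := fun x hx => by
    refine max_lt ?_ hα
    change dist x (-a) < ρ
    rw [Real.dist_eq, sub_neg_eq_add]
    linarith
  have hcor : FoldCorner (upperField f g α) σ a (r α) δ c :=
    hcα (r α) (hrα.le.trans hε2.le) hfold
  have hself : |(-a) + a| ≤ ε := by simpa using hε0.le
  have hconv : Convex ℝ {x : ℝ | |x + a| ≤ ε} := by
    have : {x : ℝ | |x + a| ≤ ε} = Icc (-a - ε) (-a + ε) := by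
      ext x
      rw [mem_ofPred_eq, abs_le, mem_Icc]
      constructor <;> rintro ⟨h1, h2⟩ <;> constructor <;> linarith
    rw [this]; exact convex_Icc _ _
  have hderiv : ∀ x, |x + a| ≤ ε → ∃ μ, HasDerivAt (fun x => P (x, α)) μ x ∧ |μ| ≤ 1 / 2 :=
    fun x hx => (hball (hC x hx)).2.2.2.2.2
  have hlip : ∀ x y, |x + a| ≤ ε → |y + a| ≤ ε →
      |P (x, α) - P (y, α)| ≤ 1 / 2 * |x - y| := fun x y hx hy => by
    have hd : ∀ x ∈ {x : ℝ | |x + a| ≤ ε}, HasDerivWithinAt (fun x => P (x, α))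
        (_root_.deriv (fun x => P (x, α)) x) {x : ℝ | |x + a| ≤ ε} x ∧
        ‖_root_.deriv (fun x => P (x, α)) x‖ ≤ 1 / 2 := fun x hx => by
      obtain ⟨μ, h1, h2⟩ := hderiv x hx
      rw [h1.deriv]
      exact ⟨h1.hasDerivWithinAt, h2⟩
    exact hconv.norm_image_sub_le_of_norm_hasDerivWithin_le (fun x hx => (hd x hx).1)
      (fun x hx => (hd x hx).2) hy hx
  refine { hcor with
    eps_pos := hε0
    eps_lt := hε2
    eps_le := by linarith
    r_mem := hrα.le
    time_pos := by linarith
    time_ge := fun x hx => (hball (hC x hx)).1.1.le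
    time_le := fun x hx => (hball (hC x hx)).1.2.le.trans (le_max_right _ _)
    lift_zero := fun x hx => (hball (hC x hx)).2.2.1.1
    lift_deriv := fun x hx => (hball (hC x hx)).2.2.1.2.2
    lift_pos := fun x hx h => (hball (hC x hx)).2.2.2.1 ?_
    lift_end := fun x hx => by rw [neg_neg]; exact (hball (hC x hx)).2.2.1.2.1
    lift_mem := fun x hx t ht => ?_
    map_mem := fun x hx => ?_
    map_lip := fun x y hx hy => ?_
    map_diff := fun x hx => ?_
    base_mem := fun x hx => (hball (hC x hx)).2.1
    neg_mem_V := fun p hp => ⟨hp.2, by rw [neg_neg]; exact hp.1⟩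
    neg_mem_W := fun p hp => ⟨fun h => hp.2 (by simpa using h), fun h => ?_⟩
    entry := fun p hp hp0 => ?_ }
  · rcases h.eq_or_lt with h | h
    · have hσ0 : σ ≠ 0 := fun h0 => by rw [h0, abs_zero] at hσ; exact zero_ne_one hσ
      have hx' : x = -r α := by
        have := (mul_eq_zero.1 h.symm).resolve_left hσ0
        linarith
      rw [hx']
      exact hfold.ge
    · exact (hcor.crossing x (hx.trans hε2.le) h).le
  · obtain ⟨⟨hτ1, -⟩, -, -, -, hcl, -⟩ := hball (hC x hx)
    have hτx : 0 < τ (x, α) := by linarith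
    have hs : t / τ (x, α) ∈ Icc (0 : ℝ) 1 :=
      ⟨div_nonneg ht.1 hτx.le, (div_le_one hτx).2 ht.2⟩
    have h1 := hcl _ hs
    rw [mul_div_cancel₀ _ hτx.ne'] at h1
    exact hthick (Metric.mem_thickening_iff.2 ⟨_, mem_image_of_mem _
      ⟨mul_nonneg hτ.le hs.1, mul_le_of_le_one_right hτ.le hs.2⟩, h1⟩)
  · have h1 := hlip x (-a) hx hself
    rw [sub_neg_eq_add] at h1
    have h2 : |-P (x, α) + a| ≤ |P (x, α) - P (-a, α)| + |P (-a, α) - a| := by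
      rw [neg_add_eq_sub, abs_sub_comm]
      exact abs_sub_le _ _ _
    linarith
  · rw [neg_sub_neg, abs_sub_comm]
    exact hlip x y hx hy
  · obtain ⟨μ, h1, h2⟩ := hderiv x hx
    exact ⟨-μ, h1.neg, by rwa [abs_neg]⟩
  · rw [neg_neg]
    exact hp.1 (by simpa using h)
  · obtain ⟨S, u, h1, h2, h3, h4⟩ := heα p (hp.1 hp0) hp0
    exact ⟨S, u, h1, h2, h3.trans (le_max_left _ _), h4⟩

end LoopData

/-! ### Dynamics on the discontinuity boundary -/

section Switching

variable {Z : ℝ × ℝ → ℝ × ℝ}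

theorem centralField_neg (p : ℝ × ℝ) : centralField Z (-p) = -Z p := by
  rw [centralField, neg_neg]

theorem secondLie_centralField (hZ : Differentiable ℝ Z) (p : ℝ × ℝ) :
    secondLie (centralField Z) (-p) = -secondLie Z p := by
  have h1 : HasFDerivAt (fun q => (Z q).2) (fderiv ℝ (fun q => (Z q).2) p) (- -p) := by
    rw [neg_neg]; exact (hZ.snd p).hasFDerivAt
  have h2 := (HasFDerivAt.comp (g := fun q => (Z q).2) (f := fun q : ℝ × ℝ => -q) (-p) h1
    (hasFDerivAt_id (-p)).neg).neg
  rw [secondLie, centralField_neg,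
    show fderiv ℝ (fun q => (centralField Z q).2) (-p) = _ from HasFDerivAt.fderiv h2]
  simp [secondLie]

theorem slidingField_neg {p : ℝ × ℝ} (h : (Z p).2 ≠ (centralField Z p).2) :
    slidingField Z (centralField Z) (-p) = -slidingField Z (centralField Z) p := by
  have e1 : Z (-p) = -centralField Z p := by rw [centralField, neg_neg]
  have h1 : (Z p).2 - (centralField Z p).2 ≠ 0 := sub_ne_zero.2 h
  have h2 : (-centralField Z p).2 - (-Z p).2 ≠ 0 := by
    rw [Prod.snd_neg, Prod.snd_neg, neg_sub_neg]; exact h1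
  rw [slidingField, slidingField, centralField_neg, e1]
  ext
  · simp only [Prod.fst_add, Prod.smul_fst, Prod.fst_neg, Prod.snd_neg, smul_eq_mul] at h2 ⊢
    field_simp
    ring
  · simp only [Prod.snd_add, Prod.smul_snd, Prod.snd_neg, smul_eq_mul] at h2 ⊢
    field_simp
    ring

variable {σ a r δ c ε M τmin : ℝ} {V W A : Set (ℝ × ℝ)} {φ : ℝ → ℝ → ℝ × ℝ} {τ Q : ℝ → ℝ} {s : ℝ}

/-- The corner estimates give the part `x < 0`; the part `x > 0` is its reflection, under which the
two fields are exchanged up to sign. -/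
theorem LoopData.switchingDynamics (D : LoopData Z σ a r δ c ε M τmin V W φ τ Q)
    (hs : ∃ k > 0, s = k * σ) (hl : (-r, (0 : ℝ)) ∈ A) (hr : (r, (0 : ℝ)) ∈ A)
    (hline : ∀ x, (x, (0 : ℝ)) ∈ A → (|x + a| ≤ δ ∧ x < 0) ∨ (|-x + a| ≤ δ ∧ 0 < x))
    (hlie : 0 < secondLie Z (-r, 0)) : SwitchingDynamics Z (centralField Z) A s r := by
  obtain ⟨k, hk, rfl⟩ := hs
  have C := D.toFoldCorner
  have hdiff : Differentiable ℝ Z := D.contDiff.differentiable one_ne_zero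
  have hfm := D.fold_mem
  have hnr : ((r, 0) : ℝ × ℝ) = -(-r, 0) := by simp
  have hcr : centralField Z (r, 0) = -Z (-r, 0) := by rw [hnr, centralField_neg]
  have hneg : ∀ x, Z (x, 0) = -centralField Z (-x, 0) := fun x => by
    rw [centralField, neg_neg]; simp
  have hneg' : ∀ x, centralField Z (x, 0) = -Z (-x, 0) := fun x => by
    rw [centralField]; simp
  have hleft : ∀ x < 0, (x, (0 : ℝ)) ∈ A → |x + a| ≤ δ := fun x hx hxA => by
    rcases hline x hxA with h | h
    · exact h.1
    · exact absurd hx h.2.le.not_gt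
  have hright : ∀ x > 0, (x, (0 : ℝ)) ∈ A → |-x + a| ≤ δ := fun x hx hxA => by
    rcases hline x hxA with h | h
    · exact absurd hx h.2.le.not_gt
    · exact h.1
  have htan := D.isTangentPoint_fold
  have hlow : ∀ x, |x + a| ≤ δ → 0 < (centralField Z (x, 0)).2 := fun x hx =>
    D.lower_pos _ (mk_zero_mem_cornerBox hx)
  have hmul : ∀ y, 0 < k * σ * y → 0 < σ * y := fun y => (pos_mul_iff hk).1
  have hmul' : ∀ y, k * σ * y < 0 → σ * y < 0 := fun y h => by
    have := (pos_mul_iff (σ := σ) (y := -y) hk).1 (by linarith)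
    linarith
  have hslide : ∀ x, |x + a| ≤ δ → σ * (x + r) < 0 →
      ((Z (x, 0)).2 < 0 ∧ 0 < (centralField Z (x, 0)).2) ∧
        0 < k * σ * (slidingField Z (centralField Z) (x, 0)).1 := fun x hx h => by
    refine ⟨⟨D.attracting x hx h, hlow x hx⟩, ?_⟩
    rw [mul_assoc]
    exact mul_pos hk (D.c_pos.trans_le (C.le_slidingField hx h.le))
  refine
    { left_mem := hl
      left_fold := ⟨htan, hlie, (D.lower_pos' hfm).ne'⟩
      left_crossing := fun x hx hxA h =>
        ⟨D.crossing x (hleft x hx hxA) (hmul _ h), hlow x (hleft x hx hxA)⟩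
      left_sliding := fun x hx hxA h => hslide x (hleft x hx hxA) (hmul' _ h)
      right_mem := hr
      right_fold := ⟨⟨rfl, ?_, ?_⟩, ?_, ?_⟩
      right_crossing := fun x hx hxA h => ?_
      right_sliding := fun x hx hxA h => ?_ }
  · rw [hcr]; exact neg_ne_zero.2 htan.2.1
  · rw [hcr, Prod.snd_neg, htan.2.2, neg_zero]
  · rw [hnr, secondLie_centralField hdiff]; linarith
  · rw [hneg r, Prod.snd_neg]; exact (neg_neg_of_pos (D.lower_pos' hfm)).ne
  · have hx' := hright x hx hxA
    rw [hneg x, hneg' x, Prod.snd_neg, Prod.snd_neg]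
    have h1 := hlow _ hx'
    have h2 := D.crossing _ hx' (hmul (-x + r) (by linarith))
    exact ⟨by linarith, by linarith⟩
  · have hx' := hright x hx hxA
    obtain ⟨⟨h1, h2⟩, h3⟩ := hslide _ hx' (hmul' (-x + r) (by linarith))
    have hsf : slidingField Z (centralField Z) (x, 0) =
        -slidingField Z (centralField Z) (-x, 0) := by
      rw [← slidingField_neg (h1.trans h2).ne]; simp
    rw [hsf, hneg x, hneg' x, Prod.snd_neg, Prod.snd_neg, Prod.fst_neg]
    exact ⟨⟨by linarith, by linarith⟩, by linarith⟩

end Switching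

/-! ### Change of the base parameter -/

section Recentre

variable {m k : ℕ} {f g : ℝ → ℝ → (Fin m → ℝ) → ℝ} {a r σ δ c ε M τmin : ℝ}
  {V W : Set (ℝ × ℝ)} {φ : ℝ → ℝ → ℝ × ℝ} {τ Q : ℝ → ℝ} {α : Fin m → ℝ}

theorem upperField_shift (β : Fin m → ℝ) :
    upperField (fun x y β => f x y (α + β)) (fun x y β => g x y (α + β)) β =
      upperField f g (α + β) := rfl

theorem contDiff_shift {n : WithTop ℕ∞} (hf : ContDiff ℝ n (uncurry₃ f)) :
    ContDiff ℝ n (uncurry₃ fun x y β => f x y (α + β)) :=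
  hf.comp (contDiff_fst.prodMk (contDiff_const.add contDiff_snd))

/-- At a parameter of the bifurcation set, the hypotheses on the unperturbed system hold again. -/
theorem LoopData.foldLoop_shift (hk : k ≠ 0) (hf : ContDiff ℝ k (uncurry₃ f))
    (hg : ContDiff ℝ k (uncurry₃ g)) (D : LoopData (upperField f g α) σ a r δ c ε M τmin V W φ τ Q)
    (hd : Q (-r) = -r) (hlie : 0 < secondLie (upperField f g α) (-r, 0)) :
    FoldLoop k (fun x y β => f x y (α + β)) (fun x y β => g x y (α + β)) r (τ (-r)) (φ (-r)) := by
  have hk1 : (1 : WithTop ℕ∞) ≤ ((k : ℕ∞) : WithTop ℕ∞) := by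
    exact_mod_cast Nat.one_le_iff_ne_zero.2 hk
  have hfm := D.fold_mem
  have hr0 := D.neg_base hfm
  have hfold : g (-r) 0 α = 0 := D.fold
  refine
    { contDiff_f := contDiff_shift hf
      contDiff_g := contDiff_shift hg
      pos := ?_
      time_pos := D.time_pos.trans_le (D.time_ge _ hfm)
      deriv := fun t ht => ?_
      arc_start := D.lift_zero _ hfm
      arc_end := ?_
      arc_pos := D.lift_pos _ hfm (by simp)
      fold := by simpa using hfold
      visible := ?_
      regular := ?_ }
  · have := D.r_mem
    rw [abs_le] at this
    linarith [D.eps_le, D.eps_pos, this.1]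
  · rw [upperField_shift, add_zero]; exact D.lift_deriv _ hfm t ht
  · rw [D.lift_end _ hfm, hd, neg_neg]
  · have hgd := (hg.of_le hk1).differentiable one_ne_zero
    rw [secondLie_upperField (hg.of_le hk1), fderiv_uncurry₃ (hgd _)] at hlie
    simp only [upperField, hfold, Pi.zero_apply, zero_mul, Finset.sum_const_zero, add_zero] at hlie
    simpa [partialX] using hlie
  · have := D.lower_pos' hfm
    simp only [centralField, upperField, Prod.neg_mk, neg_neg,
      neg_zero] at this
    simp only [add_zero]
    linarith

theorem LoopData.loopTrace_fold_eq (D : LoopData (upperField f g α) σ a r δ c ε M τmin V W φ τ Q) :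
    loopTrace σ r φ τ (-r) = symmetricLoop (φ (-r)) (τ (-r)) := by
  have hfm := D.fold_mem
  have hclamp : foldClamp σ r (-r) = -r := foldClamp_of_nonneg (by simp)
  have hhalf : halfTrace σ r φ τ (-r) = φ (-r) '' Icc 0 (τ (-r)) := by
    rw [halfTrace, hclamp, uIcc_self, image_singleton]
    refine union_eq_right.2 (singleton_subset_iff.2
      ⟨0, left_mem_Icc.2 (D.time_pos.le.trans (D.time_ge _ hfm)), D.lift_zero _ hfm⟩)
  ext p
  simp only [loopTrace, hhalf, symmetricLoop, mem_union, mem_ofPred_eq]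
  refine or_congr_right ⟨?_, ?_⟩
  · rintro ⟨t, ht, h⟩
    exact ⟨t, ht, by simp only [h, neg_neg]⟩
  · rintro ⟨t, ht, rfl⟩
    exact ⟨t, ht, by simp only [neg_neg]⟩

/-- The critical crossing cycle is orbitally stable. -/
theorem LoopData.isStableFrom_critical (hk : k ≠ 0) (hf : ContDiff ℝ k (uncurry₃ f))
    (hg : ContDiff ℝ k (uncurry₃ g)) (D : LoopData (upperField f g α) σ a r δ c ε M τmin V W φ τ Q)
    (hd : Q (-r) = -r) (hlie : 0 < secondLie (upperField f g α) (-r, 0))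
    (hW : W ∈ 𝓝ˢ (loopTrace σ r φ τ (-r))) (E : Set (ℝ × ℝ)) :
    IsStableFrom (upperField f g α) (centralField (upperField f g α)) E
      (loopTrace σ r φ τ (-r)) := by
  have hclamp : foldClamp σ r (-r) = -r := foldClamp_of_nonneg (by simp)
  refine D.isStableFrom D.fold_mem (by rw [halfMap, hclamp, hd]) hW (fun V' hV' => ?_) E
  rw [D.loopTrace_fold_eq] at hV' ⊢
  -- The critical loop is the base loop of the family recentred at `α`. Loop data built for it
  -- inside `V'` supply the trapping neighbourhood `W'`.
  have L := D.foldLoop_shift hk hf hg hd hlie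
  obtain ⟨τ', P', φ', hP'⟩ := L.exists_hittingMap hk
  obtain ⟨r', hr'⟩ := L.exists_foldPosition hk
  have hσf : 0 < σ * (fun x y β => f x y (α + β)) (-r) 0 0 := by
    have := D.drift _ (mk_zero_mem_cornerBox (D.fold_mem.trans D.eps_lt.le))
    simp only [add_zero]
    exact D.c_pos.trans_le this
  obtain ⟨V, hV, W', hW', _, _, _, _, _, _, hD⟩ := L.exists_loopData hk hP' hr' D.sign hσf hV'
  have D' := hD.self_of_nhds
  rw [upperField_shift, add_zero] at D'
  exact ⟨W', hW', fun γ T hT hγ h0 =>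
    interior_subset (hV ((D'.enter hT hγ h0).1 T (right_mem_Icc.2 hT)))⟩

end Recentre

/-! ### The change of parameters. -/

section Chart

variable {m k : ℕ}

/-- A function with nonvanishing derivative is the first component of a local chart. -/
theorem exists_chart_of_fderiv_ne_zero [NeZero m] (hk : k ≠ 0) {d : (Fin m → ℝ) → ℝ}
    {θ : Fin m → ℝ} (hd : ContDiffAt ℝ k d 0) (hd0 : d 0 = 0)
    (hder : ∀ e, fderiv ℝ d 0 e = ∑ i, θ i * e i) (hθ : θ ≠ 0) {U : Set (Fin m → ℝ)}
    (hU : U ∈ 𝓝 0) :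
    ∃ ρ : OpenPartialHomeomorph (Fin m → ℝ) (Fin m → ℝ), (0 : Fin m → ℝ) ∈ ρ.source ∧ ρ 0 = 0 ∧
      ContDiffOn ℝ k ρ ρ.source ∧ ContDiffOn ℝ k ρ.symm ρ.target ∧ ρ.source ⊆ U ∧
      ∀ α, ρ α 0 = d α := by
  have hk' : ((k : ℕ∞) : WithTop ℕ∞) ≠ 0 := by exact_mod_cast hk
  obtain ⟨j, hj⟩ := Function.ne_iff.1 hθ
  let proj : Fin m → (Fin m → ℝ) →L[ℝ] ℝ := fun i => ContinuousLinearMap.proj i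
  -- The first slot holds `d`. It can replace the coordinate `j` with `θ j ≠ 0`, so the displaced
  -- coordinate 0 moves to slot `j` and all others stay.
  let F : (Fin m → ℝ) → (Fin m → ℝ) := fun α i =>
    if i = 0 then d α else proj (if i = j then 0 else i) α
  let T : (Fin m → ℝ) →L[ℝ] (Fin m → ℝ) := ContinuousLinearMap.pi fun i =>
    if i = 0 then fderiv ℝ d 0 else proj (if i = j then 0 else i)
  have hF : ContDiffAt ℝ k F 0 := contDiffAt_pi.2 fun i => by
    by_cases h : i = 0
    · simpa only [F, h, if_true] using hd
    · simpa only [F, h, if_false] using (proj (if i = j then 0 else i)).contDiff.contDiffAt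
  have hFT : HasFDerivAt F T 0 := hasFDerivAt_pi.2 fun i => by
    by_cases h : i = 0
    · simpa only [F, h, if_true] using (hd.differentiableAt hk').hasFDerivAt
    · simpa only [F, h, if_false] using (proj (if i = j then 0 else i)).hasFDerivAt
  have hT0 : ∀ e, T e 0 = ∑ i, θ i * e i := fun e => by
    rw [← hder]; simp [T]
  have hTi : ∀ e i, i ≠ 0 → T e i = e (if i = j then 0 else i) := fun e i h => by
    simp [T, h, proj]
  have hinj : Function.Injective T := by
    refine (injective_iff_map_eq_zero T).2 fun e he => ?_
    have h1 : ∀ i, i ≠ j → e i = 0 := fun i hi => by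
      by_cases h0 : i = 0
      · have hj0 : j ≠ 0 := fun h => hi (h0.trans h.symm)
        have := hTi e j hj0
        rw [he, if_pos rfl] at this
        rw [h0, ← this]; rfl
      · have := hTi e i h0
        rw [he, if_neg hi] at this
        exact this.symm
    have h2 : θ j * e j = 0 := by
      rw [← Finset.sum_eq_single (s := Finset.univ) (f := fun i => θ i * e i) j
        (fun i _ hi => by rw [h1 i hi, mul_zero]) (fun h => absurd (Finset.mem_univ j) h),
        ← hT0, he]
      rfl
    funext i
    by_cases hi : i = j
    · rw [hi]; exact (mul_eq_zero.1 h2).resolve_left hj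
    · exact h1 i hi
  let T' : (Fin m → ℝ) ≃L[ℝ] (Fin m → ℝ) :=
    (LinearEquiv.ofInjectiveEndo (T : (Fin m → ℝ) →ₗ[ℝ] (Fin m → ℝ)) hinj).toContinuousLinearEquiv
  have hFT' : HasFDerivAt F (T' : (Fin m → ℝ) →L[ℝ] (Fin m → ℝ)) 0 := by
    convert hFT using 1
    ext1 e
    rfl
  have hF0 : F 0 = 0 := by
    funext i
    by_cases h : i = 0
    · simp only [F, h, if_true, hd0]; rfl
    · simp [F, h, proj]
  let e₀ := hF.toOpenPartialHomeomorph F hFT' hk'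
  have hsymm : ContDiffAt ℝ k e₀.symm (F 0) := hF.to_localInverse hFT' hk'
  have hkω : ((k : ℕ∞) : WithTop ℕ∞) ≠ ((⊤ : ℕ∞) : WithTop ℕ∞) := by
    exact_mod_cast ENat.natCast_ne_top k
  let ρ := (e₀.restrContDiff ℝ k hkω).restr U
  refine ⟨ρ, ⟨⟨hF.mem_toOpenPartialHomeomorph_source hFT' hk', hF, hsymm⟩,
    mem_interior_iff_mem_nhds.2 hU⟩, hF0,
    (e₀.contDiffOn_restrContDiff_source ℝ hkω).mono inter_subset_left,
    (e₀.contDiffOn_restrContDiff_target ℝ hkω).mono inter_subset_left,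
    inter_subset_right.trans interior_subset, fun α => ?_⟩
  change F α 0 = d α
  simp [F]

end Chart

/-! ### Assembly of the bifurcation diagram. -/

section Bifurcation

variable {m k : ℕ} {f g : ℝ → ℝ → (Fin m → ℝ) → ℝ} {a τ₀ σ : ℝ} {γ₀ : ℝ → ℝ × ℝ}

theorem lowerField_eq (f g : ℝ → ℝ → (Fin m → ℝ) → ℝ) (α : Fin m → ℝ) :
    lowerField f g α = centralField (upperField f g α) := rfl

theorem FoldLoop.mem_switchingLine (L : FoldLoop k f g a τ₀ γ₀) {p : ℝ × ℝ}
    (hp : p ∈ symmetricLoop γ₀ τ₀) (hp0 : p.2 = 0) : p = (-a, 0) ∨ p = (a, 0) := by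
  have harc : ∀ t ∈ Icc 0 τ₀, (γ₀ t).2 = 0 → γ₀ t = (-a, 0) ∨ γ₀ t = (a, 0) := fun t ht h => by
    by_cases h0 : t = 0
    · rw [h0]; exact Or.inl L.arc_start
    by_cases h1 : t = τ₀
    · rw [h1]; exact Or.inr L.arc_end
    · exact absurd h (L.arc_pos t ⟨ht.1.lt_of_ne' h0, ht.2.lt_of_ne h1⟩).ne'
  rcases hp with ⟨t, ht, rfl⟩ | ⟨t, ht, rfl⟩
  · exact harc t ht hp0
  · rcases harc t ht (by simpa using hp0) with h | h
    · right; simp only [h]; simp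
    · left; simp only [h]; simp

/-- The loop meets Σ only in `(-a, 0)` and `(a, 0)`, so a neighbourhood can be cut down until its
trace on Σ lies in the two corner boxes, where the dynamics is known. -/
theorem FoldLoop.restrict_mem (L : FoldLoop k f g a τ₀ γ₀) {W : Set (ℝ × ℝ)}
    (hW : W ∈ 𝓝ˢ (symmetricLoop γ₀ τ₀)) {e : ℝ} (he : 0 < e) :
    {p : ℝ × ℝ | p ∈ W ∧ (p.2 = 0 → |p.1 + a| < e ∨ |p.1 - a| < e)} ∈
      𝓝ˢ (symmetricLoop γ₀ τ₀) := by
  rw [mem_nhdsSet_iff_forall] at hW ⊢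
  intro q hq
  refine inter_mem (hW q hq) (?_ : ∀ᶠ p : ℝ × ℝ in 𝓝 q, p.2 = 0 → |p.1 + a| < e ∨ |p.1 - a| < e)
  by_cases h0 : q.2 = 0
  · rcases L.mem_switchingLine hq h0 with rfl | rfl
    · filter_upwards [continuous_fst.continuousAt.eventually (Metric.ball_mem_nhds (-a) he)]
        with p hp _
      left
      simpa [Real.dist_eq] using Metric.mem_ball.1 hp
    · filter_upwards [continuous_fst.continuousAt.eventually (Metric.ball_mem_nhds a he)]
        with p hp _
      exact Or.inr hp
  · filter_upwards [continuous_snd.continuousAt.eventually (isOpen_ne.mem_nhds h0)] with p hp h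
    exact absurd h hp

end Bifurcation

theorem theorem3p1 {m : ℕ} [NeZero m] (k : ℕ) (hk : 3 ≤ k)
    (f g : ℝ → ℝ → (Fin m → ℝ) → ℝ)
    (hf : ContDiff ℝ k (fun q : (ℝ × ℝ) × (Fin m → ℝ) => f q.1.1 q.1.2 q.2))
    (hg : ContDiff ℝ k (fun q : (ℝ × ℝ) × (Fin m → ℝ) => g q.1.1 q.1.2 q.2))
    -- the arc of the unperturbed upper subsystem from `(-a, 0)` to `(a, 0)`
    (a τ₀ : ℝ) (ha : 0 < a) (hτ₀ : 0 < τ₀) (γ₀ : ℝ → ℝ × ℝ)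
    (hγ₀_sol : ∀ t ∈ Icc 0 τ₀, HasDerivWithinAt γ₀ (upperField f g 0 (γ₀ t)) (Icc 0 τ₀) t)
    (hγ₀_start : γ₀ 0 = (-a, 0)) (hγ₀_end : γ₀ τ₀ = (a, 0))
    (hγ₀_pos : ∀ t ∈ Ioo 0 τ₀, 0 < (γ₀ t).2)
    -- `(-a, 0)` is a visible fold and `(a, 0)` a regular point of the upper subsystem
    (hfold : g (-a) 0 0 = 0) (hvisible : 0 < f (-a) 0 0 * partialX g (-a, 0) 0)
    (hregular : g a 0 0 < 0)
    (hθ : thetaCoeff f g γ₀ a τ₀ ≠ 0) :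
    ∃ A₀ ∈ 𝓝ˢ (symmetricLoop γ₀ τ₀), ∀ A ∈ 𝓝ˢ (symmetricLoop γ₀ τ₀), A ⊆ A₀ →
      -- the change of parameters `β = ρ(α)` from `U = ρ.source` onto `V = ρ.target`
      ∃ ρ : OpenPartialHomeomorph (Fin m → ℝ) (Fin m → ℝ),
        (0 : Fin m → ℝ) ∈ ρ.source ∧ ρ 0 = 0 ∧
        ContDiffOn ℝ k ρ ρ.source ∧ ContDiffOn ℝ k ρ.symm ρ.target ∧
        (fun α : Fin m → ℝ => ρ α 0 - ∑ i, thetaCoeff f g γ₀ a τ₀ i * α i)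
          =O[𝓝 0] (fun α : Fin m → ℝ => ‖α‖ ^ 2) ∧
        -- `(∓r(α), 0)` are the regular-folds
        ∃ r : (Fin m → ℝ) → ℝ, ContDiffOn ℝ k r ρ.source ∧ r 0 = a ∧
          ∀ β ∈ ρ.target, ∀ α, α = ρ.symm β →
            SwitchingDynamics (upperField f g α) (lowerField f g α) A (f (-a) 0 0) (r α) ∧
            (f (-a) 0 0 * β 0 < 0 →
              CrossingPhase (upperField f g α) (lowerField f g α) A (f (-a) 0 0) (r α)) ∧
            (β 0 = 0 →
              CriticalPhase (upperField f g α) (lowerField f g α) A (f (-a) 0 0) (r α)) ∧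
            (0 < f (-a) 0 0 * β 0 →
              SlidingPhase (upperField f g α) (lowerField f g α) A (f (-a) 0 0) (r α)) := by
  have hk0 : k ≠ 0 := by omega
  have L : FoldLoop k f g a τ₀ γ₀ :=
    ⟨hf, hg, ha, hτ₀, hγ₀_sol, hγ₀_start, hγ₀_end, hγ₀_pos, hfold, hvisible, hregular⟩
  obtain ⟨τ, P, φ, hP⟩ := L.exists_hittingMap hk0
  obtain ⟨r, hr⟩ := L.exists_foldPosition hk0
  set s := f (-a) 0 0 with hs
  have hs0 : s ≠ 0 := fun h => by rw [h, zero_mul] at hvisible; exact hvisible.false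
  set σ := s / |s| with hσdef
  have hσ : |σ| = 1 := by rw [hσdef, abs_div, abs_abs, div_self (abs_ne_zero.2 hs0)]
  have hsσ : s = |s| * σ := by rw [hσdef, mul_div_cancel₀ _ (abs_ne_zero.2 hs0)]
  have hσs : 0 < σ * s := by
    rw [hσdef, div_mul_eq_mul_div]
    exact div_pos (mul_self_pos.2 hs0) (abs_pos.2 hs0)
  have hks : ∃ l > 0, s = l * σ := ⟨|s|, abs_pos.2 hs0, hsσ⟩
  -- Loop data without any confinement fix `A₀`: uniqueness holds in `W₀`, hence in every `A ⊆ A₀`.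
  -- The second loop data, for `A`, only serve to place the orbit inside `A`.
  obtain ⟨V₀, -, W₀, hW₀, δ₀, hδ₀, c₀, ε₀, M₀, μ₀, hD₀⟩ :=
    L.exists_loopData hk0 hP hr hσ hσs (A := univ) univ_mem
  refine ⟨_, L.restrict_mem hW₀ (lt_min hδ₀ ha), fun A hA hAA₀ => ?_⟩
  obtain ⟨V₁, hV₁, W₁, -, δ₁, -, c₁, ε₁, M₁, μ₁, hD₁⟩ := L.exists_loopData hk0 hP hr hσ hσs hA
  have hAW : A ⊆ W₀ := fun p hp => (hAA₀ hp).1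
  have hk' : ((k : ℕ∞) : WithTop ℕ∞) ≠ 0 := by exact_mod_cast hk0
  have hrc : ContinuousAt r 0 := hr.contDiffAt.continuousAt
  have hrd : ∀ᶠ α in 𝓝 (0 : Fin m → ℝ), ContDiffAt ℝ k r α :=
    hr.contDiffAt.eventually (by exact_mod_cast ENat.natCast_ne_top k)
  have hlie : ∀ᶠ α in 𝓝 (0 : Fin m → ℝ), 0 < secondLie (upperField f g α) (-r α, 0) := by
    have h1 : ContinuousAt (fun α => (((-r α, (0 : ℝ)), α) : (ℝ × ℝ) × (Fin m → ℝ))) 0 :=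
      (hrc.neg.prodMk continuousAt_const).prodMk continuousAt_id
    exact h1.eventually (p := fun q => 0 < secondLie (upperField f g q.2) q.1) (by
      simp only [hr.base]; exact L.eventually_secondLie_pos hk0)
  have hl : ∀ᶠ α in 𝓝 (0 : Fin m → ℝ), (-r α, (0 : ℝ)) ∈ A := by
    have h1 : ContinuousAt (fun α => (-r α, (0 : ℝ))) 0 := hrc.neg.prodMk continuousAt_const
    refine h1.eventually (p := fun q => q ∈ A) ?_
    simp only [hr.base]
    exact mem_nhdsSet_iff_forall.1 hA _ (Or.inl ⟨0, left_mem_Icc.2 hτ₀.le, hγ₀_start⟩)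
  have hright : ∀ᶠ α in 𝓝 (0 : Fin m → ℝ), (r α, (0 : ℝ)) ∈ A := by
    have h1 : ContinuousAt (fun α => (r α, (0 : ℝ))) 0 := hrc.prodMk continuousAt_const
    refine h1.eventually (p := fun q => q ∈ A) ?_
    simp only [hr.base]
    exact mem_nhdsSet_iff_forall.1 hA _ (Or.inl ⟨τ₀, right_mem_Icc.2 hτ₀.le, hγ₀_end⟩)
  have hdd := contDiffAt_displacement hP hr
  have hd0 := displacement_zero hP hr
  have hder := fderiv_displacement hk0 hP hr
  obtain ⟨ρ, hρ0, hρ00, hρ1, hρ2, hρU, hρd⟩ := exists_chart_of_fderiv_ne_zero hk0 hdd hd0 hder hθ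
    (hD₀.and (hD₁.and (hrd.and (hlie.and (hl.and hright)))))
  refine ⟨ρ, hρ0, hρ00, hρ1, hρ2, ?_, r, fun α hα => (hρU hα).2.2.1.contDiffWithinAt, hr.base,
    fun β hβ α hα => ?_⟩
  · have hk2 : (((2 : ℕ) : ℕ∞) : WithTop ℕ∞) ≤ ((k : ℕ∞) : WithTop ℕ∞) := by
      exact_mod_cast (by omega : 2 ≤ k)
    have := isBigO_sub_fderiv_of_contDiffAt (hdd.of_le hk2)
    simpa only [hd0, sub_zero, hder, ← hρd] using this
  have hαs : α ∈ ρ.source := by rw [hα]; exact ρ.map_target hβ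
  have hβd : β 0 = displacement P r α := by rw [← hρd, hα, ρ.right_inv hβ]
  obtain ⟨D₀, D₁, -, hlie, hl, hright⟩ := hρU hαs
  rw [lowerField_eq]
  obtain ⟨x₁, hx₁, hfix₁⟩ := D₁.exists_fixedPoint
  obtain ⟨x, hx, hfix⟩ := D₀.exists_fixedPoint
  -- The loop of `D₁` lies in the interior of `A`, hence in `W₀`, where uniqueness identifies it
  -- with the loop of `D₀`.
  have hΓ : loopTrace σ (r α) (fun x => φ (x, α)) (fun x => τ (x, α)) x ⊆ interior A := by
    have h1 := (D₁.loopTrace_subset hx₁).trans hV₁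
    rwa [D₀.periodic_unique hx hfix (D₁.isPeriodicOrbit hx₁ hfix₁)
      (h1.trans (interior_subset.trans hAW))] at h1
  -- The minus sign is the reason why crossing cycles belong to negative, and sliding cycles to
  -- positive, values of `s * β 0`.
  have hdisp : -P (-r α, α) + r α = -β 0 := by rw [hβd, displacement]; ring
  have hsign : ∀ y, 0 < s * y ↔ 0 < σ * y := fun y => by
    conv_lhs => rw [hsσ]
    exact LoopData.pos_mul_iff (abs_pos.2 hs0)
  refine ⟨D₀.switchingDynamics hks hl hright (fun x hx => ?_) hlie, fun h => ?_, fun h => ?_,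
    fun h => ?_⟩
  · rcases (hAA₀ hx).2 rfl with h | h
    · refine Or.inl ⟨(h.trans_le (min_le_left _ _)).le, ?_⟩
      linarith [(abs_lt.1 (h.trans_le (min_le_right _ _))).2]
    · refine Or.inr ⟨?_, ?_⟩
      · rw [neg_add_eq_sub, abs_sub_comm]
        exact (h.trans_le (min_le_left _ _)).le
      · linarith [(abs_lt.1 (h.trans_le (min_le_right _ _))).1]
  · refine D₀.crossingPhase hx hfix hks hΓ hAW ?_
    rw [hdisp, ← hsign]
    linarith
  · have hQ : -P (-r α, α) = -r α := by linarith
    refine D₀.criticalPhase hx hfix hΓ hAW hQ fun E => ?_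
    have hxr := D₀.critical_of_displacement hx hfix hQ
    rw [hxr] at hΓ ⊢
    exact D₀.isStableFrom_critical hk0 hf hg hQ hlie
      (mem_of_superset (isOpen_interior.mem_nhdsSet.2 hΓ) (interior_subset.trans hAW)) E
  · refine D₀.slidingPhase hx hfix hks hΓ hAW ?_
    rw [hdisp]
    have := (hsign _).1 h
    linarith
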